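/- **Setting.** Let $(S_e)_{e\in\{0,1\}^*}$ be a family of settings named by binary strings. The setting $S_e$ consists of a nonempty set $\mathcal X_e$, an integer $v_e\ge 0$, a (possibly empty) family $\mathcal F_e$ of functions $f:\mathcal X_e\to[0,v_e]$, and injective encodings of $\mathcal F_e$ and of $\mathcal X_e$ by strings of $b_e$ bits. No computability of the functions is assumed. *Offline problem.* Let $C,c>0$ be constants. An instance consists of a name $e$, the number $v_e$ in unary, and an explicit description of a distribution $D$ over $\mathcal F_e$: the list of the $b_e$-bit indices of the (distinct) functions in its finite nonempty support together with their probabilities, which are positive rationals written over a common denominator in binary. With $|D|$ the size of the support of $D$, a solution is (the index of) a point $x\in\mathcal X_e$ with $$\mathbb E_{f\sim D}[f(x)]\ \ge\ \max_{y\in\mathcal X_e}\mathbb E_{f\sim D}[f(y)]-\frac{C}{|D|^{c}} .$$ The problem is NP-hard if every language in NP reduces to it by a polynomial-time Turing (Cook) reduction, that is, one which is correct with every oracle that answers each instance by some solution. *Learners.* A learner is a randomized algorithm that is given $e$, $b_e,v_e,T$ in unary and, at step $t\le T$, the indices of $f_1,\dots,f_{t-1}\in\mathcal F_e$, and outputs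 (the index of) a point $x_t\in\mathcal X_e$; its running time over all $T$ steps, and the number of its random bits, are polynomial in $|e|,b_e,v_e,T$ (in particular, this allows every running time polynomial in $b_e$, $v_e$ and $T$, apart from reading its input). It has polynomial regret if there are a polynomial $q$ and a constant $\kappa>0$ such that for all $e$, all $T\ge1$ and all sequences $f_1,\dots,f_T\in\mathcal F_e$ $$\mathbb E\Big[\sup_{x\in\mathcal X_e}\frac1T\sum_{t=1}^T\big(f_t(x)-f_t(x_t)\big)\Big]\ \le\ \frac{q(b_e+v_e)}{T^{\kappa}} .$$ **Theorem.** Suppose that for some constants $C,c>0$ the offline problem is NP-hard. Then, unless $\mathrm{RP}\supseteq\mathrm{NP}$, there is no learner with polynomial regret. (The guarantee is required only against sequences fixed in advance; hence there is also no learner with this guarantee against adaptive adversaries.) -/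

import Mathlib

namespace OnlineTransfer

/-! ### Polynomial time, NP, RP -/

/-- Binary words. -/
abbrev Word := List Bool

/-- A finite sequence of binary words, written out with the terminator `none` after each word. -/
def encodeWords : List Word → List (Option Bool)
  | [] => []
  | w :: ws => w.map some ++ none :: encodeWords ws

/-- `f` is computable by a (multi-stack) Turing machine in time polynomial in the length of the
encoded input. -/
def PolyTime (f : List Word → List Word) : Prop :=
  Nonempty (Turing.TM2ComputableInPolyTime encodeWords encodeWords f)

/-- The number `n` in unary. -/
def unary (n : ℕ) : Word := List.replicate n true

/-- The expectation of `g` over a uniformly random word of `n` bits. -/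
noncomputable def coinExpect (n : ℕ) (g : Word → ℝ) : ℝ :=
  (∑ r : Fin n → Bool, g (List.ofFn r)) / 2 ^ n

/-- The class NP: polynomial-time verifiers and witnesses of polynomial length. -/
def InNP (L : Language Bool) : Prop :=
  ∃ (V : List Word → List Word) (p : Polynomial ℕ), PolyTime V ∧
    ∀ x : Word, x ∈ L ↔ ∃ w : Word, w.length ≤ p.eval x.length ∧ V [x, w] = [[true]]

open Classical in
/-- The class RP: a polynomial-time machine with polynomially many random bits that accepts every
member with probability at least `1 / 2` and never accepts a non-member. -/
def InRP (L : Language Bool) : Prop :=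
  ∃ (M : List Word → List Word) (p : Polynomial ℕ), PolyTime M ∧
    ∀ x : Word,
      (x ∈ L → 1 / 2 ≤ coinExpect (p.eval x.length)
        fun r => if M [x, r] = [[true]] then 1 else 0) ∧
      (x ∉ L → ∀ r : Word, r.length = p.eval x.length → M [x, r] ≠ [[true]])

/-! ### NP-hard search problems -/

/-- A search problem: a set of instances, and the solutions of each instance. -/
structure SearchProblem where
  IsInstance : List Word → Prop
  IsSolution : List Word → Word → Prop

/-- The oracle `O` solves `P`: it answers every instance of `P` by one of its solutions. On other
strings it is arbitrary. -/
def SearchProblem.SolvedBy (P : SearchProblem) (O : List Word → Word) : Prop :=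
  ∀ I, P.IsInstance I → P.IsSolution I (O I)

/-- The oracle computation on input `x` whose next move, after the answers `h` to the earlier
queries, is `R (x :: h)`. A move `[] :: q` asks the oracle the query `q`; the move `[[a]]` halts
with verdict `a`. `RunsTo P R O x a B n h` says that, continued after the answers `h`, the
computation halts with verdict `a` after at most `n` more queries, each of which is an instance
of `P` of encoded length at most `B`. -/
def RunsTo (P : SearchProblem) (R : List Word → List Word) (O : List Word → Word)
    (x : Word) (a : Bool) (B : ℕ) : ℕ → List Word → Prop
  | 0, h => R (x :: h) = [[a]]
  | n + 1, h => R (x :: h) = [[a]] ∨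
      ∃ q : List Word, R (x :: h) = [] :: q ∧ P.IsInstance q ∧ (encodeWords q).length ≤ B ∧
        RunsTo P R O x a B n (h ++ [O q])

/-- `L` has a polynomial-time Turing (Cook) reduction to the search problem `P`: with every oracle
that solves `P`, the computation decides `L`, in polynomially many polynomial-time moves with
queries of polynomial length. -/
def TuringReduces (L : Language Bool) (P : SearchProblem) : Prop :=
  ∃ (R : List Word → List Word) (p : Polynomial ℕ), PolyTime R ∧
    ∀ O : List Word → Word, P.SolvedBy O → ∀ x : Word,
      ∃ a : Bool, (a = true ↔ x ∈ L) ∧ RunsTo P R O x a (p.eval x.length) (p.eval x.length) []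

/-- A search problem is NP-hard if every language in NP reduces to it. -/
def SearchProblem.NPHard (P : SearchProblem) : Prop :=
  ∀ L : Language Bool, InNP L → TuringReduces L P

/-! ### Families of functions, explicit distributions, the offline problem -/

/-- A family `F` of functions `X → [0, v]`, with an indexing of `F` and of `X` by `b` bits. -/
structure Setting where
  X : Type
  nonempty_X : Nonempty X
  v : ℕ
  F : Set (X → ℝ)
  mem_range : ∀ f ∈ F, ∀ x, f x ∈ Set.Icc (0 : ℝ) v
  b : ℕ
  codeX : X → Word
  codeX_injective : Function.Injective codeX
  length_codeX : ∀ x, (codeX x).length = b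
  codeF : F → Word
  codeF_injective : Function.Injective codeF
  length_codeF : ∀ f, (codeF f).length = b

/-- An explicitly given distribution over `F`: the list of the functions in its support, each with
a positive integer weight. The probability of a function is its weight divided by the total
weight (that is, the probabilities are rational numbers written over a common denominator). -/
structure ExplicitDist (S : Setting) where
  entries : List (S.F × ℕ)
  entries_ne_nil : entries ≠ []
  nodup : (entries.map Prod.fst).Nodup
  weight_pos : ∀ a ∈ entries, 0 < a.2

namespace ExplicitDist

variable {S : Setting}

/-- The size of the support. -/
def supportSize (D : ExplicitDist S) : ℕ := D.entries.length

/-- The sum of all weights. -/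
def totalWeight (D : ExplicitDist S) : ℕ := (D.entries.map Prod.snd).sum

/-- The expected value of `f x` for `f` drawn from `D`. -/
noncomputable def expect (D : ExplicitDist S) (x : S.X) : ℝ :=
  (D.entries.map fun a => (a.2 : ℝ) / D.totalWeight * a.1.1 x).sum

/-- `x` maximizes the expected value under `D` up to an additive `ε`. -/
def IsApproxOpt (D : ExplicitDist S) (ε : ℝ) (x : S.X) : Prop :=
  ∀ y : S.X, D.expect y - ε ≤ D.expect x

/-- The list of the indices of the functions in the support and their weights in binary. -/
def describe (D : ExplicitDist S) : List Word :=
  D.entries.flatMap fun a => [S.codeF a.1, Computability.encodeNat a.2]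

end ExplicitDist

/-- The problem of best-responding approximately to an explicit distribution, for the settings
`S e`: given the name `e` of a setting, its range bound `v` in unary and an explicit distribution
`D` over its functions, find (the index of) a point whose expected value is optimal up to an
additive `C / |D| ^ c`, where `|D|` is the size of the support of `D`. -/
def offlineProblem (S : Word → Setting) (C c : ℝ) : SearchProblem where
  IsInstance I := ∃ (e : Word) (D : ExplicitDist (S e)), I = e :: unary (S e).v :: D.describe
  IsSolution I w := ∃ (e : Word) (D : ExplicitDist (S e)) (x : (S e).X),
    I = e :: unary (S e).v :: D.describe ∧ w = (S e).codeX x ∧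
      D.IsApproxOpt (C / (D.supportSize : ℝ) ^ c) x

/-! ### Online learners -/

/-- A randomized polynomial-time online learning algorithm for the settings `S e`. It knows the
name `e` of the setting, the numbers `b`, `v`, `T` in unary, its random bits `r` and the list
`h` of (indices of) the functions of the earlier steps, and plays the point `play e T r h`. Its
earlier moves are determined by `r` and `h`. The move is computed by a single algorithm `act` in
polynomial time, and the number of random bits is polynomial. Nothing is required on strings `e`
that name no proper setting, that is, where the family of functions is empty. -/
structure Learner (S : Word → Setting) where
  act : List Word → List Word
  act_polyTime : PolyTime act
  coins : Polynomial ℕ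
  play : (e : Word) → (T : ℕ) → (r : Word) → (h : List (S e).F) → (S e).X
  act_eq : ∀ (e : Word) (T : ℕ) (r : Word) (h : List (S e).F), (S e).F.Nonempty →
    r.length = coins.eval (e.length + (S e).b + (S e).v + T) → h.length < T →
      act (e :: unary (S e).b :: unary (S e).v :: unary T :: r :: h.map (S e).codeF) =
        [(S e).codeX (play e T r h)]

namespace Learner

variable {S : Word → Setting}

/-- The expected average regret in the setting `S e` against the sequence `f` of functions: the
expectation, over the random bits, of
`sup_x (1 / T) * ∑ t, (f t x - f t (x_t))`, where `x_t` is the move after `f 0, …, f (t - 1)`. -/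
noncomputable def regret (A : Learner S) (e : Word) (T : ℕ) (f : Fin T → (S e).F) : ℝ :=
  coinExpect (A.coins.eval (e.length + (S e).b + (S e).v + T)) fun r =>
    ⨆ x : (S e).X, (1 / (T : ℝ)) *
      ∑ t : Fin T, ((f t).1 x - (f t).1 (A.play e T r ((List.ofFn f).take t)))

/-- Polynomial regret rate: after `T` steps the regret against every sequence of functions is at
most `q(b + v) / T ^ κ`, for a polynomial `q` and an exponent `κ > 0` that depend neither on the
setting nor on `T`. -/
def HasPolyRegret (A : Learner S) : Prop :=
  ∃ (q : Polynomial ℕ) (κ : ℝ), 0 < κ ∧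
    ∀ (e : Word) (T : ℕ), 1 ≤ T → ∀ f : Fin T → (S e).F,
      A.regret e T f ≤ ((q.eval ((S e).b + (S e).v) : ℕ) : ℝ) / (T : ℝ) ^ κ

end Learner

end OnlineTransfer

/-!
A learner with small regret solves the offline problem. If it plays against functions drawn
independently from a distribution `D`, the function of a step is independent of the move in this
step, so the regret bound says that on average over the steps the expected value of the move is
nearly optimal for `D`. Hence the move in a random step is good with high probability
(`Learner.coinExpect_answer_le`), and `T` polynomial in the length of the instance and in the
wanted precision suffices (`Learner.exists_answer`). The functions are drawn by reducing a long
random number modulo the total weight.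

A Turing reduction of a language to the offline problem is then run with each query answered in this
way. An oracle is a function, so repeated queries have to get the same answer: the simulation keeps
a table, and its invariant (`OracleInv`) speaks of all solving oracles that agree with the table.
This decides every language in NP with small two-sided error (`Learner.exists_decider`). Two-sided
error becomes one-sided by searching for a witness: the language of the prefixes of witnesses is in
NP as well, deciding it gives a witness bit by bit, and the witness is verified before acceptance
(`Learner.inRP`).

All these algorithms have to be polynomial-time Turing machines. Programs for multi-stack machines
are composed of relocatable fragments (`Frag`, `Runs`) that may call given machines as subroutines.
They show that polynomial-time computability is closed under composition, pairing, case distinction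
and iteration with polynomially bounded states. With these rules, formulated for the predicate `PT`
on functions between types with an encoding by words, `fun_prop` derives that the functions defined
afterwards are computable in polynomial time.
-/

namespace OnlineTransfer

open Turing Function

set_option linter.unusedSectionVars false

/-! ### Programs for multi-stack machines with subroutines -/

/-- The alphabet of all registers. -/
abbrev Sym := Option Bool

/-- `Reach f n a b`: `n` steps of the partial function `f` lead from `a` to `b`. -/
def Reach {α : Type*} (f : α → Option α) (n : ℕ) (a b : α) : Prop :=
  (flip bind f)^[n] (some a) = some b

theorem Reach.refl {α : Type*} (f : α → Option α) (a : α) : Reach f 0 a a := rfl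

theorem Reach.head {α : Type*} {f : α → Option α} {n : ℕ} {a b c : α} (h : f a = some b)
    (h' : Reach f n b c) : Reach f (n + 1) a c := by
  unfold Reach at *
  rw [iterate_succ_apply]
  simpa [flip, h] using h'

theorem Reach.trans {α : Type*} {f : α → Option α} {m n : ℕ} {a b c : α} (h : Reach f m a b)
    (h' : Reach f n b c) : Reach f (m + n) a c := by
  unfold Reach at *
  rw [add_comm, iterate_add_apply, h, h']

theorem Reach.exists_step {α : Type*} {f : α → Option α} {n : ℕ} {a c : α}
    (h : Reach f (n + 1) a c) : ∃ b, f a = some b ∧ Reach f n b c := by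
  unfold Reach at *
  rw [iterate_succ_apply] at h
  rcases hb : f a with _ | b
  · have : ∀ n, (flip bind f)^[n] none = none := by
      intro n
      induction n with
      | zero => rfl
      | succ n ih => rw [iterate_succ_apply]; simpa [flip] using ih
    simp [flip, hb] at h
    change (flip bind f)^[n] none = _ at h
    rw [this] at h
    cases h
  · exact ⟨b, rfl, by simpa [flip, hb] using h⟩

section Frag

variable {R I : Type} [DecidableEq R] [DecidableEq I] (B : I → TM2ComputableAux Sym Sym)

/-- The stacks of a program with registers `R` and subroutines `B`: the registers, and the stacks of
the machines `B i`. -/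
abbrev Stk (R : Type) (B : I → TM2ComputableAux Sym Sym) : Type := R ⊕ (Σ i, (B i).tm.K)

/-- The alphabets of the stacks. -/
abbrev Alph (R : Type) (B : I → TM2ComputableAux Sym Sym) : Stk R B → Type
  | .inl _ => Sym
  | .inr x => (B x.1).tm.Γ x.2

/-- The internal states: those of the subroutines, and the symbol that was popped last. -/
abbrev Sta (B : I → TM2ComputableAux Sym Sym) : Type := (∀ i, (B i).tm.σ) × Option Sym

/-- The contents of all stacks, given by those of the registers and those of the subroutines. -/
def contents (s : R → List Sym) (T : ∀ i, ∀ k, List ((B i).tm.Γ k)) : ∀ k, List (Alph R B k)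
  | .inl r => s r
  | .inr x => T x.1 x.2

/-- The initial states of all subroutines. -/
def initSta : ∀ i, (B i).tm.σ := fun i => (B i).tm.initialState

/-- Empty stacks for all subroutines. -/
def emptyStk : ∀ i, ∀ k, List ((B i).tm.Γ k) := fun _ _ => []

variable {B}

@[simp] theorem contents_inl (s : R → List Sym) (T) (r : R) : contents B s T (.inl r) = s r := rfl

@[simp] theorem contents_inr (s : R → List Sym) (T) (i : I) (k) :
    contents B s T (.inr ⟨i, k⟩) = T i k := rfl

theorem update_contents_inl (s : R → List Sym) (T) (r : R) (x : List Sym) :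
    update (contents B s T) (.inl r) x = contents B (update s r x) T := by
  funext k
  rcases k with r' | ⟨i, k⟩
  · by_cases h : r' = r
    · subst h; simp
    · simp [h]
  · simp

theorem update_contents_inr (s : R → List Sym) (T) (i : I) (k) (x : List ((B i).tm.Γ k)) :
    update (contents B s T) (.inr ⟨i, k⟩) x = contents B s (update T i (update (T i) k x)) := by
  funext k'
  rcases k' with r' | ⟨j, k'⟩
  · simp
  · by_cases h : j = i
    · subst h
      by_cases h : k' = k
      · subst h; simp
      · have : (Sum.inr ⟨j, k'⟩ : Stk R B) ≠ .inr ⟨j, k⟩ := by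
          intro h'; apply h; simpa using h'
        simp [h, this]
    · have : (Sum.inr ⟨j, k'⟩ : Stk R B) ≠ .inr ⟨i, k⟩ := by
        intro h'; apply h; simp at h'; exact h'.1
      simp [h, this]

variable (R B) in
/-- A program fragment: finitely many labels with one entry, and code that is relocatable: it is
written for any placement of the labels among those of a larger program, and for any exit. -/
structure Frag where
  Lab : Type
  [fin : Fintype Lab]
  entry : Lab
  code : ∀ {Λ : Type}, (Lab → Λ) → Λ → Lab → TM2.Stmt (Alph R B) Λ (Sta B)

instance (p : Frag R B) : Fintype p.Lab := p.fin

/-- The configuration between two fragments: the subroutines are at rest. -/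
def restCfg {Λ : Type} (l : Λ) (o : Option Sym) (s : R → List Sym) :
    TM2.Cfg (Alph R B) Λ (Sta B) :=
  ⟨some l, (initSta B, o), contents B s (emptyStk B)⟩

/-- In every program that contains the fragment `p`, it leads from the register contents `s` to `s'`
in at most `t` steps. -/
def Runs (p : Frag R B) (s s' : R → List Sym) (t : ℕ) : Prop :=
  ∀ (Λ : Type) (m : Λ → TM2.Stmt (Alph R B) Λ (Sta B)) (inj : p.Lab → Λ) (exit : Λ),
    (∀ l, m (inj l) = p.code inj exit l) → ∀ o, ∃ n ≤ t, ∃ o',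
      Reach (TM2.step m) n (restCfg (inj p.entry) o s) (restCfg exit o' s')

theorem Runs.mono {p : Frag R B} {s s' : R → List Sym} {t t' : ℕ} (h : Runs p s s' t)
    (ht : t ≤ t') : Runs p s s' t' := by
  intro Λ m inj exit hm o
  obtain ⟨n, hn, o', hr⟩ := h _ m inj exit hm o
  exact ⟨n, hn.trans ht, o', hr⟩

namespace Frag

/-- Push the symbol `a` on register `r`. -/
def push (r : R) (a : Sym) : Frag R B where
  Lab := Unit
  entry := ()
  code _ exit _ := .push (.inl r) (fun _ => a) (.goto fun _ => exit)

/-- Pop register `r` and continue depending on the result. -/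
def pop (r : R) (c : Option Sym → Frag R B) : Frag R B where
  Lab := Option (Σ o, (c o).Lab)
  entry := none
  code inj exit
    | none => .pop (.inl r) (fun v o => (v.1, o)) (.goto fun v => inj (some ⟨v.2, (c v.2).entry⟩))
    | some ⟨o, l⟩ => (c o).code (fun l => inj (some ⟨o, l⟩)) exit l

/-- Do nothing. -/
def skip : Frag R B where
  Lab := Unit
  entry := ()
  code _ exit _ := .goto fun _ => exit

/-- One fragment after the other. -/
def seq (p q : Frag R B) : Frag R B where
  Lab := p.Lab ⊕ q.Lab
  entry := .inl p.entry
  code inj exit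
    | .inl l => p.code (fun l => inj (.inl l)) (inj (.inr q.entry)) l
    | .inr l => q.code (fun l => inj (.inr l)) exit l

/-- As long as register `r` is nonempty, repeat `p`. -/
def loop (r : R) (p : Frag R B) : Frag R B where
  Lab := Option p.Lab
  entry := none
  code inj exit
    | none => .peek (.inl r) (fun v o => (v.1, o))
        (.goto fun v => if v.2 = none then exit else inj (some p.entry))
    | some l => p.code (fun l => inj (some l)) (inj none) l

/-- The code of a subroutine inside a larger program, with a jump in place of halting. -/
def embed (i : I) {Λ : Type} (inj : (B i).tm.Λ → Λ) (exit : Λ) :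
    TM2.Stmt (B i).tm.Γ (B i).tm.Λ (B i).tm.σ → TM2.Stmt (Alph R B) Λ (Sta B)
  | .push k f q => .push (.inr ⟨i, k⟩) (fun v => f (v.1 i)) (embed i inj exit q)
  | .peek k f q => .peek (.inr ⟨i, k⟩) (fun v o => (update v.1 i (f (v.1 i) o), v.2))
      (embed i inj exit q)
  | .pop k f q => .pop (.inr ⟨i, k⟩) (fun v o => (update v.1 i (f (v.1 i) o), v.2))
      (embed i inj exit q)
  | .load f q => .load (fun v => (update v.1 i (f (v.1 i)), v.2)) (embed i inj exit q)
  | .branch f q q' => .branch (fun v => f (v.1 i)) (embed i inj exit q) (embed i inj exit q')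
  | .goto f => .goto fun v => inj (f (v.1 i))
  | .halt => .goto fun _ => exit

/-- Move the word in register `r` to the input stack of `B i`, and jump. -/
def feed (i : I) (r : R) {Λ : Type} (self exit : Λ) : TM2.Stmt (Alph R B) Λ (Sta B) :=
  .pop (.inl r) (fun v o => (v.1, o)) (.branch (fun v => v.2.isSome)
    (.push (.inr ⟨i, (B i).tm.k₀⟩) (fun v => (B i).inputAlphabet.symm (v.2.getD none))
      (.goto fun _ => self))
    (.goto fun _ => exit))

/-- Move the word on the output stack of `B i` to register `r`, and jump. -/
def drain (i : I) (r : R) {Λ : Type} (self exit : Λ) : TM2.Stmt (Alph R B) Λ (Sta B) :=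
  .pop (.inr ⟨i, (B i).tm.k₁⟩) (fun v o => (v.1, o.map (B i).outputAlphabet))
    (.branch (fun v => v.2.isSome)
      (.push (.inl r) (fun v => v.2.getD none) (.goto fun _ => self))
      (.goto fun _ => exit))

/-- Run the subroutine `B i` on the reverse of the word in register `r`, and replace this word by
the reverse of the output. -/
def call (i : I) (r : R) : Frag R B where
  Lab := Bool ⊕ (B i).tm.Λ
  fin := @instFintypeSum _ _ _ (B i).tm.ΛFin
  entry := .inl true
  code inj exit
    | .inl true => feed i r (inj (.inl true)) (inj (.inr (B i).tm.main))
    | .inl false => drain i r (inj (.inl false)) exit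
    | .inr l => embed i (fun l => inj (.inr l)) (inj (.inl false)) ((B i).tm.m l)

end Frag

theorem Runs.push {r : R} {a : Sym} {s s' : R → List Sym} (h : s' = update s r (a :: s r)) :
    Runs (B := B) (.push r a) s s' 1 := by
  intro Λ m inj exit hm o
  subst h
  refine ⟨1, le_rfl, o, Reach.head ?_ (Reach.refl _ _)⟩
  change some (TM2.stepAux (m _) _ _) = _
  rw [hm]
  simp [restCfg, Frag.push, update_contents_inl]

theorem Runs.skip {s : R → List Sym} : Runs (B := B) .skip s s 1 := by
  intro Λ m inj exit hm o
  refine ⟨1, le_rfl, o, Reach.head ?_ (Reach.refl _ _)⟩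
  change some (TM2.stepAux (m _) _ _) = _
  rw [hm]
  simp [restCfg, Frag.skip]

theorem Runs.pop {r : R} {c : Option Sym → Frag R B} {s s' : R → List Sym} {t : ℕ}
    (h : Runs (c (s r).head?) (update s r (s r).tail) s' t) : Runs (.pop r c) s s' (t + 1) := by
  intro Λ m inj exit hm o
  obtain ⟨n, hn, o', hr⟩ := h _ m (fun l => inj (some ⟨_, l⟩)) exit
    (fun l => hm (some ⟨_, l⟩)) (s r).head?
  refine ⟨n + 1, by omega, o', Reach.head ?_ hr⟩
  change some (TM2.stepAux (m _) _ _) = _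
  rw [hm]
  simp [restCfg, Frag.pop, update_contents_inl]

theorem Runs.pop_cons {r : R} {c : Option Sym → Frag R B} {s s' : R → List Sym} {t : ℕ} {a : Sym}
    {u : List Sym} (hs : s r = a :: u)
    (h : Runs (c (some a)) (update s r u) s' t) : Runs (.pop r c) s s' (t + 1) := by
  apply Runs.pop
  simpa [hs] using h

theorem Runs.pop_nil {r : R} {c : Option Sym → Frag R B} {s s' : R → List Sym} {t : ℕ}
    (hs : s r = []) (h : Runs (c none) s s' t) : Runs (.pop r c) s s' (t + 1) := by
  apply Runs.pop
  have : update s r [] = s := by rw [← hs]; simp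
  simpa [hs, this] using h

theorem Runs.seq {p q : Frag R B} {s s' s'' : R → List Sym} {t t' : ℕ} (h : Runs p s s' t)
    (h' : Runs q s' s'' t') : Runs (.seq p q) s s'' (t + t') := by
  intro Λ m inj exit hm o
  obtain ⟨n, hn, o', hr⟩ := h _ m (fun l => inj (.inl l)) (inj (.inr q.entry))
    (fun l => hm (.inl l)) o
  obtain ⟨n', hn', o'', hr'⟩ := h' _ m (fun l => inj (.inr l)) exit
    (fun l => hm (.inr l)) o'
  exact ⟨n + n', by omega, o'', hr.trans hr'⟩

theorem Runs.loop_nil {r : R} {p : Frag R B} {s : R → List Sym} (hs : s r = []) :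
    Runs (.loop r p) s s 1 := by
  intro Λ m inj exit hm o
  refine ⟨1, le_rfl, none, Reach.head ?_ (Reach.refl _ _)⟩
  change some (TM2.stepAux (m _) _ _) = _
  rw [hm]
  simp [restCfg, Frag.loop, hs]

theorem Runs.loop_step {r : R} {p : Frag R B} {s s' s'' : R → List Sym} {t t' : ℕ}
    (hs : s r ≠ []) (h : Runs p s s' t) (h' : Runs (.loop r p) s' s'' t') :
    Runs (.loop r p) s s'' (t + t' + 1) := by
  intro Λ m inj exit hm o
  obtain ⟨n, hn, o', hr⟩ := h _ m (fun l => inj (some l)) (inj none)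
    (fun l => hm (some l)) (s r).head?
  obtain ⟨n', hn', o'', hr'⟩ := h' _ m inj exit hm o'
  refine ⟨n + n' + 1, by omega, o'', Reach.head ?_ (hr.trans hr')⟩
  change some (TM2.stepAux (m _) _ _) = _
  rw [hm]
  simp [restCfg, Frag.loop, hs]

/-- A configuration of a subroutine, seen as one of the whole program. -/
def embedCfg (i : I) {Λ : Type} (inj : (B i).tm.Λ → Λ) (exit : Λ) (o : Option Sym)
    (s : R → List Sym) (c : TM2.Cfg (B i).tm.Γ (B i).tm.Λ (B i).tm.σ) :
    TM2.Cfg (Alph R B) Λ (Sta B) :=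
  ⟨some (c.l.elim exit inj), (update (initSta B) i c.var, o),
    contents B s (update (emptyStk B) i c.stk)⟩

theorem stepAux_embed (i : I) {Λ : Type} (inj : (B i).tm.Λ → Λ) (exit : Λ) (o : Option Sym)
    (s : R → List Sym) (q : TM2.Stmt (B i).tm.Γ (B i).tm.Λ (B i).tm.σ) (v) (S) :
    TM2.stepAux (Frag.embed i inj exit q) (update (initSta B) i v, o)
        (contents B s (update (emptyStk B) i S)) =
      embedCfg i inj exit o s (TM2.stepAux q v S) := by
  induction q generalizing v S with
  | push k f q ih => simp [Frag.embed, update_contents_inr, ← ih]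
  | peek k f q ih => simp [Frag.embed, ← ih]
  | pop k f q ih => simp [Frag.embed, update_contents_inr, ← ih]
  | load f q ih => simp [Frag.embed, ← ih]
  | branch f q q' ih ih' =>
    simp only [Frag.embed, TM2.stepAux, update_self]
    cases f v <;> simp [ih, ih']
  | goto f => simp [Frag.embed, embedCfg]
  | halt => simp [Frag.embed, embedCfg]

/-- A subroutine with its code embedded runs as it does on its own, and leaves everything else
unchanged. -/
theorem reach_embed (i : I) {Λ : Type} {inj : (B i).tm.Λ → Λ} {exit : Λ} (o : Option Sym)
    (s : R → List Sym) (m : Λ → TM2.Stmt (Alph R B) Λ (Sta B))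
    (hm : ∀ l, m (inj l) = Frag.embed i inj exit ((B i).tm.m l)) {n : ℕ}
    {c c' : TM2.Cfg (B i).tm.Γ (B i).tm.Λ (B i).tm.σ} (h : Reach (TM2.step (B i).tm.m) n c c') :
    Reach (TM2.step m) n (embedCfg i inj exit o s c) (embedCfg i inj exit o s c') := by
  induction n generalizing c with
  | zero =>
    have : c = c' := by simpa [Reach] using h
    subst this
    exact Reach.refl _ _
  | succ n ih =>
    obtain ⟨b, hb, hr⟩ := h.exists_step
    refine Reach.head ?_ (ih hr)
    obtain ⟨l, v, S⟩ := c
    cases l with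
    | none => simp at hb
    | some l =>
      simp only [TM2.step, Option.some.injEq] at hb
      rw [← hb, ← stepAux_embed]
      change some (TM2.stepAux (m _) _ _) = _
      simp [hm]

end Frag

theorem initList_eq (M : FinTM2) (l : List (M.Γ M.k₀)) :
    initList M l = ⟨some M.main, M.initialState, update (fun _ => []) M.k₀ l⟩ := by
  unfold initList
  congr 1
  funext k
  by_cases h : k = M.k₀
  · subst h; simp
  · simp [h]

theorem haltList_eq (M : FinTM2) (l : List (M.Γ M.k₁)) :
    haltList M l = ⟨none, M.initialState, update (fun _ => []) M.k₁ l⟩ := by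
  unfold haltList
  congr 1
  funext k
  by_cases h : k = M.k₁
  · subst h; simp
  · simp [h]

/-- The machine turns the word `u` into `u'` within `t` steps. -/
def Computes (M : TM2ComputableAux Sym Sym) (u u' : List Sym) (t : ℕ) : Prop :=
  ∃ n ≤ t, Reach (TM2.step M.tm.m) n
    ⟨some M.tm.main, M.tm.initialState,
      update (fun _ => []) M.tm.k₀ (u.map M.inputAlphabet.symm)⟩
    ⟨none, M.tm.initialState, update (fun _ => []) M.tm.k₁ (u'.map M.outputAlphabet.symm)⟩

theorem computes_iff {M : TM2ComputableAux Sym Sym} {u u' : List Sym} {t : ℕ} :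
    Computes M u u' t ↔ Nonempty (TM2OutputsInTime M.tm (u.map M.inputAlphabet.invFun)
      (some (u'.map M.outputAlphabet.invFun)) t) := by
  constructor
  · rintro ⟨n, hn, h⟩
    refine ⟨⟨⟨n, ?_⟩, hn⟩⟩
    rw [Option.map_some, initList_eq, haltList_eq]
    exact h
  · rintro ⟨⟨⟨n, h⟩, hn⟩⟩
    refine ⟨n, hn, ?_⟩
    rw [Option.map_some, initList_eq, haltList_eq] at h
    exact h

section Frag

variable {R I : Type} [DecidableEq R] [DecidableEq I] {B : I → TM2ComputableAux Sym Sym}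

theorem reach_feed {i : I} {r : R} {Λ : Type} {m : Λ → TM2.Stmt (Alph R B) Λ (Sta B)}
    {l l' : Λ} (hm : m l = Frag.feed i r l l') (s : R → List Sym) (v : List Sym)
    (w : List ((B i).tm.Γ (B i).tm.k₀)) (o : Option Sym) :
    Reach (TM2.step m) (v.length + 1)
      ⟨some l, (initSta B, o), contents B (update s r v)
        (update (emptyStk B) i (update (fun _ => []) (B i).tm.k₀ w))⟩
      ⟨some l', (initSta B, none), contents B (update s r [])
        (update (emptyStk B) i (update (fun _ => []) (B i).tm.k₀
          ((v.map (B i).inputAlphabet.symm).reverse ++ w)))⟩ := by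
  induction v generalizing w o with
  | nil =>
    refine Reach.head ?_ (Reach.refl _ _)
    simp [hm, Frag.feed, update_contents_inl]
  | cons a v ih =>
    rw [List.map_cons, List.reverse_cons, List.append_assoc]
    refine Reach.head ?_ (ih ((B i).inputAlphabet.symm a :: w) (some a))
    simp [hm, Frag.feed, update_contents_inl, update_contents_inr]

theorem reach_drain {i : I} {r : R} {Λ : Type} {m : Λ → TM2.Stmt (Alph R B) Λ (Sta B)}
    {l l' : Λ} (hm : m l = Frag.drain i r l l') (s : R → List Sym) (v w : List Sym)
    (o : Option Sym) :
    Reach (TM2.step m) (v.length + 1)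
      ⟨some l, (initSta B, o), contents B (update s r w)
        (update (emptyStk B) i (update (fun _ => []) (B i).tm.k₁
          (v.map (B i).outputAlphabet.symm)))⟩
      (restCfg l' none (update s r (v.reverse ++ w))) := by
  induction v generalizing w o with
  | nil =>
    refine Reach.head ?_ (Reach.refl _ _)
    have h1 : (fun _ => [] : ∀ k, List ((B i).tm.Γ k)) = emptyStk B i := rfl
    have h2 : ∀ k, emptyStk B i k = [] := fun _ => rfl
    have h3 : update (emptyStk B i) (B i).tm.k₁ [] = emptyStk B i := by
      rw [← h2 (B i).tm.k₁, update_eq_self]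
    simp [hm, Frag.drain, update_contents_inr, restCfg, h1, h2, h3]
  | cons a v ih =>
    rw [List.reverse_cons, List.append_assoc]
    refine Reach.head ?_ (ih (a :: w) (some a))
    simp [hm, Frag.drain, update_contents_inl, update_contents_inr]

/-- A machine that turns `u` into `u'`, called as a subroutine, does so for the reversed words. -/
theorem Runs.call {i : I} {r : R} {u u' : List Sym} {t : ℕ} {s s' : R → List Sym}
    (hs : s r = u.reverse) (h : Computes (B i) u u' t) (hs' : s' = update s r u'.reverse) :
    Runs (B := B) (.call i r) s s' (u.length + t + u'.length + 2) := by
  intro Λ m inj exit hm o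
  obtain ⟨n, hn, hr⟩ := h
  have h1 := reach_feed (hm (.inl true)) s u.reverse [] o
  have h2 := reach_embed i none (update s r []) m (fun l => hm (.inr l)) hr
  have h3 := reach_drain (hm (.inl false)) s u' [] none
  have e1 : (fun _ => [] : ∀ k, List ((B i).tm.Γ k)) = emptyStk B i := rfl
  have e2 : ∀ k, emptyStk B i k = [] := fun _ => rfl
  have e3 : update (emptyStk B i) (B i).tm.k₀ [] = emptyStk B i := by
    rw [← e2 (B i).tm.k₀, update_eq_self]
  have e4 : update (initSta B) i (B i).tm.initialState = initSta B := update_eq_self i _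
  have e5 : update s r u.reverse = s := by rw [← hs, update_eq_self]
  refine ⟨(u.length + 1) + (n + (u'.length + 1)), by omega, none, ?_⟩
  simp only [embedCfg, Option.elim, e4] at h2
  rw [e1, e3, update_eq_self, e5, List.length_reverse] at h1
  simp only [List.map_reverse, List.reverse_reverse, List.append_nil] at h1 h3
  rw [hs']
  exact h1.trans (h2.trans h3)

/-! ### From programs to polynomial-time functions -/

/-- The register contents with the word `u` in register `r` and nothing elsewhere. -/
def single (r : R) (u : List Sym) : R → List Sym := update (fun _ => []) r u

variable [Fintype R] [Fintype I]

instance (i : I) : Fintype (B i).tm.K := (B i).tm.kFin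
instance (i : I) : Fintype (B i).tm.σ := (B i).tm.σFin

/-- The machine of a program whose input and output are in register `r`. -/
def Frag.machine (p : Frag R B) (r : R) : FinTM2 where
  K := Stk R B
  k₀ := .inl r
  k₁ := .inl r
  Γ := Alph R B
  Λ := Option p.Lab
  main := some p.entry
  σ := Sta B
  initialState := (initSta B, none)
  Γk₀Fin := inferInstanceAs (Fintype Sym)
  m
    | none => .load (fun _ => (initSta B, none)) .halt
    | some l => p.code some none l

theorem contents_single (r : R) (u : List Sym) :
    contents B (single r u) (emptyStk B) =
      (update (fun _ => []) (Sum.inl r) u : ∀ k, List (Alph R B k)) := by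
  unfold single
  rw [← update_contents_inl]
  congr 1
  funext k
  rcases k with k | k <;> rfl

/-- A program that takes `ea a` to `eb (f a)` in polynomial time shows that `f` is computable in
polynomial time. -/
theorem Frag.polyTime (p : Frag R B) (r : R) {α β : Type} {ea : α → List Sym} {eb : β → List Sym}
    {f : α → β} (P : Polynomial ℕ)
    (h : ∀ a, Runs p (single r (ea a)) (single r (eb (f a))) (P.eval (ea a).length)) :
    Nonempty (TM2ComputableInPolyTime ea eb f) := by
  have key : ∀ a, Computes ⟨p.machine r, Equiv.refl _, Equiv.refl _⟩ (ea a) (eb (f a))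
      ((P + 1).eval (ea a).length) := by
    intro a
    obtain ⟨n, hn, o, hr⟩ := h a _ (p.machine r).m some none (fun _ => rfl) none
    refine ⟨n + 1, by simpa using hn, ?_⟩
    simp only [restCfg, contents_single] at hr
    have e : ∀ l : List Sym, l.map (Equiv.refl Sym).symm = l := fun l => List.map_id l
    have hr' : Reach (TM2.step (p.machine r).m) (n + 1)
        ⟨some (some p.entry), (initSta B, none), update (fun _ => []) (.inl r) (ea a)⟩
        ⟨none, (initSta B, none), update (fun _ => []) (.inl r) (eb (f a))⟩ :=
      hr.trans (Reach.head rfl (Reach.refl _ _))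
    rw [← e (ea a), ← e (eb (f a))] at hr'
    exact hr'
  exact ⟨{  tm := p.machine r
            inputAlphabet := Equiv.refl _
            outputAlphabet := Equiv.refl _
            time := P + 1
            outputsFun := fun a => (computes_iff.1 (key a)).some }⟩

end Frag

/-! ### The output is not much longer than the running time -/

/-- The largest number of symbols that a statement can push. -/
def pushBound {K : Type} {Γ : K → Type} {Λ σ : Type} : TM2.Stmt Γ Λ σ → ℕ
  | .push _ _ q => pushBound q + 1
  | .peek _ _ q => pushBound q
  | .pop _ _ q => pushBound q
  | .load _ q => pushBound q
  | .branch _ q q' => pushBound q + pushBound q'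
  | .goto _ => 0
  | .halt => 0

theorem stepAux_length_le {K : Type} [DecidableEq K] {Γ : K → Type} {Λ σ : Type}
    (q : TM2.Stmt Γ Λ σ) (v : σ) (S : ∀ k, List (Γ k)) {L : ℕ} (hS : ∀ k, (S k).length ≤ L) (k) :
    ((TM2.stepAux q v S).stk k).length ≤ L + pushBound q := by
  induction q generalizing v S L with
  | push k' f q ih =>
    have := ih v (update S k' (f v :: S k')) (L := L + 1) (fun k'' => by
      by_cases h : k'' = k'
      · subst h; simpa using hS k''
      · simpa [h] using (hS k'').trans (Nat.le_succ L))
    simp only [TM2.stepAux, pushBound]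
    omega
  | peek k' f q ih => exact ih _ _ hS
  | pop k' f q ih =>
    refine ih _ _ fun k'' => ?_
    by_cases h : k'' = k'
    · subst h; simpa using (Nat.sub_le _ _).trans (hS k'')
    · simpa [h] using hS k''
  | load f q ih => exact ih _ _ hS
  | branch f q q' ih ih' =>
    simp only [TM2.stepAux, pushBound]
    cases f v
    · exact (ih' _ _ hS).trans (by omega)
    · exact (ih _ _ hS).trans (by omega)
  | goto f => simpa [pushBound] using hS k
  | halt => simpa [pushBound] using hS k

/-- Each step of a machine pushes a bounded number of symbols. -/
theorem exists_output_bound (M : TM2ComputableAux Sym Sym) :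
    ∃ c : ℕ, ∀ u u' t, Computes M u u' t → u'.length ≤ u.length + c * t := by
  have := M.tm.ΛFin
  refine ⟨∑ l, pushBound (M.tm.m l), ?_⟩
  rintro u u' t ⟨n, hn, h⟩
  have key : ∀ n (c c' : TM2.Cfg M.tm.Γ M.tm.Λ M.tm.σ) (L : ℕ), Reach (TM2.step M.tm.m) n c c' →
      (∀ k, (c.stk k).length ≤ L) →
      ∀ k, (c'.stk k).length ≤ L + (∑ l, pushBound (M.tm.m l)) * n := by
    intro n
    induction n with
    | zero =>
      intro c c' L h hL k
      have : c = c' := by simpa [Reach] using h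
      subst this
      simpa using hL k
    | succ n ih =>
      intro c c' L h hL k
      obtain ⟨b, hb, hr⟩ := h.exists_step
      obtain ⟨l, v, S⟩ := c
      cases l with
      | none => simp at hb
      | some l =>
        simp only [TM2.step, Option.some.injEq] at hb
        have h1 := ih b c' (L + pushBound (M.tm.m l)) hr (fun k => by
          rw [← hb]; exact stepAux_length_le _ _ _ hL k) k
        have h2 : pushBound (M.tm.m l) ≤ ∑ l, pushBound (M.tm.m l) :=
          Finset.single_le_sum (f := fun l => pushBound (M.tm.m l)) (fun _ _ => Nat.zero_le _)
            (Finset.mem_univ l)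
        rw [Nat.mul_succ]
        omega
  have := key n _ _ u.length h (fun k => by
    by_cases hk : k = M.tm.k₀
    · subst hk; simp
    · simp [hk]) M.tm.k₁
  simp only [update_self, List.length_map] at this
  exact this.trans (Nat.add_le_add_left (Nat.mul_le_mul_left _ hn) _)

/-! ### Basic programs with four registers -/

@[simp] theorem update_reg0 {α : Type*} (a b c d x : α) :
    update ![a, b, c, d] 0 x = ![x, b, c, d] := by
  funext i; fin_cases i <;> rfl

@[simp] theorem update_reg1 {α : Type*} (a b c d x : α) :
    update ![a, b, c, d] 1 x = ![a, x, c, d] := by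
  funext i; fin_cases i <;> rfl

@[simp] theorem update_reg2 {α : Type*} (a b c d x : α) :
    update ![a, b, c, d] 2 x = ![a, b, x, d] := by
  funext i; fin_cases i <;> rfl

@[simp] theorem update_reg3 {α : Type*} (a b c d x : α) :
    update ![a, b, c, d] 3 x = ![a, b, c, x] := by
  funext i; fin_cases i <;> rfl

theorem single_zero (u : List Sym) : single (0 : Fin 4) u = ![u, [], [], []] := by
  funext i; fin_cases i <;> rfl

/-- The word `w` in the alphabet of the registers. -/
def bits (w : Word) : List Sym := w.map some

@[simp] theorem bits_nil : bits [] = [] := rfl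
@[simp] theorem bits_cons (b : Bool) (w : Word) : bits (b :: w) = some b :: bits w := rfl
@[simp] theorem bits_append (v w : Word) : bits (v ++ w) = bits v ++ bits w := List.map_append
@[simp] theorem length_bits (w : Word) : (bits w).length = w.length := List.length_map _

/-- Each bit preceded by `true`. -/
def escape : Word → Word
  | [] => []
  | b :: w => true :: b :: escape w

@[simp] theorem length_escape (w : Word) : (escape w).length = 2 * w.length := by
  induction w with
  | nil => rfl
  | cons b w ih => simp [escape, ih]; ring

/-- A pair of words as one word: the first one is escaped, and `false` ends it. -/
def pairWord (v w : Word) : Word := escape v ++ false :: w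

theorem length_pairWord (v w : Word) : (pairWord v w).length = 2 * v.length + w.length + 1 := by
  simp [pairWord]; ring

/-- The two components of a pair of words. -/
def unpairWord : Word → Word × Word
  | true :: b :: w => (b :: (unpairWord w).1, (unpairWord w).2)
  | false :: w => ([], w)
  | [true] => ([], [])
  | [] => ([], [])

@[simp] theorem unpairWord_pairWord (v w : Word) : unpairWord (pairWord v w) = (v, w) := by
  induction v with
  | nil => rfl
  | cons b v ih =>
    change unpairWord (true :: b :: pairWord v w) = _
    rw [unpairWord, ih]

theorem length_unpairWord (w : Word) :
    (unpairWord w).1.length + (unpairWord w).2.length ≤ w.length := by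
  induction w using unpairWord.induct <;> (simp [unpairWord]; try omega)

section Programs

variable {I : Type} [DecidableEq I] {B : I → TM2ComputableAux Sym Sym}

namespace Frag

/-- Move the word in register `r` to register `r'`, which reverses it. -/
def move (r r' : Fin 4) : Frag (Fin 4) B :=
  .loop r (.pop r fun o => .push r' (o.getD none))

/-- Empty register `r`. -/
def clear (r : Fin 4) : Frag (Fin 4) B := .loop r (.pop r fun _ => .skip)

/-- Move the word in register `r` to register `0`, and escape it. -/
def escapeFrom (r : Fin 4) : Frag (Fin 4) B :=
  .loop r (.pop r fun o => .seq (.push 0 (o.getD none)) (.push 0 (some true)))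

/-- Split a pair of words in register `0`: the first component moves to register `1`, reversed.
Register `3` tells that the end of this component has not been reached. -/
def parse : Frag (Fin 4) B :=
  .seq (.push 3 none) (.loop 3 (.pop 0 fun o =>
    if o = some (some true) then
      .pop 0 fun o' => if o' = none then .pop 3 fun _ => .skip else .push 1 (o'.getD none)
    else .pop 3 fun _ => .skip))

end Frag

theorem Runs.move {r r' : Fin 4} (h : r ≠ r') {s s' : Fin 4 → List Sym}
    (hs' : s' = update (update s r []) r' ((s r).reverse ++ s r')) :
    Runs (B := B) (.move r r') s s' (3 * (s r).length + 1) := by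
  obtain ⟨u, hu⟩ : ∃ u, s r = u := ⟨_, rfl⟩
  rw [hu] at hs' ⊢
  induction u generalizing s s' with
  | nil =>
    have h1 : s' = s := by
      have e : update s r [] = s := by rw [← hu, update_eq_self]
      rw [hs', e]; simp
    rw [h1]
    exact (Runs.loop_nil hu).mono (by omega)
  | cons a u ih =>
    have h1 := ih (s := update (update s r u) r' (a :: s r')) (s' := s') (by
      rw [hs']; simp [update_comm h]) (by simp [h])
    have h2 : Runs (B := B) (.pop r fun o => .push r' (o.getD none)) s
        (update (update s r u) r' (a :: s r')) (1 + 1) :=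
      Runs.pop_cons hu (Runs.push (by simp [h.symm]))
    exact (Runs.loop_step (by simp [hu]) h2 h1).mono (by simp; omega)

theorem Runs.clear {r : Fin 4} {s s' : Fin 4 → List Sym} (hs' : s' = update s r []) :
    Runs (B := B) (.clear r) s s' (3 * (s r).length + 1) := by
  obtain ⟨u, hu⟩ : ∃ u, s r = u := ⟨_, rfl⟩
  rw [hu]
  induction u generalizing s s' with
  | nil =>
    have h1 : s' = s := by rw [hs', ← hu, update_eq_self]
    rw [h1]
    exact (Runs.loop_nil hu).mono (by omega)
  | cons a u ih =>
    have h1 := ih (s := update s r u) (s' := s') (by simp [hs']) (by simp)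
    have h2 : Runs (B := B) (.pop r fun o => .skip) s _ (1 + 1) := Runs.pop_cons hu Runs.skip
    exact (Runs.loop_step (by simp [hu]) h2 h1).mono (by simp; omega)

theorem Runs.escapeFrom {r : Fin 4} (h : r ≠ 0) {s s' : Fin 4 → List Sym} {w : Word}
    (hs : s r = (bits w).reverse)
    (hs' : s' = update (update s r []) 0 (bits (escape w) ++ s 0)) :
    Runs (B := B) (.escapeFrom r) s s' (4 * w.length + 1) := by
  have key : ∀ u : Word, ∀ v : Word, ∀ s s' : Fin 4 → List Sym, w = u.reverse ++ v →
      s r = bits u → s' = update (update s r []) 0 (bits (escape u.reverse) ++ s 0) →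
      Runs (B := B) (.escapeFrom r) s s' (4 * u.length + 1) := by
    intro u
    induction u with
    | nil =>
      intro v s s' _ hu hs'
      have h1 : s' = s := by
        have e : update s r [] = s := by rw [← bits_nil, ← hu, update_eq_self]
        rw [hs', e]; simp [escape]
      rw [h1]
      exact (Runs.loop_nil hu).mono (by omega)
    | cons b u ih =>
      intro v s s' hw hu hs'
      have e : ∀ (x : Word), escape (x ++ [b]) = escape x ++ [true, b] := by
        intro x
        induction x with
        | nil => rfl
        | cons c x ih => simp [escape, ih]
      have h1 := ih (b :: v) (update (update s r (bits u)) 0 (some true :: some b :: s 0)) s'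
        (by simpa using hw) (by simp [h])
        (by rw [hs']; simp [update_comm h, e])
      have h2 : Runs (B := B) (.pop r fun o => .seq (.push 0 (o.getD none)) (.push 0 (some true)))
          s (update (update s r (bits u)) 0 (some true :: some b :: s 0)) (1 + 1 + 1) :=
        Runs.pop_cons (u := bits u) hu (Runs.seq (Runs.push rfl) (Runs.push (by simp [h.symm])))
      exact (Runs.loop_step (by simp [hu]) h2 h1).mono (by simp; omega)
  have := key w.reverse [] s s' (by simp) (by rw [hs]; simp [bits]) (by rw [hs']; simp)
  simpa using this

theorem Runs.parse {w : Word} {v : List Sym} :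
    Runs (B := B) .parse ![bits w, v, [], []]
      ![bits (unpairWord w).2, (bits (unpairWord w).1).reverse ++ v, [], []]
      (4 * w.length + 6) := by
  refine (Runs.seq (Runs.push (s' := ![bits w, v, [], [none]]) (by simp))
    (t' := 4 * w.length + 5) ?_).mono (by omega)
  induction w using unpairWord.induct generalizing v with
  | case1 b w ih =>
    refine (Runs.loop_step (by simp) (Runs.pop_cons (a := some true) (u := bits (b :: w)) rfl
      (s' := ![bits w, some b :: v, [], [none]]) (t := 1 + 1) ?_) ?_ (t' := 4 * w.length + 5)).mono
      (by simp; omega)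
    · rw [if_pos rfl]
      refine Runs.pop_cons (a := some b) (u := bits w) (by simp) ?_
      exact Runs.push (by simp)
    · simpa [unpairWord] using ih (v := some b :: v)
  | case2 w =>
    refine (Runs.loop_step (by simp) (Runs.pop_cons (a := some false)
      (u := bits w) rfl
      (s' := ![bits w, v, [], []]) (t := 1 + 1) ?_) (Runs.loop_nil ?_)).mono (by simp)
    · rw [if_neg (by simp)]
      exact Runs.pop_cons (a := none) (u := []) (by simp) (by simpa using Runs.skip)
    · simp
  | case3 =>
    refine (Runs.loop_step (by simp) (Runs.pop_cons (a := some true) rfl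
      (s' := ![[], v, [], []]) (t := 1 + 1 + 1) ?_) (Runs.loop_nil ?_)).mono (by simp)
    · rw [if_pos rfl]
      refine Runs.pop_nil (by simp) ?_
      rw [if_pos rfl]
      exact Runs.pop_cons (a := none) (u := []) (by simp) (by simpa using Runs.skip)
    · simp
  | case4 =>
    refine (Runs.loop_step (by simp) (Runs.pop_nil (by simp)
      (s' := ![[], v, [], []]) (t := 1 + 1) ?_) (Runs.loop_nil ?_)).mono (by simp)
    · rw [if_neg (by simp)]
      exact Runs.pop_cons (a := none) (u := []) (by simp) (by simpa using Runs.skip)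
    · simp

end Programs

/-! ### Closure properties of polynomial-time computability -/

/-- Computability in polynomial time with respect to given encodings. -/
def PolyComputable {α β : Type} (ea : α → List Sym) (eb : β → List Sym) (f : α → β) : Prop :=
  Nonempty (TM2ComputableInPolyTime ea eb f)

theorem eval_mono (p : Polynomial ℕ) {m n : ℕ} (h : m ≤ n) : p.eval m ≤ p.eval n := by
  rw [Polynomial.eval_eq_sum_range, Polynomial.eval_eq_sum_range]
  gcongr

/-- The machine of a polynomial-time function, with a bound of its running time and a bound of the
length of its output. -/
theorem PolyComputable.exists_machine {α β : Type} {ea : α → List Sym} {eb : β → List Sym}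
    {f : α → β} (h : PolyComputable ea eb f) :
    ∃ (M : TM2ComputableAux Sym Sym) (P Q : Polynomial ℕ), ∀ a,
      Computes M (ea a) (eb (f a)) (P.eval (ea a).length) ∧
        (eb (f a)).length ≤ Q.eval (ea a).length := by
  obtain ⟨h⟩ := h
  obtain ⟨c, hc⟩ := exists_output_bound h.toTM2ComputableAux
  refine ⟨h.toTM2ComputableAux, h.time, .X + .C c * h.time, fun a => ?_⟩
  have h1 := computes_iff.2 ⟨h.outputsFun a⟩
  exact ⟨h1, by simpa using hc _ _ _ h1⟩

theorem PolyComputable.comp {α β γ : Type} {ea : α → List Sym} {eb : β → List Sym}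
    {ec : γ → List Sym} {f : α → β} {g : β → γ} (hg : PolyComputable eb ec g)
    (hf : PolyComputable ea eb f) : PolyComputable ea ec (fun a => g (f a)) := by
  obtain ⟨M, P, Q, hM⟩ := hf.exists_machine
  obtain ⟨M', P', Q', hM'⟩ := hg.exists_machine
  -- a subroutine expects and leaves its register reversed, so that two calls need no reversal
  -- between
  let B : Bool → TM2ComputableAux Sym Sym := fun i => cond i M M'
  refine Frag.polyTime (B := B)
    (.seq (.move 0 1) (.seq (.call true 1) (.seq (.call false 1) (.move 1 0)))) 0
    (4 * .X + P + 2 * Q + P'.comp Q + 4 * Q'.comp Q + 6) fun a => ?_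
  obtain ⟨h1, h2⟩ := hM a
  obtain ⟨h3, h4⟩ := hM' (f a)
  rw [single_zero, single_zero]
  have e1 := eval_mono P' h2
  have e2 := eval_mono Q' h2
  refine Runs.mono (Runs.seq (Runs.move (s' := ![[], (ea a).reverse, [], []]) (by decide) (by simp))
    (Runs.seq (Runs.call (B := B) (i := true) (s' := ![[], (eb (f a)).reverse, [], []]) rfl h1
      (by simp))
    (Runs.seq (Runs.call (B := B) (i := false) (s' := ![[], (ec (g (f a))).reverse, [], []]) rfl h3
      (by simp)) (Runs.move (by decide) (by simp))))) ?_
  simp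
  omega

/-- A function into another type with the same encoding. -/
theorem PolyComputable.congr {α β α' β' : Type} {ea : α → List Sym} {eb : β → List Sym}
    {ea' : α' → List Sym} {eb' : β' → List Sym} {f : α → β} {f' : α' → β'} (φ : α' → α)
    (h : PolyComputable ea eb f) (ha : ∀ a, ea' a = ea (φ a))
    (hb : ∀ a, eb' (f' a) = eb (f (φ a))) : PolyComputable ea' eb' f' := by
  obtain ⟨h⟩ := h
  exact ⟨{ h with outputsFun := fun a => by rw [ha, hb]; exact h.outputsFun (φ a) }⟩

/-- Programs without subroutines. -/
abbrev noBox : Empty → TM2ComputableAux Sym Sym := Empty.elim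

theorem polyComputable_of_program {α β : Type} {ea : α → List Sym} {eb : β → List Sym} {f : α → β}
    (p : Frag (Fin 4) noBox) (P : Polynomial ℕ)
    (h : ∀ a, Runs p ![ea a, [], [], []] ![eb (f a), [], [], []] (P.eval (ea a).length)) :
    PolyComputable ea eb f :=
  Frag.polyTime p 0 P fun a => by rw [single_zero, single_zero]; exact h a

theorem polyComputable_cons (b : Bool) : PolyComputable bits bits (fun w => b :: w) :=
  polyComputable_of_program (.push 0 (some b)) 1 fun w => by
    simpa using Runs.push (by simp)

theorem polyComputable_tail : PolyComputable bits bits List.tail :=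
  polyComputable_of_program (f := List.tail) (.pop 0 fun _ => .skip) 2 fun w => by
    cases w with
    | nil => exact Runs.mono (Runs.pop_nil rfl Runs.skip) (by simp)
    | cons b w =>
      exact Runs.mono (Runs.pop_cons (a := some b) (u := bits w) rfl
        (by simpa using Runs.skip)) (by simp)

theorem polyComputable_nil : PolyComputable bits bits (fun _ => []) :=
  polyComputable_of_program (.clear 0) (3 * .X + 1) fun w => by
    exact Runs.mono (Runs.clear (by simp)) (by simp)

theorem polyComputable_head : PolyComputable bits bits (fun w => [w.headD false]) :=
  polyComputable_of_program
    (.pop 0 fun o => .seq (.clear 0) (.push 0 (some (o = some (some true)))))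
      (3 * .X + 3) fun w => by
    cases w with
    | nil =>
      exact Runs.mono (Runs.pop_nil rfl (Runs.seq (Runs.clear rfl) (Runs.push (by simp)))) (by simp)
    | cons b w =>
      refine Runs.mono (Runs.pop_cons rfl (Runs.seq (Runs.clear (s' := ![[], [], [], []]) (by simp))
        (Runs.push ?_))) ?_
      · cases b <;> simp
      · simp; omega

theorem polyComputable_isEmpty : PolyComputable bits bits (fun w => [w.isEmpty]) :=
  polyComputable_of_program
    (.pop 0 fun o => .seq (.clear 0) (.push 0 (some o.isNone))) (3 * .X + 3) fun w => by
    cases w with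
    | nil =>
      exact Runs.mono (Runs.pop_nil rfl (Runs.seq (Runs.clear rfl) (Runs.push (by simp)))) (by simp)
    | cons b w =>
      refine Runs.mono (Runs.pop_cons rfl (Runs.seq (Runs.clear (s' := ![[], [], [], []]) (by simp))
        (Runs.push (by simp)))) ?_
      simp; omega

/-- The program that replaces a pair of words by its first component. -/
def Frag.fst {I : Type} {B : I → TM2ComputableAux Sym Sym} : Frag (Fin 4) B :=
  .seq .parse (.seq (.clear 0) (.move 1 0))

/-- The program that replaces a pair of words by its second component. -/
def Frag.snd {I : Type} {B : I → TM2ComputableAux Sym Sym} : Frag (Fin 4) B :=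
  .seq .parse (.clear 1)

theorem Runs.fst {I : Type} [DecidableEq I] {B : I → TM2ComputableAux Sym Sym} (w : Word) :
    Runs (B := B) .fst ![bits w, [], [], []] ![bits (unpairWord w).1, [], [], []]
      (7 * w.length + 8) := by
  refine Runs.mono (Runs.seq Runs.parse (Runs.seq (Runs.clear (s' := ![[], (bits
    (unpairWord w).1).reverse, [], []])
    (by simp)) (Runs.move (by decide) (by simp)))) ?_
  have := length_unpairWord w
  simp; omega

theorem Runs.snd {I : Type} [DecidableEq I] {B : I → TM2ComputableAux Sym Sym} (w : Word) :
    Runs (B := B) .snd ![bits w, [], [], []] ![bits (unpairWord w).2, [], [], []]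
      (7 * w.length + 8) := by
  refine Runs.mono (Runs.seq Runs.parse (Runs.clear (by simp))) ?_
  have := length_unpairWord w
  simp; omega

theorem polyComputable_fst : PolyComputable bits bits (fun w => (unpairWord w).1) :=
  polyComputable_of_program .fst (7 * .X + 8) fun w => Runs.mono (Runs.fst w) (by simp)

theorem polyComputable_snd : PolyComputable bits bits (fun w => (unpairWord w).2) :=
  polyComputable_of_program .snd (7 * .X + 8) fun w => Runs.mono (Runs.snd w) (by simp)

theorem polyComputable_swap :
    PolyComputable bits bits (fun w => pairWord (unpairWord w).2 (unpairWord w).1) :=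
  polyComputable_of_program (.seq .parse (.seq (.move 0 2) (.seq (.move 1 0)
    (.seq (.push 0 (some false)) (.escapeFrom 2))))) (20 * .X + 20) fun w => by
    refine Runs.mono (Runs.seq Runs.parse (Runs.seq (Runs.move (s' := ![[], (bits
      (unpairWord w).1).reverse,
      (bits (unpairWord w).2).reverse, []]) (by decide) (by simp))
      (Runs.seq (Runs.move (s' := ![bits (unpairWord w).1, [], (bits (unpairWord w).2).reverse, []])
      (by decide) (by simp)) (Runs.seq (Runs.push rfl)
      (Runs.escapeFrom (by decide) (w := (unpairWord w).2) (by simp)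
      (by simp [pairWord])))))) ?_
    have := length_unpairWord w
    simp; omega

/-- The program that moves the word in register `1` to the registers `0` and `2`. -/
def Frag.copy {I : Type} {B : I → TM2ComputableAux Sym Sym} : Frag (Fin 4) B :=
  .loop 1 (.pop 1 fun o => .seq (.push 0 (o.getD none)) (.push 2 (o.getD none)))

theorem Runs.copy {I : Type} [DecidableEq I] {B : I → TM2ComputableAux Sym Sym}
    (u v v' : List Sym) :
    Runs (B := B) .copy ![v, u, v', []] ![u.reverse ++ v, [], u.reverse ++ v', []]
      (4 * u.length + 1) := by
  induction u generalizing v v' with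
  | nil => exact Runs.mono (Runs.loop_nil rfl) (by simp)
  | cons a u ih =>
    refine Runs.mono (Runs.loop_step (by simp) (Runs.pop_cons rfl (Runs.seq (Runs.push rfl)
      (Runs.push (s' := ![a :: v, u, a :: v', []]) (by simp)))) (t' := 4 * u.length + 1) ?_) ?_
    · simpa [Frag.copy] using ih (a :: v) (a :: v')
    · simp; omega

theorem polyComputable_dup : PolyComputable bits bits (fun w => pairWord w w) :=
  polyComputable_of_program (.seq (.move 0 1) (.seq .copy (.seq (.move 2 1)
    (.seq (.push 0 (some false)) (.escapeFrom 1))))) (20 * .X + 20) fun w => by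
    refine Runs.mono (Runs.seq (Runs.move (s' := ![[], (bits w).reverse, [], []]) (by decide)
      (by simp))
      (Runs.seq (Runs.copy _ _ _)
      (Runs.seq (Runs.move (s' := ![bits w, (bits w).reverse, [], []])
      (by decide) (by simp)) (Runs.seq (Runs.push rfl)
      (Runs.escapeFrom (by decide) (w := w) (by simp)
      (by simp [pairWord])))))) ?_
    simp; omega

theorem polyComputable_select :
    PolyComputable (fun x : Bool × Word => bits (pairWord [x.1] x.2)) bits
      (fun x => if x.1 then (unpairWord x.2).1 else (unpairWord x.2).2) :=
  polyComputable_of_program (.pop 0 fun _ => .pop 0 fun o => .pop 0 fun _ =>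
    if o = some (some true) then .fst else .snd) (7 * .X + 11) fun ⟨b, w⟩ => by
    have e : bits (pairWord [b] w) = some true :: some b :: some false :: bits w := rfl
    rw [e]
    refine Runs.mono (Runs.pop_cons (a := some true) (u := some b :: some false :: bits w) rfl
      (Runs.pop_cons (a := some b) (u := some false :: bits w) (by simp)
      (Runs.pop_cons (a := some false) (u := bits w) (by simp)
      (t := 7 * w.length + 8) ?_))) (by simp; omega)
    cases b
    · simpa using Runs.snd w
    · simpa using Runs.fst w

/-- A function of the first component of a pair. -/
theorem PolyComputable.first {α β γ : Type} {ea : α → Word} {eb : β → Word} {ec : γ → Word}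
    {f : α → β} (hf : PolyComputable (fun a => bits (ea a)) (fun b => bits (eb b)) f) :
    PolyComputable (fun x : α × γ => bits (pairWord (ea x.1) (ec x.2)))
      (fun x : β × γ => bits (pairWord (eb x.1) (ec x.2))) (fun x => (f x.1, x.2)) := by
  obtain ⟨M, P, Q, hM⟩ := hf.exists_machine
  let B : Unit → TM2ComputableAux Sym Sym := fun _ => M
  refine Frag.polyTime (B := B)
    (.seq .parse (.seq (.call () 1) (.seq (.push 0 (some false)) (.escapeFrom 1)))) 0
    (20 * .X + P + 5 * Q + 20) fun ⟨a, c⟩ => ?_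
  obtain ⟨h1, h2⟩ := hM a
  simp only [single_zero]
  have h3 := Runs.parse (B := B) (w := pairWord (ea a) (ec c)) (v := [])
  simp only [unpairWord_pairWord, List.append_nil] at h3
  refine Runs.mono (Runs.seq h3 (Runs.seq (Runs.call (B := B) (i := ()) rfl h1 rfl) (Runs.seq
    (Runs.push rfl)
    (Runs.escapeFrom (by decide) (w := eb (f a)) (by simp) (by simp [pairWord]))))) ?_
  have e : (ea a).length ≤ (pairWord (ea a) (ec c)).length := by rw [length_pairWord]; omega
  have e1 := eval_mono P e
  have e2 := eval_mono Q e
  simp at *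
  omega

/-- Iteration. The number of iterations is given in unary; the lengths of all states that occur must
be bounded by a polynomial. -/
theorem PolyComputable.iterate {α σ : Type} {es : σ → Word} {f : σ → σ}
    (hf : PolyComputable (fun s => bits (es s)) (fun s => bits (es s)) f) (n : α → ℕ) (s : α → σ)
    (S : Polynomial ℕ) (hS : ∀ a, ∀ k ≤ n a, (es (f^[k] (s a))).length ≤
      S.eval (pairWord (unary (n a)) (es (s a))).length) :
    PolyComputable (fun a => bits (pairWord (unary (n a)) (es (s a)))) (fun s => bits (es s))
      (fun a => f^[n a] (s a)) := by
  obtain ⟨M, P, Q, hM⟩ := hf.exists_machine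
  let B : Unit → TM2ComputableAux Sym Sym := fun _ => M
  -- register `1` holds the counter, register `2` the reversed state
  have key : ∀ (N m : ℕ) (x : σ), (∀ k ≤ m, (es (f^[k] x)).length ≤ N) →
      Runs (B := B) (.loop 1 (.pop 1 fun _ => .call () 2))
        ![[], bits (unary m), (bits (es x)).reverse, []]
        ![[], [], (bits (es (f^[m] x))).reverse, []] (m * (N + P.eval N + N + 4) + 1) := by
    intro N m
    induction m with
    | zero => intro x _; exact Runs.mono (Runs.loop_nil rfl) (by simp)
    | succ m ih =>
      intro x hx
      have h1 := ih (f x) (fun k hk => hx (k + 1) (by omega))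
      have h2 := (hM x).1
      have h3 := hx 0 (by omega)
      have h4 := hx 1 (by omega)
      refine Runs.mono (Runs.loop_step (by simp [unary, List.replicate_succ]) (Runs.pop_cons
        (a := some true) (u := bits (unary m)) rfl (Runs.call (B := B) (i := ()) rfl h2
        (s' := ![[], bits (unary m), (bits (es (f x))).reverse, []]) (by simp))) h1) ?_
      have h5 := eval_mono P h3
      simp at *
      nlinarith
  refine Frag.polyTime (B := B)
    (.seq .parse (.seq (.move 0 2) (.seq (.loop 1 (.pop 1 fun _ => .call () 2)) (.move 2 0)))) 0
    (20 * .X + 20 + .X * (S + P.comp S + S + 4) + 3 * S) fun a => ?_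
  have h3 := Runs.parse (B := B) (w := pairWord (unary (n a)) (es (s a))) (v := [])
  simp only [unpairWord_pairWord, List.append_nil] at h3
  have e : (bits (unary (n a))).reverse = bits (unary (n a)) := by simp [bits, unary]
  rw [e] at h3
  have h4 := key _ (n a) (s a) (hS a)
  simp only [single_zero]
  refine Runs.mono (Runs.seq h3 (Runs.seq (Runs.move (by decide) (s' := ![[], bits (unary (n a)),
    (bits (es (s a))).reverse, []]) (by simp)) (Runs.seq h4 (Runs.move (by decide) (by simp))))) ?_
  have h5 := hS a (n a) le_rfl
  have h6 : (pairWord (unary (n a)) (es (s a))).length = _ := length_pairWord _ _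
  have h7 : (unary (n a)).length = n a := List.length_replicate
  have h8 : n a ≤ (pairWord (unary (n a)) (es (s a))).length := by omega
  simp only [length_bits, Polynomial.eval_add, Polynomial.eval_mul, Polynomial.eval_X,
    Polynomial.eval_comp, Polynomial.eval_ofNat]
  generalize (pairWord (unary (n a)) (es (s a))).length = L at h5 h6 h8 ⊢
  have h9 : n a * (S.eval L + P.eval (S.eval L) + S.eval L + 4) ≤
      L * (S.eval L + P.eval (S.eval L) + S.eval L + 4) := Nat.mul_le_mul_right _ h8
  simp
  omega

/-- A list of words as one word. -/
def packWords : List Word → Word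
  | [] => []
  | w :: ws => pairWord w (packWords ws)

theorem length_packWords (ws : List Word) :
    (packWords ws).length = (ws.map fun w => 2 * w.length + 1).sum := by
  induction ws with
  | nil => rfl
  | cons w ws ih => rw [packWords, length_pairWord, ih]; simp; ring

/-- The bits that stand for a symbol when a list of words is packed. -/
def packSym : Sym → List Sym
  | some b => [some true, some b]
  | none => [some false]

theorem bits_packWords (ws : List Word) : bits (packWords ws) =
    (encodeWords ws).flatMap packSym := by
  induction ws with
  | nil => rfl
  | cons w ws ih =>
    have : ∀ v : Word, bits (escape v) = (v.map some).flatMap packSym := by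
      intro v
      induction v with
      | nil => rfl
      | cons b v ih => simp [escape, ih, packSym]
    simp [packWords, pairWord, encodeWords, ih, this, packSym]

theorem polyComputable_pack :
    PolyComputable encodeWords (fun ws => bits (packWords ws)) id := by
  let p : Frag (Fin 4) noBox := .loop 1 (.pop 1 fun o => match o with
    | some (some b) => .seq (.push 0 (some b)) (.push 0 (some true))
    | _ => .push 0 (some false))
  have key : ∀ u v : List Sym, Runs p ![v, u, [], []]
      ![u.reverse.flatMap packSym ++ v, [], [], []] (4 * u.length + 1) := by
    intro u
    induction u with
    | nil => intro v; exact Runs.mono (Runs.loop_nil rfl) (by simp)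
    | cons a u ih =>
      intro v
      rcases a with _ | b
      · refine Runs.mono (Runs.loop_step (by simp) (Runs.pop_cons rfl (Runs.push
          (s' := ![some false :: v, u, [], []]) (by simp))) (t' := 4 * u.length + 1) ?_) ?_
        · simpa [packSym] using ih (some false :: v)
        · simp; omega
      · refine Runs.mono (Runs.loop_step (by simp) (Runs.pop_cons rfl (Runs.seq (Runs.push rfl)
          (Runs.push (s' := ![some true :: some b :: v, u, [], []]) (by simp))))
          (t' := 4 * u.length + 1) ?_) ?_
        · simpa [packSym] using ih (some true :: some b :: v)
        · simp; omega
  refine polyComputable_of_program (.seq (.move 0 1) p) (10 * .X + 10) fun ws => ?_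
  refine Runs.mono (Runs.seq (Runs.move (by decide) (s' := ![[],
    (encodeWords ws).reverse, [], []]) (by simp))
    (t' := 4 * (encodeWords ws).length + 1) ?_) ?_
  · simpa [bits_packWords] using key (encodeWords ws).reverse []
  · simp; omega

theorem polyComputable_unpack :
    PolyComputable (fun ws => bits (packWords ws)) encodeWords id := by
  let p : Frag (Fin 4) noBox := .loop 0 (.pop 0 fun o =>
    if o = some (some true) then .pop 0 fun o => .push 1 (o.getD none) else .push 1 none)
  have key : ∀ u v : List Sym, Runs p ![u.flatMap packSym, v, [], []]
      ![[], u.reverse ++ v, [], []] (4 * u.length + 1) := by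
    intro u
    induction u with
    | nil => intro v; exact Runs.mono (Runs.loop_nil rfl) (by simp)
    | cons a u ih =>
      intro v
      rcases a with _ | b
      · refine Runs.mono (Runs.loop_step (by simp [packSym]) (Runs.pop_cons
          (u := u.flatMap packSym) rfl (t := 1) (s' := ![u.flatMap packSym, none :: v, [], []]) ?_)
          (t' := 4 * u.length + 1) ?_) ?_
        · rw [if_neg (by simp)]; exact Runs.push (by simp)
        · simpa using ih (none :: v)
        · simp; omega
      · refine Runs.mono (Runs.loop_step (by simp [packSym]) (Runs.pop_cons
          (u := some b :: u.flatMap packSym) rfl (t := 1 + 1)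
          (s' := ![u.flatMap packSym, some b :: v, [], []]) ?_)
          (t' := 4 * u.length + 1) ?_) ?_
        · rw [if_pos rfl]
          exact Runs.pop_cons (a := some b) (u := u.flatMap packSym) (by simp)
            (Runs.push (by simp))
        · simpa using ih (some b :: v)
        · simp; omega
  have hl : ∀ ws, (encodeWords ws).length ≤ (bits (packWords ws)).length := by
    intro ws
    rw [bits_packWords]
    generalize encodeWords ws = u
    induction u with
    | nil => simp
    | cons a u ih => rcases a with _ | b <;> simp [packSym] at * <;> omega
  refine polyComputable_of_program (.seq p (.move 1 0)) (10 * .X + 10) fun ws => ?_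
  rw [bits_packWords]
  refine Runs.mono (Runs.seq (key _ _) (Runs.move (by decide) (by simp))) ?_
  have := hl ws
  rw [bits_packWords] at this
  simp at *
  omega

theorem polyComputable_length : PolyComputable bits bits (fun w => unary w.length) := by
  let p : Frag (Fin 4) noBox := .loop 1 (.pop 1 fun _ => .push 0 (some true))
  have key : ∀ (u : List Sym) (n : ℕ), Runs p ![bits (unary n), u, [], []]
      ![bits (unary (n + u.length)), [], [], []] (4 * u.length + 1) := by
    intro u
    induction u with
    | nil => intro n; exact Runs.mono (Runs.loop_nil rfl) (by simp)
    | cons a u ih =>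
      intro n
      refine Runs.mono (Runs.loop_step (by simp) (Runs.pop_cons rfl (Runs.push
        (s' := ![bits (unary (n + 1)), u, [], []]) (by simp [unary, List.replicate_succ])))
        (t' := 4 * u.length + 1) ?_) ?_
      · simpa [add_assoc, add_comm 1] using ih (n + 1)
      · simp; omega
  refine polyComputable_of_program (.seq (.move 0 1) p) (10 * .X + 10) fun w => ?_
  refine Runs.mono (Runs.seq (Runs.move (by decide) (s' := ![[], (bits w).reverse, [], []])
    (by simp)) (t' := 4 * w.length + 1) ?_) ?_
  · simpa [unary] using key (bits w).reverse 0
  · simp; omega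

/-! ### Polynomial-time functions between types with an encoding -/

/-- An encoding of the elements of a type by words. Natural numbers are encoded in unary. That an
encoding is injective is not required: facts like `packWords_injective` are proved where needed. -/
class Enc (α : Type) where
  enc : α → Word

open Enc (enc)

instance : Enc Word := ⟨id⟩
instance : Enc Bool := ⟨fun b => [b]⟩
instance : Enc ℕ := ⟨unary⟩
instance : Enc (List Word) := ⟨packWords⟩
instance {α β : Type} [Enc α] [Enc β] : Enc (α × β) := ⟨fun x => pairWord (enc x.1) (enc x.2)⟩

/-- The length of the encoding. -/
def size {α : Type} [Enc α] (a : α) : ℕ := (enc a).length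

section PolynomialTime

variable {α β γ δ σ : Type} [Enc α] [Enc β] [Enc γ] [Enc δ] [Enc σ]

/-- `f` is computable in polynomial time. -/
@[fun_prop] def PT (f : α → β) : Prop :=
  PolyComputable (fun a => bits (enc a)) (fun b => bits (enc b)) f

/-- A function into which a polynomial-time function turns by a change of types that keeps the
encodings. -/
theorem PT.congr {α' β' : Type} [Enc α'] [Enc β'] {f : α → β} {f' : α' → β'} (φ : α' → α)
    (h : PT f) (ha : ∀ a, enc a = enc (φ a)) (hb : ∀ a, enc (f' a) = enc (f (φ a))) : PT f' :=
  PolyComputable.congr φ h (fun a => by rw [ha]) (fun a => by rw [hb])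

theorem PT.of_word {g : Word → Word} (h : PolyComputable bits bits g) (f : α → β)
    (hf : ∀ a, enc (f a) = g (enc a)) : PT f :=
  PolyComputable.congr (fun a => enc a) h (fun _ => rfl) (fun a => by rw [hf])

@[fun_prop] theorem PT.id : PT (fun a : α => a) :=
  ⟨idComputableInPolyTime _⟩

@[fun_prop] theorem PT.comp {g : β → γ} {f : α → β} (hg : PT g) (hf : PT f) :
    PT (fun a => g (f a)) := PolyComputable.comp hg hf

theorem PT.encode : PT (fun a : α => enc a) := PT.of_word PT.id _ fun _ => rfl

@[fun_prop] theorem PT.fst {f : α → β × γ} (hf : PT f) : PT (fun a => (f a).1) :=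
  PT.comp (g := fun x : β × γ => x.1) (PT.of_word polyComputable_fst _ fun a => by
    change enc _ = (unpairWord (pairWord _ _)).1
    rw [unpairWord_pairWord]) hf

@[fun_prop] theorem PT.snd {f : α → β × γ} (hf : PT f) : PT (fun a => (f a).2) :=
  PT.comp (g := fun x : β × γ => x.2) (PT.of_word polyComputable_snd _ fun a => by
    change enc _ = (unpairWord (pairWord _ _)).2
    rw [unpairWord_pairWord]) hf

@[fun_prop] theorem PT.pair {f : α → β} {g : α → γ} (hf : PT f) (hg : PT g) :
    PT (fun a => (f a, g a)) := by
  have hdup : PT (fun a : α => (a, a)) := PT.of_word polyComputable_dup _ fun _ => rfl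
  have hswap : ∀ {β γ : Type} [Enc β] [Enc γ], PT (fun x : β × γ => (x.2, x.1)) := fun {β γ} _ _ =>
    PT.of_word polyComputable_swap _ fun x => by
      change pairWord _ _ = pairWord (unpairWord (pairWord _ _)).2 (unpairWord (pairWord _ _)).1
      rw [unpairWord_pairWord]
  have h1 : PT (fun x : α × α => (g x.1, x.2)) := PolyComputable.first hg
  have h2 : PT (fun x : α × γ => (f x.1, x.2)) := PolyComputable.first hf
  exact h2.comp (hswap.comp (h1.comp hdup))

@[fun_prop] theorem PT.const (b : β) : PT (fun _ : α => b) := by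
  have key : ∀ w : Word, PolyComputable bits bits (fun _ => w) := by
    intro w
    induction w with
    | nil => exact polyComputable_nil
    | cons c w ih => exact (polyComputable_cons c).comp ih
  exact PT.of_word (key (enc b)) _ fun _ => rfl

@[fun_prop] theorem PT.cond {c : α → Bool} {f g : α → β} (hc : PT c) (hf : PT f) (hg : PT g) :
    PT (fun a => bif c a then f a else g a) := by
  have h : PT (fun x : Bool × (β × β) => bif x.1 then x.2.1 else x.2.2) := by
    refine PolyComputable.congr (fun x => (x.1, enc x.2)) polyComputable_select
      (fun _ => rfl) fun x => ?_
    change _ = bits (if x.1 then (unpairWord (pairWord _ _)).1 else (unpairWord (pairWord _ _)).2)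
    rw [unpairWord_pairWord]
    cases x.1 <;> rfl
  exact h.comp (hc.pair (hf.pair hg))

theorem PT.of_polyTime {f : List Word → List Word} (h : PolyTime f) : PT f :=
  PolyComputable.comp (g := _root_.id) (f := f) polyComputable_pack
    (PolyComputable.comp (f := fun a => a) (g := f) h polyComputable_unpack)

theorem PT.polyTime {f : List Word → List Word} (h : PT f) : PolyTime f :=
  PolyComputable.comp (g := _root_.id) polyComputable_unpack
    (PolyComputable.comp (f := _root_.id) (g := f) h polyComputable_pack)

/-! ### Boolean operations in polynomial time -/

@[fun_prop] theorem PT.not {c : α → Bool} (hc : PT c) : PT (fun a => !(c a)) := by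
  have : (fun a => !(c a)) = fun a => bif c a then false else true := by
    funext a; cases c a <;> rfl
  rw [this]; fun_prop

@[fun_prop] theorem PT.and {c d : α → Bool} (hc : PT c) (hd : PT d) : PT (fun a => c a && d a) := by
  have : (fun a => c a && d a) = fun a => bif c a then d a else false := by
    funext a; cases c a <;> rfl
  rw [this]; fun_prop

@[fun_prop] theorem PT.or {c d : α → Bool} (hc : PT c) (hd : PT d) : PT (fun a => c a || d a) := by
  have : (fun a => c a || d a) = fun a => bif c a then true else d a := by
    funext a; cases c a <;> rfl
  rw [this]; fun_prop

@[fun_prop] theorem PT.xor {c d : α → Bool} (hc : PT c) (hd : PT d) :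
    PT (fun a => Bool.xor (c a) (d a)) := by
  have : (fun a => Bool.xor (c a) (d a)) = fun a => bif c a then !(d a) else d a := by
    funext a; cases c a <;> cases d a <;> rfl
  rw [this]; fun_prop

/-! ### Heads and tails in polynomial time -/

@[fun_prop] theorem PT.tail {f : α → Word} (hf : PT f) : PT (fun a => (f a).tail) :=
  PT.comp (g := List.tail) (PT.of_word polyComputable_tail _ fun _ => rfl) hf

@[fun_prop] theorem PT.headD {f : α → Word} (hf : PT f) : PT (fun a => (f a).headD false) :=
  PT.comp (g := fun w => w.headD false) (PT.of_word polyComputable_head _ fun _ => rfl) hf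

@[fun_prop] theorem PT.isEmpty {f : α → Word} (hf : PT f) : PT (fun a => (f a).isEmpty) :=
  PT.comp (g := fun w => w.isEmpty) (PT.of_word polyComputable_isEmpty _ fun _ => rfl) hf

@[fun_prop] theorem PT.length {f : α → Word} (hf : PT f) : PT (fun a => (f a).length) :=
  PT.comp (g := fun w => w.length) (PT.of_word polyComputable_length _ fun _ => rfl) hf

@[fun_prop] theorem PT.cons {b : α → Bool} {f : α → Word} (hb : PT b) (hf : PT f) :
    PT (fun a => b a :: f a) := by
  have h : ∀ c : Bool, PT (fun w : Word => c :: w) := fun c =>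
    PT.of_word (polyComputable_cons c) _ fun _ => rfl
  have : (fun a => b a :: f a) = fun a => bif b a then true :: f a else false :: f a := by
    funext a; cases b a <;> rfl
  rw [this]
  exact hb.cond ((h true).comp hf) ((h false).comp hf)

theorem unpairWord_packWords (l : List Word) :
    unpairWord (packWords l) = (l.headD [], packWords l.tail) := by
  cases l with
  | nil => rfl
  | cons w l => exact unpairWord_pairWord _ _

@[fun_prop] theorem PT.tailWords {f : α → List Word} (hf : PT f) : PT (fun a => (f a).tail) :=
  PT.comp (g := List.tail) (PT.of_word polyComputable_snd _ fun l => by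
    change packWords _ = (unpairWord (packWords _)).2
    rw [unpairWord_packWords]) hf

@[fun_prop] theorem PT.headDWords {f : α → List Word} (hf : PT f) :
    PT (fun a => (f a).headD []) :=
  PT.comp (g := fun l => l.headD []) (PT.of_word polyComputable_fst _ fun l => by
    change _ = (unpairWord (packWords _)).1
    rw [unpairWord_packWords]; rfl) hf

@[fun_prop] theorem PT.isEmptyWords {f : α → List Word} (hf : PT f) :
    PT (fun a => (f a).isEmpty) :=
  PT.comp (g := fun l => l.isEmpty) (PT.of_word polyComputable_isEmpty _ fun l => by
    cases l with
    | nil => rfl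
    | cons w l => cases w <;> rfl) hf

@[fun_prop] theorem PT.consWords {w : α → Word} {f : α → List Word} (hw : PT w) (hf : PT f) :
    PT (fun a => w a :: f a) :=
  PT.comp (g := fun x : Word × List Word => x.1 :: x.2)
    (PT.congr (fun x => x) PT.id (fun _ => rfl) fun _ => rfl) (hw.pair hf)

/-! ### Polynomial bounds and iteration -/

/-- `B a` is bounded by a polynomial in the length of the encoding of `a`. -/
@[fun_prop] def PolyBdd (B : α → ℕ) : Prop := ∃ p : Polynomial ℕ, ∀ a, B a ≤ p.eval (size a)

@[fun_prop] theorem PolyBdd.const (n : ℕ) : PolyBdd (fun _ : α => n) := ⟨.C n, by simp⟩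

@[fun_prop] theorem PolyBdd.add {B B' : α → ℕ} (h : PolyBdd B) (h' : PolyBdd B') :
    PolyBdd (fun a => B a + B' a) := by
  obtain ⟨p, hp⟩ := h
  obtain ⟨p', hp'⟩ := h'
  exact ⟨p + p', fun a => by simpa using add_le_add (hp a) (hp' a)⟩

@[fun_prop] theorem PolyBdd.mul {B B' : α → ℕ} (h : PolyBdd B) (h' : PolyBdd B') :
    PolyBdd (fun a => B a * B' a) := by
  obtain ⟨p, hp⟩ := h
  obtain ⟨p', hp'⟩ := h'
  exact ⟨p * p', fun a => by simpa using Nat.mul_le_mul (hp a) (hp' a)⟩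

theorem PT.polyBdd_size {f : α → β} (hf : PT f) : PolyBdd (fun a => size (f a)) := by
  obtain ⟨_, _, Q, h⟩ := PolyComputable.exists_machine hf
  exact ⟨Q, fun a => by simpa [size] using (h a).2⟩

theorem size_nat (n : ℕ) : size n = n := List.length_replicate
theorem size_word (w : Word) : size w = w.length := rfl
theorem size_bool (b : Bool) : size b = 1 := rfl
theorem size_pair (x : α × β) : size x = 2 * size x.1 + size x.2 + 1 := length_pairWord _ _
theorem size_words (l : List Word) : size l = (l.map fun w => 2 * w.length + 1).sum :=
  length_packWords l

theorem PT.polyBdd {n : α → ℕ} (hn : PT n) : PolyBdd n := by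
  simpa [size_nat] using hn.polyBdd_size

theorem PolyBdd.exists_mono {B : α → ℕ} (h : PolyBdd B) (p : Polynomial ℕ) :
    PolyBdd (fun a => p.eval (B a)) := by
  obtain ⟨q, hq⟩ := h
  exact ⟨p.comp q, fun a => by simpa using eval_mono p (hq a)⟩

/-- Iteration of a step that depends on the input: the input is carried along in the state. -/
theorem PT.iterate {step : α → σ → σ} {n : α → ℕ} {s : α → σ}
    (hstep : PT (fun x : α × σ => step x.1 x.2)) (hn : PT n) (hs : PT s) {S : α → ℕ}
    (hS : PolyBdd S) (h : ∀ a, ∀ k ≤ n a, size ((step a)^[k] (s a)) ≤ S a) :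
    PT (fun a => (step a)^[n a] (s a)) := by
  obtain ⟨p, hp⟩ := hS
  have e : ∀ a k, (fun x : α × σ => (x.1, step x.1 x.2))^[k] (a, s a) = (a, (step a)^[k]
    (s a)) := by
    intro a k
    induction k with
    | zero => rfl
    | succ k ih => rw [iterate_succ_apply', ih, iterate_succ_apply']
  have h1 : PT (fun x : α × σ => (x.1, step x.1 x.2)) := by fun_prop
  have h2 := PolyComputable.iterate (α := α) h1 n (fun a => (a, s a)) (2 * .X + p + 1) (by
    intro a k hk
    rw [e]
    change size (a, _) ≤ _
    rw [size_pair]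
    have h3 := (h a k hk).trans (hp a)
    have h4 : size a ≤ (pairWord (unary (n a)) (enc (a, s a))).length := by
      rw [length_pairWord]
      change _ ≤ _ + size (a, s a) + 1
      rw [size_pair]
      simp only
      omega
    have h5 := eval_mono p h4
    simp only [Polynomial.eval_add, Polynomial.eval_mul, Polynomial.eval_X, Polynomial.eval_ofNat,
      Polynomial.eval_one]
    omega)
  have h3 : PT (fun a => (n a, (a, s a))) := by fun_prop
  have h4 : PT (fun a => (a, (step a)^[n a] (s a))) :=
    PolyComputable.congr (fun a => a) (PolyComputable.comp (f := fun a : α => a)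
      (eb := fun a => bits (pairWord (unary (n a)) (enc (a, s a))))
      h2 (PolyComputable.congr (fun a => a) h3 (fun _ => rfl) fun _ => rfl))
      (fun _ => rfl) (fun a => by rw [e])
  exact h4.snd

/-- Iteration of a step that adds a bounded amount to the size of the state. -/
theorem PT.iterate_add {step : α → σ → σ} {n : α → ℕ} {s : α → σ}
    (hstep : PT (fun x : α × σ => step x.1 x.2)) (hn : PT n) (hs : PT s) {S : α → ℕ}
    (hS : PolyBdd S) (h : ∀ a x, size (step a x) ≤ size x + S a) :
    PT (fun a => (step a)^[n a] (s a)) := by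
  refine PT.iterate hstep hn hs (S := fun a => size (s a) + n a * S a)
    (hs.polyBdd_size.add (hn.polyBdd.mul hS)) fun a k hk => ?_
  have : size ((step a)^[k] (s a)) ≤ size (s a) + k * S a := by
    clear hk
    induction k with
    | zero => simp
    | succ k ih => rw [iterate_succ_apply', Nat.succ_mul]; have := h a ((step a)^[k] (s a)); omega
  exact this.trans (Nat.add_le_add_left (Nat.mul_le_mul_right _ hk) _)

/-! ### Unary arithmetic in polynomial time -/

@[fun_prop] theorem PT.size_comp {f : α → β} (hf : PT f) : PT (fun a => size (f a)) :=
  (PT.encode.comp hf).length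

@[fun_prop] theorem PT.succ {m : α → ℕ} (hm : PT m) : PT (fun a => (m a).succ) :=
  PT.comp (g := Nat.succ) (PT.of_word (polyComputable_cons true) _ fun _ => rfl) hm

@[fun_prop] theorem PT.pred {m : α → ℕ} (hm : PT m) : PT (fun a => (m a).pred) :=
  PT.comp (g := Nat.pred) (PT.of_word polyComputable_tail _ fun n => by cases n <;> rfl) hm

@[fun_prop] theorem PT.unary_comp {m : α → ℕ} (hm : PT m) : PT (fun a => unary
    (m a)) := PT.encode.comp hm

@[fun_prop] theorem PT.add {m n : α → ℕ} (hm : PT m) (hn : PT n) : PT (fun a => m a + n a) := by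
  have : (fun a => m a + n a) = fun a => Nat.succ^[n a] (m a) := by
    funext a; rw [Nat.succ_iterate]
  rw [this]
  exact PT.iterate_add (step := fun _ => Nat.succ) (by fun_prop) hn hm (S := fun _ => 1)
    (by fun_prop) (fun a x => by simp [size_nat])

@[fun_prop] theorem PT.sub {m n : α → ℕ} (hm : PT m) (hn : PT n) : PT (fun a => m a - n a) := by
  have : (fun a => m a - n a) = fun a => Nat.pred^[n a] (m a) := by
    funext a; rw [Nat.pred_iterate]
  rw [this]
  exact PT.iterate_add (step := fun _ => Nat.pred) (by fun_prop) hn hm (S := fun _ => 0)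
    (by fun_prop) (fun a x => by simp [size_nat])

@[fun_prop] theorem PT.mul {m n : α → ℕ} (hm : PT m) (hn : PT n) : PT (fun a => m a * n a) := by
  have : (fun a => m a * n a) = fun a => (fun x => x + m a)^[n a] 0 := by
    funext a; simp [add_right_iterate, mul_comm]
  rw [this]
  exact PT.iterate_add (step := fun a x => x + m a) (by fun_prop) hn (by fun_prop)
    (S := m) hm.polyBdd (fun a x => by simp [size_nat])

@[fun_prop] theorem PT.eval {n : α → ℕ} (p : Polynomial ℕ) (hn : PT n) :
    PT (fun a => p.eval (n a)) := by
  induction p using Polynomial.induction_on' with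
  | add p q hp hq => simpa using hp.add hq
  | monomial k c =>
    simp only [Polynomial.eval_monomial]
    refine PT.mul (PT.const c) ?_
    induction k with
    | zero => simpa using PT.const 1
    | succ k ih => simpa [pow_succ] using ih.mul hn

@[fun_prop] theorem PT.isZero {n : α → ℕ} (hn : PT n) : PT (fun a => n a == 0) :=
  PT.comp (g := fun n : ℕ => n == 0) (PT.of_word polyComputable_isEmpty _ fun n => by
    cases n <;> rfl) hn

@[fun_prop] theorem PT.le {m n : α → ℕ} (hm : PT m) (hn : PT n) :
    PT (fun a => decide (m a ≤ n a)) := by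
  have : (fun a => decide (m a ≤ n a)) = fun a => m a - n a == 0 := by
    funext a; rw [Bool.eq_iff_iff]; simp [Nat.sub_eq_zero_iff_le]
  rw [this]; fun_prop

/-! ### Polynomial-time operations on words and lists of words -/

theorem size_words_nil : size ([] : List Word) = 0 := rfl

theorem size_words_cons (w : Word) (l : List Word) : size (w :: l) = 2 * w.length + 1 + size l := by
  rw [size_words, size_words, List.map_cons, List.sum_cons]

theorem size_words_append (l l' : List Word) : size (l ++ l') = size l + size l' := by
  simp [size_words]

theorem length_le_size (l : List Word) : l.length ≤ size l := by
  induction l with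
  | nil => simp
  | cons w l ih => rw [size_words_cons, List.length_cons]; omega

theorem size_tail_words_le (l : List Word) :
    size l.tail + 2 * (l.headD []).length + 1 ≤ size l + 1 := by
  cases l with
  | nil => simp
  | cons w l => rw [size_words_cons]; simp; omega

theorem size_sublist {l l' : List Word} (h : l.Sublist l') : size l ≤ size l' := by
  rw [size_words, size_words]
  exact (h.map _).sum_le_sum fun _ _ => Nat.zero_le _

theorem reverse_iterate {A : Type*} (d : A) (v w : List A) :
    (fun x : List A × List A => (x.1.tail, x.1.headD d :: x.2))^[v.length] (v, w) =
      ([], v.reverse ++ w) := by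
  induction v generalizing w with
  | nil => rfl
  | cons b v ih => simpa using ih (b :: w)

theorem PT.reverseAppend {v w : α → Word} (hv : PT v) (hw : PT w) :
    PT (fun a => (v a).reverse ++ w a) := by
  have h : PT fun a => (fun x : Word × Word => (x.1.tail, x.1.headD false :: x.2))^[(v a).length]
      (v a, w a) :=
    PT.iterate_add (step := fun _ (x : Word × Word) => (x.1.tail, x.1.headD false :: x.2))
      (by fun_prop)
      (by fun_prop) (by fun_prop) (S := fun _ => 1) (by fun_prop) (fun a x => by
        simp only [size_pair, size_word, List.length_tail, List.length_cons]; omega)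
  simp only [reverse_iterate] at h
  exact h.snd

@[fun_prop] theorem PT.reverse {v : α → Word} (hv : PT v) : PT (fun a => (v a).reverse) := by
  simpa using hv.reverseAppend (PT.const [])

@[fun_prop] theorem PT.append {v w : α → Word} (hv : PT v) (hw : PT w) :
    PT (fun a => v a ++ w a) := by
  simpa using hv.reverse.reverseAppend hw

@[fun_prop] theorem PT.drop {n : α → ℕ} {v : α → Word} (hn : PT n) (hv : PT v) :
    PT (fun a => (v a).drop (n a)) := by
  simp only [← List.tail_iterate]
  exact PT.iterate_add (step := fun _ => List.tail) (by fun_prop) hn hv (S := fun _ => 0)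
    (by fun_prop) (fun a x => by simp [size_word])

@[fun_prop] theorem PT.take {n : α → ℕ} {v : α → Word} (hn : PT n) (hv : PT v) :
    PT (fun a => (v a).take (n a)) := by
  have : (fun a => (v a).take (n a)) =
      fun a => ((v a).reverse.drop ((v a).length - n a)).reverse := by
    funext a; rw [← List.reverse_take, List.reverse_reverse]
  rw [this]; fun_prop

theorem countWords_iterate (l : List Word) (n k : ℕ) (h : l.length ≤ k) :
    (fun x : List Word × ℕ => bif x.1.isEmpty then x else (x.1.tail, x.2.succ))^[k] (l, n) =
      ([], n + l.length) := by
  induction k generalizing l n with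
  | zero => have : l = [] := by simpa using h
            subst this; rfl
  | succ k ih =>
    cases l with
    | nil => simpa using ih [] n (by simp)
    | cons w l => simpa [add_assoc, add_comm 1] using ih l (n + 1) (by simpa using h)

@[fun_prop] theorem PT.lengthWords {l : α → List Word} (hl : PT l) :
    PT (fun a => (l a).length) := by
  have h : PT fun a => (fun x : List Word × ℕ => bif x.1.isEmpty then x else
      (x.1.tail, x.2.succ))^[size (l a)] (l a, 0) :=
    PT.iterate_add (step := fun _ (x : List Word × ℕ) => bif x.1.isEmpty then x else
      (x.1.tail, x.2.succ))
      (by fun_prop) (by fun_prop) (by fun_prop) (S := fun _ => 1) (by fun_prop) (fun a x => by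
        obtain ⟨l, n⟩ := x
        have := size_tail_words_le l
        cases h : l.isEmpty <;> (simp [size_pair, size_nat, h] at *; try omega))
  simp only [countWords_iterate _ _ _ (length_le_size _), zero_add] at h
  exact h.snd

theorem PT.reverseAppendWords {v w : α → List Word} (hv : PT v) (hw : PT w) :
    PT (fun a => (v a).reverse ++ w a) := by
  have h : PT fun a => (fun x : List Word × List Word =>
      (x.1.tail, x.1.headD [] :: x.2))^[(v a).length] (v a, w a) :=
    PT.iterate_add (step := fun _ (x : List Word × List Word) => (x.1.tail, x.1.headD [] :: x.2))
      (by fun_prop)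
      (by fun_prop) (by fun_prop) (S := fun _ => 1) (by fun_prop) (fun a x => by
        have := size_tail_words_le x.1
        simp only [size_pair, size_words_cons]; omega)
  simp only [reverse_iterate] at h
  exact h.snd

@[fun_prop] theorem PT.reverseWords {v : α → List Word} (hv : PT v) :
    PT (fun a => (v a).reverse) := by
  simpa using hv.reverseAppendWords (PT.const [])

@[fun_prop] theorem PT.appendWords {v w : α → List Word} (hv : PT v) (hw : PT w) :
    PT (fun a => v a ++ w a) := by
  simpa using hv.reverseWords.reverseAppendWords hw

@[fun_prop] theorem PT.dropWords {n : α → ℕ} {v : α → List Word} (hn : PT n) (hv : PT v) :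
    PT (fun a => (v a).drop (n a)) := by
  simp only [← List.tail_iterate]
  exact PT.iterate_add (step := fun _ => List.tail) (by fun_prop) hn hv (S := fun _ => 0)
    (by fun_prop) (fun a x => size_sublist (List.tail_sublist x))

@[fun_prop] theorem PT.takeWords {n : α → ℕ} {v : α → List Word} (hn : PT n) (hv : PT v) :
    PT (fun a => (v a).take (n a)) := by
  have : (fun a => (v a).take (n a)) =
      fun a => ((v a).reverse.drop ((v a).length - n a)).reverse := by
    funext a; rw [← List.reverse_take, List.reverse_reverse]
  rw [this]; fun_prop

/-- One step of the comparison of two words. -/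
def eqStep (x : Word × Word × Bool) : Word × Word × Bool :=
  (x.1.tail, x.2.1.tail, x.2.2 && !(Bool.xor x.1.isEmpty x.2.1.isEmpty) &&
    !(Bool.xor (x.1.headD false) (x.2.1.headD false)))

theorem eqStep_iterate (v w : Word) (c : Bool) (k : ℕ) (h : v.length ≤ k) (h' : w.length ≤ k) :
    eqStep^[k] (v, w, c) = ([], [], c && decide (v = w)) := by
  induction k generalizing v w c with
  | zero =>
    have h1 : v = [] := by simpa using h
    have h2 : w = [] := by simpa using h'
    subst h1 h2; simp
  | succ k ih =>
    rw [iterate_succ_apply, eqStep, ih _ _ _ (by simpa using h) (by simpa using h')]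
    rcases v with _ | ⟨a, v⟩ <;> rcases w with _ | ⟨b, w⟩
    · simp
    · simp
    · simp
    · cases a <;> cases b <;> simp <;> congr

@[fun_prop] theorem PT.decideEq {v w : α → Word} (hv : PT v) (hw : PT w) :
    PT (fun a => decide (v a = w a)) := by
  have h : PT fun a => eqStep^[(v a).length + (w a).length] (v a, w a, true) :=
    PT.iterate_add (step := fun _ x => eqStep x) (by unfold eqStep; fun_prop) (by fun_prop)
      (by fun_prop) (S := fun _ => 0) (by fun_prop) (fun a x => by
        simp only [eqStep, size_pair, size_word, size_bool, List.length_tail]; omega)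
  have e : ∀ a, eqStep^[(v a).length + (w a).length] (v a, w a, true) =
      ([], [], decide (v a = w a)) := fun a => by
    rw [eqStep_iterate _ _ _ _ (by omega) (by omega), Bool.true_and]
  simp only [e] at h
  exact h.snd.snd

theorem packWords_injective : Injective packWords := by
  intro l
  induction l with
  | nil =>
    intro l' h
    cases l' with
    | nil => rfl
    | cons w l' => cases w <;> simp [packWords, pairWord, escape] at h
  | cons v l ih =>
    intro l' h
    cases l' with
    | nil => cases v <;> simp [packWords, pairWord, escape] at h
    | cons w l' =>
      have h' := congrArg unpairWord h
      simp only [packWords, unpairWord_pairWord, Prod.mk.injEq] at h'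
      rw [h'.1, ih h'.2]

@[fun_prop] theorem PT.decideEqWords {v w : α → List Word} (hv : PT v) (hw : PT w) :
    PT (fun a => decide (v a = w a)) := by
  have : PT (fun a => decide ((enc (v a) : Word) = enc (w a))) :=
    (PT.encode.comp hv).decideEq (PT.encode.comp hw)
  convert this using 4
  exact packWords_injective.eq_iff.symm

/-- A list of pairs of words, written as one list. -/
def flat (ps : List (Word × Word)) : List Word := ps.flatMap fun p => [p.1, p.2]

@[simp] theorem flat_nil : flat [] = [] := rfl
@[simp] theorem flat_cons (p : Word × Word) (ps) : flat (p :: ps) = p.1 :: p.2 :: flat ps := rfl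

theorem length_le_size_flat (ps : List (Word × Word)) : ps.length ≤ size (flat ps) := by
  induction ps with
  | nil => simp
  | cons p ps ih => rw [flat_cons, size_words_cons, size_words_cons, List.length_cons]; omega

/-- Drop the first entry of a table, unless it is the entry for `key`. -/
def seekStep (key : Word) (t : List Word) : List Word :=
  bif t.isEmpty || decide (t.headD [] = key) then t else t.tail.tail

/-- The part of a table that begins with the entry for `key`. -/
def seek (key : Word) (t : List Word) : List Word := (seekStep key)^[size t] t

@[fun_prop] theorem PT.seek_comp {k : α → Word} {t : α → List Word} (hk : PT k) (ht : PT t) :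
    PT (fun a => seek (k a) (t a)) := by
  refine PT.iterate_add (step := fun a => seekStep (k a)) (by unfold seekStep; fun_prop)
    (by fun_prop) ht (S := fun _ => 0) (by fun_prop) fun a t => ?_
  unfold seekStep
  cases t.isEmpty || decide (t.headD [] = k a)
  · exact size_sublist ((List.tail_sublist _).trans (List.tail_sublist _))
  · exact le_rfl

theorem seek_flat (key : Word) (ps : List (Word × Word)) :
    seek key (flat ps) = flat (ps.dropWhile fun p => decide (p.1 ≠ key)) := by
  have : ∀ k ps, ps.length ≤ k → (seekStep key)^[k] (flat ps) =
      flat (ps.dropWhile fun p => decide (p.1 ≠ key)) := by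
    intro k
    induction k with
    | zero =>
      intro ps h
      have : ps = [] := by simpa using h
      subst this; rfl
    | succ k ih =>
      intro ps h
      rw [iterate_succ_apply]
      cases ps with
      | nil => simpa [seekStep] using ih [] (by simp)
      | cons p ps =>
        by_cases hp : p.1 = key
        · have e : ∀ m, (seekStep key)^[m] (flat (p :: ps)) = flat (p :: ps) := by
            intro m
            exact iterate_fixed (by simp [seekStep, hp]) m
          rw [← iterate_succ_apply, e]; simp [hp]
        · simpa [seekStep, hp] using ih ps (by simpa using h)
  exact this _ ps (length_le_size_flat ps)

/-! ### Binary numbers -/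

/-- The value of a word as a binary number, the lowest bit first. -/
def binVal : Word → ℕ
  | [] => 0
  | b :: w => b.toNat + 2 * binVal w

theorem binVal_lt (w : Word) : binVal w < 2 ^ w.length := by
  induction w with
  | nil => simp [binVal]
  | cons b w ih => cases b <;> simp [binVal, pow_succ] <;> omega

theorem binVal_encodeNat (n : ℕ) : binVal (Computability.encodeNat n) = n := by
  have h : ∀ p : PosNum, binVal (Computability.encodePosNum p) = p := by
    intro p
    induction p with
    | one => rfl
    | bit0 p ih => simp [Computability.encodePosNum, binVal, ih]; ring
    | bit1 p ih => simp [Computability.encodePosNum, binVal, ih]; ring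
  have h' : ∀ p : Num, binVal (Computability.encodeNum p) = p := by
    intro p
    cases p with
    | zero => rfl
    | pos p => exact h p
  rw [Computability.encodeNat, h', Num.to_of_nat]

/-- One step of the subtraction of binary numbers: the state consists of the remaining bits of both
numbers, the borrow, and the bits of the difference so far, the highest first. -/
def subStep (x : Word × Word × Bool × Word) : Word × Word × Bool × Word :=
  (x.1.tail, x.2.1.tail,
    (bif x.1.headD false then x.2.1.headD false && x.2.2.1 else x.2.1.headD false || x.2.2.1),
    Bool.xor (Bool.xor (x.1.headD false) (x.2.1.headD false)) x.2.2.1 :: x.2.2.2)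

theorem subStep_iterate (k : ℕ) (v w : Word) (c : Bool) (o : Word) (hv : v.length ≤ k)
    (hw : w.length ≤ k) : ∃ (d : Word) (c' : Bool), subStep^[k] (v, w, c, o) =
      ([], [], c', d.reverse ++ o) ∧ d.length = k ∧
        binVal d + binVal w + c.toNat = binVal v + 2 ^ k * c'.toNat := by
  induction k generalizing v w c o with
  | zero =>
    have h1 : v = [] := by simpa using hv
    have h2 : w = [] := by simpa using hw
    subst h1 h2
    exact ⟨[], c, by simp [binVal]⟩
  | succ k ih =>
    rw [iterate_succ_apply, subStep]
    obtain ⟨d, c', h1, h2, h3⟩ := ih v.tail w.tail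
      (bif v.headD false then w.headD false && c else w.headD false || c)
      (Bool.xor (Bool.xor (v.headD false) (w.headD false)) c :: o) (by simpa using hv)
      (by simpa using hw)
    refine ⟨Bool.xor (Bool.xor (v.headD false) (w.headD false)) c :: d, c', ?_, by simp [h2], ?_⟩
    · simpa using h1
    · have e : ∀ v : Word, binVal v = (v.headD false).toNat + 2 * binVal v.tail := by
        intro v; cases v <;> simp [binVal]
      rw [e v, e w, binVal, pow_succ]
      revert h3
      generalize v.headD false = p
      generalize w.headD false = q
      cases p <;> cases q <;> cases c <;> cases c' <;> simp <;> omega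

/-- The borrow and the difference of two binary numbers. -/
def subWords (v w : Word) : Bool × Word :=
  let x := subStep^[v.length + w.length] (v, w, false, [])
  (x.2.2.1, x.2.2.2.reverse)

theorem subWords_spec (v w : Word) : (subWords v w).1 = decide (binVal v < binVal w) ∧
    (binVal w ≤ binVal v → binVal (subWords v w).2 = binVal v - binVal w) ∧
      (subWords v w).2.length = v.length + w.length := by
  obtain ⟨d, c, h1, h2, h3⟩ := subStep_iterate (v.length + w.length) v w false [] (by omega)
    (by omega)
  have h4 := binVal_lt d
  have h5 := binVal_lt w
  have h6 : 2 ^ w.length ≤ 2 ^ (v.length + w.length) := Nat.pow_le_pow_right (by omega) (by omega)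
  rw [h2] at h4
  simp only [subWords, h1, List.append_nil, List.reverse_reverse]
  cases c
  · simp at h3
    refine ⟨by symm; simp; omega, fun _ => by omega, h2⟩
  · simp at h3
    refine ⟨by symm; simp; omega, fun _ => by omega, h2⟩

@[fun_prop] theorem PT.subWords_comp {v w : α → Word} (hv : PT v) (hw : PT w) :
    PT (fun a => subWords (v a) (w a)) := by
  have h : PT fun a => subStep^[(v a).length + (w a).length] (v a, w a, false, []) :=
    PT.iterate_add (step := fun _ x => subStep x) (by unfold subStep; fun_prop) (by fun_prop)
      (by fun_prop) (S := fun _ => 1) (by fun_prop) (fun a x => by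
        simp only [subStep, size_pair, size_word, size_bool, List.length_tail, List.length_cons]
        omega)
  unfold subWords
  fun_prop

/-! ### Sampling from a weighted list -/

/-- Subtract the weight of the first entry, if possible. The state consists of the remaining
entries,
written as one list, and the rest. -/
def walkStep (x : List Word × Word) : List Word × Word :=
  bif x.1.isEmpty || (subWords x.2 (x.1.tail.headD [])).1 then x else
    (x.1.tail.tail, (subWords x.2 (x.1.tail.headD [])).2)

/-- Subtract the weights of the entries one after the other, as long as possible. -/
def walk (l : List Word) (u : Word) : List Word × Word := walkStep^[size l] (l, u)

/-- The entries that are left, and the rest, after subtracting weights from `n` as long as possible: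
the specification of `walk`. -/
def walkFrom : List (Word × Word) → ℕ → List (Word × Word) × ℕ
  | [], n => ([], n)
  | p :: ps, n => if n < binVal p.2 then (p :: ps, n) else walkFrom ps (n - binVal p.2)

theorem walk_step_size (x : List Word × Word) :
    size (walkStep x) ≤ size x := by
  unfold walkStep
  cases x.1.isEmpty || (subWords x.2 (x.1.tail.headD [])).1
  · have h1 := size_tail_words_le x.1
    have h2 := size_tail_words_le x.1.tail
    have h3 := (subWords_spec x.2 (x.1.tail.headD [])).2.2
    simp only [cond_false, size_pair, size_word]
    omega
  · exact le_rfl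

@[fun_prop] theorem PT.walk_comp {l : α → List Word} {u : α → Word} (hl : PT l) (hu : PT u) :
    PT (fun a => walk (l a) (u a)) :=
  PT.iterate_add (step := fun _ => walkStep) (by unfold walkStep; fun_prop) (by fun_prop)
    (by fun_prop) (S := fun _ => 0) (by fun_prop)
    fun _ x => walk_step_size x

theorem size_walk_le (l : List Word) (u : Word) : size (walk l u) ≤ size (l, u) := by
  have : ∀ k x, size (walkStep^[k] x) ≤ size x := by
    intro k
    induction k with
    | zero => intro x; exact le_rfl
    | succ k ih => intro x; exact (ih _).trans (walk_step_size x)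
  exact this _ _

theorem walk_flat (ps : List (Word × Word)) (u : Word) : ∃ u', walk (flat ps) u =
    (flat (walkFrom ps (binVal u)).1, u') ∧ binVal u' = (walkFrom ps (binVal u)).2 := by
  have : ∀ k ps u, ps.length ≤ k → ∃ u', walkStep^[k] (flat ps, u) =
      (flat (walkFrom ps (binVal u)).1, u') ∧ binVal u' = (walkFrom ps (binVal u)).2 := by
    intro k
    induction k with
    | zero =>
      intro ps u h
      have : ps = [] := by simpa using h
      subst this; exact ⟨u, rfl, rfl⟩
    | succ k ih =>
      intro ps u h
      cases ps with
      | nil => simpa [walkStep] using ih [] u (by simp)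
      | cons p ps =>
        have h1 := subWords_spec u p.2
        by_cases hp : binVal u < binVal p.2
        · refine ⟨u, ?_, by simp [walkFrom, hp]⟩
          simp only [walkFrom, hp, if_true]
          exact iterate_fixed (by simp [walkStep, h1.1, hp]) _
        · obtain ⟨u', h2, h3⟩ := ih ps (subWords u p.2).2 (by simpa using h)
          rw [h1.2.1 (by omega)] at h2 h3
          refine ⟨u', ?_, by simpa [walkFrom, hp] using h3⟩
          rw [iterate_succ_apply]
          simpa [walkFrom, walkStep, hp, h1.1] using h2
  exact this _ ps u (length_le_size_flat ps)

/-- The sum of the weights. -/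
def weight (ps : List (Word × Word)) : ℕ := (ps.map fun p => binVal p.2).sum

theorem walkFrom_of_lt {ps : List (Word × Word)} {n : ℕ} (h : n < weight ps) :
    (walkFrom ps n).1 ≠ [] := by
  induction ps generalizing n with
  | nil => simp [weight] at h
  | cons p ps ih =>
    by_cases hp : n < binVal p.2
    · simp [walkFrom, hp]
    · have : n - binVal p.2 < weight ps := by simp [weight] at h ⊢; omega
      simpa [walkFrom, hp] using ih this

theorem walkFrom_of_le {ps : List (Word × Word)} {n : ℕ} (h : weight ps ≤ n) :
    walkFrom ps n = ([], n - weight ps) := by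
  induction ps generalizing n with
  | nil => simp [weight, walkFrom]
  | cons p ps ih =>
    have h' : binVal p.2 + weight ps ≤ n := by simpa [weight] using h
    have hp : ¬ n < binVal p.2 := by omega
    have e : weight (p :: ps) = binVal p.2 + weight ps := by simp [weight]
    rw [walkFrom, if_neg hp, ih (by omega), e, Nat.sub_sub]

/-- One step of Horner's rule modulo the sum of the weights. -/
def hornerStep (l : List Word) (x : Word × Word) : Word × Word :=
  (bif (walk l (x.2.headD false :: x.1)).1.isEmpty then (walk l (x.2.headD false :: x.1)).2
    else x.2.headD false :: x.1, x.2.tail)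

/-- The code of the entry that is chosen from a weighted list by the random word `r`. -/
def sample (l : List Word) (r : Word) : Word :=
  (walk l ((hornerStep l)^[r.length] ([], r)).1).1.headD []

@[fun_prop] theorem PT.sample_comp {l : α → List Word} {r : α → Word} (hl : PT l) (hr : PT r) :
    PT (fun a => sample (l a) (r a)) := by
  have h : PT fun a => (hornerStep (l a))^[(r a).length] ([], r a) := by
    refine PT.iterate_add (step := fun a => hornerStep (l a)) (by unfold hornerStep; fun_prop)
      (by fun_prop) (by fun_prop) (S := fun a => 4 * size (l a) + 2)
      (((PolyBdd.const 4).mul hl.polyBdd_size).add (PolyBdd.const 2)) (fun a x => ?_)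
    have h1 := size_walk_le (l a) (x.2.headD false :: x.1)
    simp only [hornerStep, size_pair, size_word, List.length_tail, List.length_cons] at *
    cases (walk (l a) (x.2.headD false :: x.1)).1.isEmpty
    · simp only [cond_false, List.length_cons]; omega
    · simp only [cond_true]; omega
  unfold sample
  fun_prop

/-- The value of a word as a binary number, the highest bit first, continued from `n`. -/
def hornerVal : ℕ → Word → ℕ
  | n, [] => n
  | n, b :: r => hornerVal (b.toNat + 2 * n) r

theorem hornerVal_mod (m n : ℕ) (r : Word) : hornerVal (n % m) r % m = hornerVal n r % m := by
  induction r generalizing n with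
  | nil => simp [hornerVal]
  | cons b r ih =>
    rw [hornerVal, hornerVal, ← ih, ← ih (b.toNat + 2 * n)]
    congr 2
    simp [Nat.add_mod, Nat.mul_mod]

theorem hornerStep_iterate (ps : List (Word × Word)) (r u : Word)
    (hu : binVal u < weight ps) :
    ∃ u', (hornerStep (flat ps))^[r.length] (u, r) = (u', []) ∧
      binVal u' = hornerVal (binVal u) r % weight ps := by
  induction r generalizing u with
  | nil => exact ⟨u, rfl, by rw [hornerVal, Nat.mod_eq_of_lt hu]⟩
  | cons b r ih =>
    obtain ⟨u', h1, h2⟩ := walk_flat ps (b :: u)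
    have hb : binVal (b :: u) = b.toNat + 2 * binVal u := rfl
    by_cases h : binVal (b :: u) < weight ps
    · obtain ⟨u'', h3, h4⟩ := ih (b :: u) h
      refine ⟨u'', ?_, by rw [h4, hb, hornerVal]⟩
      have h5 := walkFrom_of_lt h
      have h6 : (walk (flat ps) (b :: u)).1.isEmpty = false := by
        rw [h1]
        cases h7 : (walkFrom ps (binVal (b :: u))).1 with
        | nil => exact absurd h7 h5
        | cons p ps => simp
      rw [List.length_cons, iterate_succ_apply, hornerStep]
      simpa [h6] using h3
    · rw [walkFrom_of_le (by omega)] at h1 h2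
      simp only at h2
      have h5 : binVal u' = binVal (b :: u) % weight ps := by
        rw [h2, Nat.mod_eq_sub_mod (by omega), Nat.mod_eq_of_lt]
        have : b.toNat ≤ 1 := by cases b <;> simp
        omega
      obtain ⟨u'', h3, h4⟩ := ih u' (by rw [h5]; exact Nat.mod_lt _ (by omega))
      refine ⟨u'', ?_, by rw [h4, hornerVal, ← hb, h5, hornerVal_mod]⟩
      rw [List.length_cons, iterate_succ_apply, hornerStep]
      simpa [h1] using h3

/-- The sampler reduces the number given by the random word modulo the sum of the weights. -/
theorem sample_flat (ps : List (Word × Word)) (r : Word) (h : 0 < weight ps) :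
    sample (flat ps) r = (flat (walkFrom ps (hornerVal 0 r % weight ps)).1).headD [] := by
  obtain ⟨u, h1, h2⟩ := hornerStep_iterate ps r [] h
  obtain ⟨u', h3, -⟩ := walk_flat ps u
  rw [sample, h1, h3, h2]
  rfl

theorem length_sample_le (l : List Word) (r : Word) : (sample l r).length ≤ size l := by
  have key : ∀ k x, walkStep^[k] x |>.1.Sublist x.1 := by
    intro k
    induction k with
    | zero => intro x; exact List.Sublist.refl _
    | succ k ih =>
      intro x
      refine (ih _).trans ?_
      unfold walkStep
      cases x.1.isEmpty || (subWords x.2 (x.1.tail.headD [])).1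
      · simp only [cond_false]
        exact (List.tail_sublist _).trans (List.tail_sublist _)
      · simp only [cond_true, List.Sublist.refl]
  have h := size_sublist (key (size l) (l, ((hornerStep l)^[r.length] ([], r)).1))
  have h' := size_tail_words_le (walk l ((hornerStep l)^[r.length] ([], r)).1).1
  change size (walk l _).1 ≤ size l at h
  unfold sample
  omega

/-! ### Random unary numbers -/

/-- One step of Horner's rule modulo `T`, in unary. -/
def unaryStep (T : ℕ) (x : ℕ × Word) : ℕ × Word :=
  let u := (x.2.headD false).toNat + 2 * x.1
  let u' := bif decide (T ≤ u) then u - T else u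
  (u' - (u' - T), x.2.tail)

/-- A number below `T` that is given by the random word `r`. -/
def unaryMod (T : ℕ) (r : Word) : ℕ := ((unaryStep T)^[r.length] (0, r)).1

@[fun_prop] theorem PT.toNat {b : α → Bool} (hb : PT b) : PT (fun a => (b a).toNat) := by
  have : (fun a => (b a).toNat) = fun a => bif b a then 1 else 0 := by
    funext a; cases b a <;> rfl
  rw [this]; fun_prop

@[fun_prop] theorem PT.unaryMod_comp {T : α → ℕ} {r : α → Word} (hT : PT T) (hr : PT r) :
    PT (fun a => unaryMod (T a) (r a)) := by
  have h : PT fun a => (unaryStep (T a))^[(r a).length] (0, r a) := by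
    refine PT.iterate_add (step := fun a => unaryStep (T a)) (by unfold unaryStep; fun_prop)
      (by fun_prop) (by fun_prop) (S := fun a => 2 * T a)
      ((PolyBdd.const 2).mul hT.polyBdd) (fun a x => ?_)
    simp only [unaryStep, size_pair, size_nat, size_word, List.length_tail]
    omega
  exact h.fst

theorem unaryMod_eq {T : ℕ} (r : Word) (hT : 0 < T) : unaryMod T r = hornerVal 0 r % T := by
  have : ∀ n, n < T → (unaryStep T)^[r.length] (n, r) = (hornerVal n r % T, []) := by
    induction r with
    | nil => intro n hn; simp [hornerVal, Nat.mod_eq_of_lt hn]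
    | cons b r ih =>
      intro n hn
      have hb : b.toNat ≤ 1 := by cases b <;> simp
      rw [List.length_cons, iterate_succ_apply, hornerVal, ← hornerVal_mod]
      rw [← ih _ (Nat.mod_lt _ hT)]
      congr 1
      simp only [unaryStep, List.headD_cons, List.tail_cons, Prod.mk.injEq, and_true]
      by_cases h : T ≤ b.toNat + 2 * n
      · simp [h]
        rw [Nat.mod_eq_sub_mod h, Nat.mod_eq_of_lt (by omega)]
        omega
      · simp [h]
        rw [Nat.mod_eq_of_lt (by omega)]
        omega
  rw [unaryMod, this 0 hT]

end PolynomialTime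

/-! ### Expectations over random words -/

theorem coinExpect_zero (g : Word → ℝ) : coinExpect 0 g = g [] := by
  simp [coinExpect]

theorem coinExpect_succ (n : ℕ) (g : Word → ℝ) :
    coinExpect (n + 1) g =
      (coinExpect n (fun r => g (false :: r)) + coinExpect n (fun r => g (true :: r))) / 2 := by
  unfold coinExpect
  rw [← (Fin.consEquiv fun _ => Bool).sum_comp, Fintype.sum_prod_type]
  simp only [Fintype.sum_bool, Fin.consEquiv, Equiv.coe_fn_mk, List.ofFn_succ, Fin.cons_zero,
    Fin.cons_succ, pow_succ]
  field_simp
  ring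

theorem coinExpect_congr {n : ℕ} {g h : Word → ℝ} (H : ∀ r, r.length = n → g r = h r) :
    coinExpect n g = coinExpect n h := by
  unfold coinExpect
  congr 1
  exact Finset.sum_congr rfl fun r _ => H _ (by simp)

theorem coinExpect_mono {n : ℕ} {g h : Word → ℝ} (H : ∀ r, r.length = n → g r ≤ h r) :
    coinExpect n g ≤ coinExpect n h := by
  unfold coinExpect
  gcongr
  exact H _ (by simp)

theorem coinExpect_const (n : ℕ) (c : ℝ) : coinExpect n (fun _ => c) = c := by
  simp [coinExpect]

theorem coinExpect_add_fun (n : ℕ) (g h : Word → ℝ) :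
    coinExpect n (fun r => g r + h r) = coinExpect n g + coinExpect n h := by
  simp only [coinExpect, Finset.sum_add_distrib, add_div]

theorem coinExpect_sub_fun (n : ℕ) (g h : Word → ℝ) :
    coinExpect n (fun r => g r - h r) = coinExpect n g - coinExpect n h := by
  simp only [coinExpect, Finset.sum_sub_distrib, sub_div]

theorem coinExpect_mul (n : ℕ) (c : ℝ) (g : Word → ℝ) :
    coinExpect n (fun r => c * g r) = c * coinExpect n g := by
  simp only [coinExpect, ← Finset.mul_sum, mul_div_assoc]

theorem coinExpect_sum {ι : Type*} (s : Finset ι) (n : ℕ) (g : ι → Word → ℝ) :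
    coinExpect n (fun r => ∑ i ∈ s, g i r) = ∑ i ∈ s, coinExpect n (g i) := by
  simp only [coinExpect, ← Finset.sum_div]
  rw [Finset.sum_comm]

theorem coinExpect_swap (m n : ℕ) (g : Word → Word → ℝ) :
    coinExpect m (fun r => coinExpect n fun r' => g r r') =
      coinExpect n (fun r' => coinExpect m fun r => g r r') := by
  simp only [coinExpect, ← Finset.sum_div]
  rw [Finset.sum_comm, div_right_comm]

/-- A random word of `m + n` bits consists of two independent random words. -/
theorem coinExpect_add (m n : ℕ) (g : Word → ℝ) :
    coinExpect (m + n) g = coinExpect m (fun r => coinExpect n fun r' => g (r ++ r')) := by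
  induction m generalizing g with
  | zero => simp [coinExpect_zero]
  | succ m ih => rw [Nat.add_right_comm, coinExpect_succ, coinExpect_succ, ih, ih]; rfl

theorem coinExpect_take {m n : ℕ} (h : m ≤ n) (g : Word → ℝ) :
    coinExpect n (fun r => g (r.take m)) = coinExpect m g := by
  obtain ⟨k, rfl⟩ := Nat.exists_eq_add_of_le h
  rw [coinExpect_add]
  refine coinExpect_congr fun r hr => ?_
  simp [← hr, coinExpect_const]

open Classical in
/-- If each round of a randomized process, with fresh random bits, keeps an invariant except with
probability `δ`, then `N` rounds keep it except with probability `N * δ`. -/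
theorem coinExpect_iterate {σ : Type*} (core : σ → Word → σ) (ρ : ℕ) (Inv : ℕ → σ → Prop) (δ : ℝ)
    (h : ∀ k x, Inv k x → coinExpect ρ (fun b => if Inv (k + 1) (core x b) then 0 else 1) ≤ δ)
    (N k : ℕ) (x : σ) (hx : Inv k x) :
    coinExpect (N * ρ) (fun r => if Inv (k + N)
      ((fun y : σ × Word => (core y.1 (y.2.take ρ), y.2.drop ρ))^[N] (x, r)).1 then 0 else 1) ≤
        N * δ := by
  induction N generalizing k x with
  | zero => simp [coinExpect_zero, hx]
  | succ N ih =>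
    have hδ : 0 ≤ δ := le_trans (by
      refine (coinExpect_const ρ 0).symm.le.trans (coinExpect_mono fun r _ => ?_)
      split_ifs <;> norm_num) (h k x hx)
    rw [Nat.succ_mul, add_comm, coinExpect_add]
    calc _ ≤ coinExpect ρ (fun b => (if Inv (k + 1) (core x b) then 0 else 1) + N * δ) := by
          refine coinExpect_mono fun b hb => ?_
          have e : ∀ r : Word, (b ++ r).take ρ = b := fun r => List.take_left' hb
          have e' : ∀ r : Word, (b ++ r).drop ρ = r := fun r => List.drop_left' hb
          simp only [iterate_succ_apply, e, e']
          by_cases hi : Inv (k + 1) (core x b)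
          · rw [if_pos hi, zero_add, show k + (N + 1) = k + 1 + N by ring]
            exact ih _ _ hi
          · rw [if_neg hi]
            refine le_trans (b := 1) ?_ (by nlinarith [Nat.cast_nonneg (α := ℝ) N])
            refine le_trans (coinExpect_mono fun r _ => ?_) (coinExpect_const (N * ρ) 1).le
            split_ifs <;> norm_num
      _ ≤ _ := by
          rw [coinExpect_add_fun, coinExpect_const]
          have := h k x hx
          push_cast
          linarith

/-- Horner's rule gives a uniformly random number. -/
theorem coinExpect_hornerVal (n m : ℕ) (ψ : ℕ → ℝ) :
    coinExpect n (fun r => ψ (hornerVal m r)) = (∑ u ∈ Finset.range (2 ^ n), ψ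
      (m * 2 ^ n + u)) / 2 ^ n := by
  induction n generalizing m with
  | zero => simp [coinExpect_zero, hornerVal]
  | succ n ih =>
    rw [coinExpect_succ]
    simp only [hornerVal]
    rw [ih, ih, pow_succ, mul_two, Finset.sum_range_add]
    have e1 : ∀ u, (false.toNat + 2 * m) * 2 ^ n + u = m * (2 ^ n + 2 ^ n) + u := fun u => by
      simp; ring
    have e2 : ∀ u, (true.toNat + 2 * m) * 2 ^ n + u = m * (2 ^ n + 2 ^ n) + (2 ^ n + u) :=
      fun u => by simp; ring
    simp only [e1, e2, pow_succ]
    field_simp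

theorem sum_range_mod (W k j : ℕ) (hj : j ≤ W) (ψ : ℕ → ℝ) :
    ∑ u ∈ Finset.range (W * k + j), ψ (u % W) =
      k * ∑ u ∈ Finset.range W, ψ u + ∑ u ∈ Finset.range j, ψ u := by
  have h0 : ∀ j ≤ W, ∑ u ∈ Finset.range j, ψ (u % W) = ∑ u ∈ Finset.range j, ψ u := fun j hj =>
    Finset.sum_congr rfl fun u hu => by
      rw [Nat.mod_eq_of_lt (lt_of_lt_of_le (Finset.mem_range.1 hu) hj)]
  induction k with
  | zero => simp [h0 j hj]
  | succ k ih =>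
    rw [Nat.mul_succ, show W * k + W + j = W + (W * k + j) by ring, Finset.sum_range_add]
    simp only [Nat.add_mod_left]
    rw [ih, h0 W le_rfl]
    push_cast
    ring

/-- A random number of `n` bits, reduced modulo `W`, is nearly uniform. -/
theorem abs_coinExpect_mod_sub_le (n W : ℕ) (hW : 0 < W) (ψ : ℕ → ℝ) (v : ℝ)
    (hψ : ∀ u, 0 ≤ ψ u ∧ ψ u ≤ v) :
    |coinExpect n (fun r => ψ (hornerVal 0 r % W)) - (∑ u ∈ Finset.range W, ψ u) / W| ≤
      v * W / 2 ^ n := by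
  rw [coinExpect_hornerVal n 0 fun u => ψ (u % W)]
  simp only [zero_mul, zero_add]
  have h2 : (2 : ℕ) ^ n = W * (2 ^ n / W) + 2 ^ n % W := (Nat.div_add_mod _ _).symm
  have hj : 2 ^ n % W < W := Nat.mod_lt _ hW
  have e := sum_range_mod W (2 ^ n / W) (2 ^ n % W) hj.le ψ
  rw [← h2] at e
  rw [e]
  set k := 2 ^ n / W
  set j := 2 ^ n % W
  set S := ∑ u ∈ Finset.range W, ψ u with hS
  set S' := ∑ u ∈ Finset.range j, ψ u with hS'
  have h2' : (2 : ℝ) ^ n = W * k + j := by exact_mod_cast h2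
  have hW' : (0 : ℝ) < W := by exact_mod_cast hW
  have hv : 0 ≤ v := (hψ 0).1.trans (hψ 0).2
  have hjW : (j : ℝ) ≤ W := by exact_mod_cast hj.le
  have b1 : 0 ≤ S := Finset.sum_nonneg fun u _ => (hψ u).1
  have b2 : S ≤ W * v := by
    simpa using Finset.sum_le_card_nsmul (Finset.range W) ψ v fun u _ => (hψ u).2
  have b3 : 0 ≤ S' := Finset.sum_nonneg fun u _ => (hψ u).1
  have b4 : S' ≤ j * v := by
    simpa using Finset.sum_le_card_nsmul (Finset.range j) ψ v fun u _ => (hψ u).2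
  have key : (k * S + S') / 2 ^ n - S / W = (S' - j * (S / W)) / 2 ^ n := by
    have : (0 : ℝ) < 2 ^ n := by positivity
    field_simp
    rw [h2']
    ring
  rw [key, abs_div, abs_of_pos (by positivity : (0 : ℝ) < 2 ^ n)]
  gcongr
  have b5 : 0 ≤ S / W := by positivity
  have b6 : S / W ≤ v := by rw [div_le_iff₀ hW']; linarith
  have b7 : j * (S / W) ≤ W * v := by gcongr
  have b8 : (j : ℝ) * v ≤ W * v := by gcongr
  have b9 : 0 ≤ (j : ℝ) * (S / W) := by positivity
  rw [abs_le]
  constructor <;> linarith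

/-- A random number of `n` bits, reduced modulo `T`, takes no value with probability above
`2 / T`. -/
theorem coinExpect_mod_le (n T : ℕ) (hT : 0 < T) (hn : T ≤ 2 ^ n) (ψ : ℕ → ℝ) (hψ : ∀ u, 0 ≤ ψ u) :
    coinExpect n (fun r => ψ (hornerVal 0 r % T)) ≤ 2 / T * ∑ u ∈ Finset.range T, ψ u := by
  rw [coinExpect_hornerVal n 0 fun u => ψ (u % T)]
  simp only [zero_mul, zero_add]
  have h2 : (2 : ℕ) ^ n = T * (2 ^ n / T) + 2 ^ n % T := (Nat.div_add_mod _ _).symm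
  have hj : 2 ^ n % T < T := Nat.mod_lt _ hT
  have e := sum_range_mod T (2 ^ n / T) (2 ^ n % T) hj.le ψ
  rw [← h2] at e
  rw [e]
  have hk : 1 ≤ 2 ^ n / T := (Nat.one_le_div_iff hT).2 hn
  set k := 2 ^ n / T
  set j := 2 ^ n % T
  set S := ∑ u ∈ Finset.range T, ψ u with hS
  have hT' : (0 : ℝ) < T := by exact_mod_cast hT
  have h2' : (2 : ℝ) ^ n = T * k + j := by exact_mod_cast h2
  have hk' : (1 : ℝ) ≤ k := by exact_mod_cast hk
  have b1 : 0 ≤ S := Finset.sum_nonneg fun u _ => hψ u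
  have b2 : ∑ u ∈ Finset.range j, ψ u ≤ S :=
    Finset.sum_le_sum_of_subset_of_nonneg (by intro x; simp; omega) fun u _ _ => hψ u
  rw [div_le_iff₀ (by positivity)]
  calc _ ≤ k * S + k * S := by nlinarith
    _ = 2 / T * S * (T * k) := by field_simp; ring
    _ ≤ _ := by
      rw [h2']
      have : 0 ≤ 2 / T * S := by positivity
      gcongr
      simp

/-! ### Answering an instance of the offline problem by a learner -/

/-- Apply `g` to `T` consecutive blocks of `K` bits. -/
def blocks {γ : Type*} (g : Word → γ) (K : ℕ) : ℕ → Word → List γ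
  | 0, _ => []
  | T + 1, r => g (r.take K) :: blocks g K T (r.drop K)

theorem length_blocks {γ : Type*} (g : Word → γ) (K T : ℕ) (r : Word) :
    (blocks g K T r).length = T := by
  induction T generalizing r with
  | zero => rfl
  | succ T ih => simp [blocks, ih]

theorem map_blocks {γ δ : Type*} (g : Word → γ) (φ : γ → δ) (K T : ℕ) (r : Word) :
    (blocks g K T r).map φ = blocks (fun b => φ (g b)) K T r := by
  induction T generalizing r with
  | zero => rfl
  | succ T ih => simp [blocks, ih]

theorem blocks_append {γ : Type*} (g : Word → γ) (K s t : ℕ) (r r' : Word)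
    (hr : r.length = s * K) : blocks g K (s + t) (r ++ r') = blocks g K s r ++ blocks g K t r' := by
  induction s generalizing r with
  | zero =>
    have : r = [] := by simpa using hr
    subst this; simp [blocks]
  | succ s ih =>
    have hK : K ≤ r.length := by rw [hr, Nat.succ_mul]; omega
    rw [Nat.add_right_comm, blocks, blocks, List.take_append_of_le_length hK,
      List.drop_append_of_le_length hK, ih _ (by rw [List.length_drop, hr, Nat.succ_mul]; omega)]
    rfl

theorem blocks_congr {γ : Type*} {g g' : Word → γ} {K : ℕ} (h : ∀ b, g b = g' b) (T : ℕ)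
    (r : Word) :
    blocks g K T r = blocks g' K T r := by
  rw [show g = g' from funext h]

/-- Run a learner for a random number of steps, with functions sampled from the distribution in
the instance `q`, and answer with its next move. All randomness comes from the word `r`: the first
`K` bits give the number of steps, the next `T * K` bits the functions, and the learner gets the
rest. The second word of `q` is `v` in unary, and the length of the third one, the index of a
function,
is `b`. -/
def answer (act : List Word → List Word) (coins : Polynomial ℕ) (T K : ℕ) (q : List Word)
    (r : Word) : Word :=
  (act (q.headD [] :: unary (q.tail.tail.headD []).length :: q.tail.headD [] :: unary T ::
    ((r.drop K).drop (T * K)).take (coins.eval ((q.headD []).length +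
      (q.tail.tail.headD []).length + (q.tail.headD []).length + T)) ::
    (blocks (sample q.tail.tail) K T (r.drop K)).take (unaryMod T (r.take K)))).headD []

/-- The entry at position `n` of a list in which each entry is repeated as often as its weight says,
or `d` behind the end. -/
def pick {γ : Type*} (d : γ) : List (γ × ℕ) → ℕ → γ
  | [], _ => d
  | a :: l, n => if n < a.2 then a.1 else pick d l (n - a.2)

theorem sum_pick {γ : Type*} (d : γ) (l : List (γ × ℕ)) (ψ : γ → ℝ) :
    ∑ n ∈ Finset.range (l.map Prod.snd).sum, ψ (pick d l n) =
      (l.map fun a => (a.2 : ℝ) * ψ a.1).sum := by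
  induction l with
  | nil => simp
  | cons a l ih =>
    rw [List.map_cons, List.sum_cons, Finset.sum_range_add, List.map_cons, List.sum_cons, ← ih]
    congr 1
    · rw [Finset.sum_congr rfl fun n hn => by
        rw [pick, if_pos (Finset.mem_range.1 hn)]]
      simp
    · refine Finset.sum_congr rfl fun n _ => ?_
      rw [pick, if_neg (by omega), Nat.add_sub_cancel_left]

/-- The codes and the weights of the entries of a weighted list. -/
def codes {γ : Type*} (code : γ → Word) (l : List (γ × ℕ)) : List (Word × Word) :=
  l.map fun a => (code a.1, Computability.encodeNat a.2)

theorem weight_codes {γ : Type*} (code : γ → Word) (l : List (γ × ℕ)) :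
    weight (codes code l) = (l.map Prod.snd).sum := by
  simp only [weight, codes, List.map_map]
  congr 1
  refine List.map_congr_left fun a _ => ?_
  simp [binVal_encodeNat]

theorem walkFrom_codes {γ : Type*} (code : γ → Word) (d : γ) (l : List (γ × ℕ)) (n : ℕ)
    (hn : n < (l.map Prod.snd).sum) :
    (flat (walkFrom (codes code l) n).1).headD [] = code (pick d l n) := by
  induction l generalizing n with
  | nil => simp at hn
  | cons a l ih =>
    change (flat (walkFrom ((code a.1, Computability.encodeNat a.2) :: codes code l) n).1).headD []
      = _
    rw [walkFrom, pick, binVal_encodeNat]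
    by_cases h : n < a.2
    · rw [if_pos h, if_pos h]; rfl
    · rw [if_neg h, if_neg h]
      exact ih _ (by simp at hn; omega)

section Learner

variable {S : Word → Setting} (A : Learner S)

theorem ExplicitDist.describe_eq {S : Setting} (D : ExplicitDist S) :
    D.describe = flat (codes S.codeF D.entries) := by
  simp [ExplicitDist.describe, flat, codes, List.flatMap_map]

theorem ExplicitDist.totalWeight_pos {S : Setting} (D : ExplicitDist S) : 0 < D.totalWeight := by
  obtain ⟨a, l, h⟩ := List.exists_cons_of_ne_nil D.entries_ne_nil
  have := D.weight_pos a (by simp [h])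
  simp [ExplicitDist.totalWeight, h]
  omega

theorem ExplicitDist.expect_eq {S : Setting} (D : ExplicitDist S) (d : S.F) (x : S.X) :
    D.expect x = (∑ n ∈ Finset.range D.totalWeight, (pick d D.entries n).1 x) / D.totalWeight := by
  rw [ExplicitDist.totalWeight, sum_pick d D.entries fun f => f.1 x, ExplicitDist.expect,
    div_eq_mul_inv, ← List.sum_map_mul_right]
  congr 1
  refine List.map_congr_left fun a _ => ?_
  rw [ExplicitDist.totalWeight]
  ring

/-- A function chosen by the random word `b`. -/
def ExplicitDist.draw {S : Setting} (D : ExplicitDist S) (d : S.F) (b : Word) : S.F :=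
  pick d D.entries (hornerVal 0 b % D.totalWeight)

theorem ExplicitDist.sample_describe {S : Setting} (D : ExplicitDist S) (d : S.F) (b : Word) :
    sample D.describe b = S.codeF (D.draw d b) := by
  have h := D.totalWeight_pos
  rw [D.describe_eq, sample_flat _ _ (by rw [weight_codes]; exact h), weight_codes]
  exact walkFrom_codes _ d _ _ (Nat.mod_lt _ h)

/-- The sampled function has nearly the expected value. -/
theorem ExplicitDist.abs_draw_sub_le {S : Setting} (D : ExplicitDist S) (d : S.F) (K : ℕ)
    (x : S.X) :
    |coinExpect K (fun b => (D.draw d b).1 x) - D.expect x| ≤ S.v * D.totalWeight / 2 ^ K := by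
  rw [D.expect_eq d]
  exact abs_coinExpect_mod_sub_le K _ D.totalWeight_pos (fun n => (pick d D.entries n).1 x) S.v
    fun n => S.mem_range _ (pick d D.entries n).2 x

/-- The function of step `t` is independent of the functions before. -/
theorem coinExpect_blocks {γ : Type*} (g : Word → γ) (d : γ) (K T t : ℕ) (ht : t < T)
    (Ψ : γ → List γ → ℝ) :
    coinExpect (T * K) (fun r => Ψ ((blocks g K T r).getD t d) ((blocks g K T r).take t)) =
      coinExpect (T * K) (fun r => coinExpect K fun b => Ψ (g b) ((blocks g K T r).take t)) := by
  obtain ⟨s, rfl⟩ := Nat.exists_eq_add_of_lt ht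
  have e : (t + s + 1) * K = t * K + (K + s * K) := by ring
  have key : ∀ r b r' : Word, r.length = t * K → b.length = K →
      blocks g K (t + s + 1) (r ++ (b ++ r')) = blocks g K t r ++ (g b :: blocks g K s r') := by
    intro r b r' hr hb
    rw [add_assoc, blocks_append _ _ _ _ _ _ hr, blocks, List.take_left' hb, List.drop_left' hb]
  rw [e]
  simp only [coinExpect_add]
  refine coinExpect_congr fun r hr => ?_
  have h1 : ∀ b r' : Word, b.length = K →
      (blocks g K (t + s + 1) (r ++ (b ++ r'))).take t = blocks g K t r := fun b r' hb => by
    rw [key r b r' hr hb, List.take_left' (length_blocks _ _ _ _)]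
  have h2 : ∀ b r' : Word, b.length = K →
      (blocks g K (t + s + 1) (r ++ (b ++ r'))).getD t d = g b := fun b r' hb => by
    rw [key r b r' hr hb]
    simp [length_blocks]
  calc _ = coinExpect K (fun b => Ψ (g b) (blocks g K t r)) := by
        refine coinExpect_congr fun b hb => ?_
        simp only [h1 b _ hb, h2 b _ hb, coinExpect_const]
    _ = _ := by
        symm
        refine Eq.trans (coinExpect_congr fun b hb => ?_) (coinExpect_const K _)
        simp only [h1 b _ hb, coinExpect_const]

theorem ofFn_getD {γ : Type*} (l : List γ) (d : γ) {T : ℕ} (h : l.length = T) :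
    List.ofFn (fun t : Fin T => l.getD t d) = l := by
  subst h
  apply List.ext_getElem
  · simp
  · intro i h1 h2; simp

/-- The regret bound, averaged over sampled functions: in a random step, the move is nearly optimal
for the sampling distribution. -/
theorem Learner.sum_gap_le (e : Word) (T K : ℕ) (hT : 1 ≤ T) (g : Word → (S e).F) (d : (S e).F)
    (ε : ℝ) (hε : ∀ f, A.regret e T f ≤ ε) (y : (S e).X) :
    ∑ t ∈ Finset.range T, coinExpect (T * K) (fun R =>
      coinExpect (A.coins.eval (e.length + (S e).b + (S e).v + T)) fun r =>
        coinExpect K (fun b => (g b).1 y) -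
          coinExpect K fun b => (g b).1 (A.play e T r ((blocks g K T R).take t))) ≤ T * ε := by
  set m := A.coins.eval (e.length + (S e).b + (S e).v + T) with hm
  have hT' : (0 : ℝ) < T := by exact_mod_cast hT
  have h1 : ∀ t ∈ Finset.range T, coinExpect (T * K) (fun R => coinExpect m fun r =>
        coinExpect K (fun b => (g b).1 y) -
          coinExpect K fun b => (g b).1 (A.play e T r ((blocks g K T R).take t))) =
      coinExpect (T * K) (fun R => coinExpect m fun r => ((blocks g K T R).getD t d).1 y -
        ((blocks g K T R).getD t d).1 (A.play e T r ((blocks g K T R).take t))) := by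
    intro t ht
    rw [coinExpect_blocks g d K T t (Finset.mem_range.1 ht) fun f l =>
      coinExpect m fun r => f.1 y - f.1 (A.play e T r l)]
    refine coinExpect_congr fun R _ => ?_
    rw [coinExpect_swap]
    refine coinExpect_congr fun r _ => ?_
    rw [coinExpect_sub_fun]
  rw [Finset.sum_congr rfl h1, ← coinExpect_sum]
  refine le_trans (coinExpect_mono fun R _ => ?_) (coinExpect_const (T * K) (T * ε)).le
  rw [← coinExpect_sum]
  have h2 := hε fun t : Fin T => (blocks g K T R).getD t d
  have hT1 : T * (1 / (T : ℝ)) = 1 := by field_simp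
  calc _ ≤ T * A.regret e T (fun t : Fin T => (blocks g K T R).getD t d) := ?_
    _ ≤ _ := by gcongr
  rw [Learner.regret, ofFn_getD _ d (length_blocks _ _ _ _), ← coinExpect_mul]
  refine coinExpect_mono fun r _ => ?_
  have hb : BddAbove (Set.range fun x : (S e).X => (1 / (T : ℝ)) * ∑ t : Fin T,
      (((blocks g K T R).getD t d).1 x - ((blocks g K T R).getD t d).1
        (A.play e T r ((blocks g K T R).take t)))) := by
    refine ⟨(1 / (T : ℝ)) * ∑ t : Fin T, ((S e).v : ℝ), ?_⟩
    rintro _ ⟨x, rfl⟩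
    dsimp only
    gcongr with t
    have h3 := (S e).mem_range _ ((blocks g K T R).getD t d).2
    have h4 := (h3 x).2
    have h5 := (h3 (A.play e T r ((blocks g K T R).take t))).1
    linarith
  refine le_trans ?_ (mul_le_mul_of_nonneg_left (le_ciSup hb y) hT'.le)
  rw [← mul_assoc, hT1, one_mul, Finset.sum_range]

/-- The optimal expected value. -/
noncomputable def ExplicitDist.opt {S : Setting} (D : ExplicitDist S) : ℝ := ⨆ x, D.expect x

theorem ExplicitDist.bddAbove {S : Setting} (D : ExplicitDist S) :
    BddAbove (Set.range D.expect) := by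
  obtain ⟨a, l, -⟩ := List.exists_cons_of_ne_nil D.entries_ne_nil
  refine ⟨S.v, ?_⟩
  rintro _ ⟨x, rfl⟩
  have hW : (0 : ℝ) < D.totalWeight := by exact_mod_cast D.totalWeight_pos
  rw [D.expect_eq a.1, div_le_iff₀ hW]
  simpa [mul_comm] using Finset.sum_le_card_nsmul (Finset.range D.totalWeight)
    (fun n => (pick a.1 D.entries n).1 x) S.v fun n _ => (S.mem_range _ (Subtype.property _) x).2

theorem ExplicitDist.le_opt {S : Setting} (D : ExplicitDist S) (x : S.X) : D.expect x ≤ D.opt :=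
  le_ciSup D.bddAbove x

theorem ExplicitDist.isApproxOpt_of {S : Setting} (D : ExplicitDist S) {ε : ℝ} {x : S.X}
    (h : D.opt - D.expect x ≤ ε) : D.IsApproxOpt ε x := fun y => by
  have := D.le_opt y; linarith

/-- The sum over all steps of the expected distance of the move from the optimum. -/
theorem Learner.sum_opt_sub_le (e : Word) (D : ExplicitDist (S e)) (T K : ℕ) (hT : 1 ≤ T)
    (d : (S e).F) (ε : ℝ) (hε : ∀ f, A.regret e T f ≤ ε) :
    ∑ t ∈ Finset.range T, coinExpect (T * K) (fun R =>
      coinExpect (A.coins.eval (e.length + (S e).b + (S e).v + T)) fun r =>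
        D.opt - D.expect (A.play e T r ((blocks (D.draw d) K T R).take t))) ≤
      T * (ε + 2 * ((S e).v * D.totalWeight / 2 ^ K)) := by
  set m := A.coins.eval (e.length + (S e).b + (S e).v + T) with hm
  set η : ℝ := (S e).v * D.totalWeight / 2 ^ K with hη
  have hT' : (0 : ℝ) < T := by exact_mod_cast hT
  have key : ∀ y, ∑ t ∈ Finset.range T, coinExpect (T * K) (fun R => coinExpect m fun r =>
        D.expect y - D.expect (A.play e T r ((blocks (D.draw d) K T R).take t))) ≤
      T * (ε + 2 * η) := by
    intro y
    have h1 := A.sum_gap_le e T K hT (D.draw d) d ε hε y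
    have h2 : ∀ t ∈ Finset.range T, coinExpect (T * K) (fun R => coinExpect m fun r =>
        D.expect y - D.expect (A.play e T r ((blocks (D.draw d) K T R).take t))) ≤
      coinExpect (T * K) (fun R => coinExpect m fun r =>
        coinExpect K (fun b => (D.draw d b).1 y) - coinExpect K fun b =>
          (D.draw d b).1 (A.play e T r ((blocks (D.draw d) K T R).take t))) + 2 * η := by
      intro t _
      rw [← coinExpect_const (T * K) (2 * η), ← coinExpect_add_fun]
      refine coinExpect_mono fun R _ => ?_
      rw [← coinExpect_const m (2 * η), ← coinExpect_add_fun]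
      refine coinExpect_mono fun r _ => ?_
      have h3 := abs_le.1 (D.abs_draw_sub_le d K y)
      have h4 := abs_le.1 (D.abs_draw_sub_le d K
        (A.play e T r ((blocks (D.draw d) K T R).take t)))
      rw [← hη] at h3 h4
      linarith [h3.1, h4.2]
    refine (Finset.sum_le_sum h2).trans ?_
    rw [Finset.sum_add_distrib, Finset.sum_const, Finset.card_range, nsmul_eq_mul]
    linarith
  have e1 : ∀ c : ℝ, ∑ t ∈ Finset.range T, coinExpect (T * K) (fun R => coinExpect m fun r =>
        c - D.expect (A.play e T r ((blocks (D.draw d) K T R).take t))) =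
      T * c - ∑ t ∈ Finset.range T, coinExpect (T * K) (fun R => coinExpect m fun r =>
        D.expect (A.play e T r ((blocks (D.draw d) K T R).take t))) := by
    intro c
    simp only [coinExpect_sub_fun, coinExpect_const, Finset.sum_sub_distrib, Finset.sum_const,
      Finset.card_range, nsmul_eq_mul]
  have := (S e).nonempty_X
  simp only [e1] at key ⊢
  have h5 : D.opt ≤ (T * (ε + 2 * η) + ∑ t ∈ Finset.range T, coinExpect (T * K) (fun R =>
      coinExpect m fun r =>
        D.expect (A.play e T r ((blocks (D.draw d) K T R).take t)))) / T :=
    ciSup_le fun y => by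
      rw [le_div_iff₀ hT']
      linarith [key y]
  rw [le_div_iff₀ hT'] at h5
  linarith

open Classical in
/-- With high probability, the answer computed by means of a learner with small regret solves the
instance. -/
theorem Learner.coinExpect_answer_le (e : Word) (D : ExplicitDist (S e)) (C c : ℝ) (T K m' : ℕ)
    (hT : 1 ≤ T) (hK : T ≤ 2 ^ K) (hm : A.coins.eval (e.length + (S e).b + (S e).v + T) ≤ m')
    (ε : ℝ) (hε : ∀ f, A.regret e T f ≤ ε) (hC : 0 < C) :
    coinExpect (K + (T * K + m')) (fun r => if (offlineProblem S C c).IsSolution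
        (e :: unary (S e).v :: D.describe)
        (answer A.act A.coins T K (e :: unary (S e).v :: D.describe) r) then 0 else 1) ≤
      (2 * ε + 4 * ((S e).v * D.totalWeight / 2 ^ K)) / (C / (D.supportSize : ℝ) ^ c) := by
  obtain ⟨a, l, hl⟩ := List.exists_cons_of_ne_nil D.entries_ne_nil
  set d := a.1 with hd
  set m := A.coins.eval (e.length + (S e).b + (S e).v + T) with hmdef
  set η : ℝ := (S e).v * D.totalWeight / 2 ^ K with hη
  set ε₀ : ℝ := C / (D.supportSize : ℝ) ^ c with hε₀
  have hT' : (0 : ℝ) < T := by exact_mod_cast hT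
  have hε₀' : 0 < ε₀ := by
    have : (0 : ℝ) < D.supportSize := by
      simp [ExplicitDist.supportSize, hl]; positivity
    positivity
  let q := e :: unary (S e).v :: D.describe
  have hb : (q.tail.tail.headD []).length = (S e).b := by
    change (D.describe.headD []).length = _
    rw [D.describe_eq, hl]
    exact (S e).length_codeF _
  have hv : (q.tail.headD []).length = (S e).v := List.length_replicate
  -- the bits are split into those for the step, those for the functions, and those of the learner
  have hans : ∀ r₁ R r₂ : Word, r₁.length = K → R.length = T * K → r₂.length = m' →
      answer A.act A.coins T K q (r₁ ++ (R ++ r₂)) = (S e).codeX (A.play e T (r₂.take m)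
        ((blocks (D.draw d) K T R).take (hornerVal 0 r₁ % T))) := by
    intro r₁ R r₂ h1 h2 h3
    have e1 : blocks (sample q.tail.tail) K T (R ++ r₂) =
        (blocks (D.draw d) K T R).map (S e).codeF := by
      have := blocks_append (sample q.tail.tail) K T 0 R r₂ h2
      rw [add_zero] at this
      rw [this, map_blocks, blocks, List.append_nil]
      exact blocks_congr (fun b => D.sample_describe d b) T R
    rw [answer, hb, hv, List.drop_left' h1, List.drop_left' h2, List.take_left' h1, e1,
      unaryMod_eq _ hT, ← List.map_take]
    change (A.act (e :: unary (S e).b :: unary (S e).v :: _)).headD [] = _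
    rw [A.act_eq e T _ _ ⟨_, d.2⟩ (by
      rw [List.length_take, h3]; exact min_eq_left hm) (by
      rw [List.length_take, length_blocks]
      exact lt_of_le_of_lt (min_le_left _ _) (Nat.mod_lt _ hT))]
    rfl
  -- Markov's inequality for the distance of the move in step `t` from the optimum
  let ψ : ℕ → ℝ := fun t => coinExpect (T * K) (fun R => coinExpect m fun r =>
        D.opt - D.expect (A.play e T r ((blocks (D.draw d) K T R).take t)))
  have hψ : ∀ t, 0 ≤ ψ t := by
    intro t
    refine (coinExpect_const (T * K) 0).symm.le.trans (coinExpect_mono fun R _ => ?_)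
    refine (coinExpect_const m 0).symm.le.trans (coinExpect_mono fun r _ => ?_)
    linarith [D.le_opt (A.play e T r ((blocks (D.draw d) K T R).take t))]
  have h1 : coinExpect (K + (T * K + m')) (fun r => if (offlineProblem S C c).IsSolution
        q (answer A.act A.coins T K q r) then 0 else 1) ≤
      coinExpect K (fun r₁ => ε₀⁻¹ * ψ (hornerVal 0 r₁ % T)) := by
    simp only [coinExpect_add]
    refine coinExpect_mono fun r₁ h1 => ?_
    rw [← coinExpect_mul]
    refine coinExpect_mono fun R h2 => ?_
    rw [← coinExpect_mul, ← coinExpect_take hm]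
    refine coinExpect_mono fun r₂ h3 => ?_
    rw [hans r₁ R r₂ h1 h2 h3]
    set x := A.play e T (r₂.take m) ((blocks (D.draw d) K T R).take (hornerVal 0 r₁ % T))
    split_ifs with hsol
    · have := D.le_opt x
      have h5 : 0 ≤ D.opt - D.expect x := by linarith
      positivity
    · have h4 : ε₀ < D.opt - D.expect x := by
        by_contra hcon
        exact hsol ⟨e, D, x, rfl, rfl, D.isApproxOpt_of (not_lt.1 hcon)⟩
      rw [← inv_mul_cancel₀ hε₀'.ne']
      gcongr
  refine h1.trans ?_
  rw [coinExpect_mul, div_eq_inv_mul]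
  gcongr
  refine (coinExpect_mod_le K T hT hK ψ hψ).trans ?_
  have h6 := A.sum_opt_sub_le e D T K hT d ε hε
  calc 2 / (T : ℝ) * ∑ u ∈ Finset.range T, ψ u ≤ 2 / T * (T * (ε + 2 * η)) := by gcongr
    _ = _ := by field_simp; ring

end Learner

/-! ### The answer is computed in polynomial time -/

theorem blocks_iterate (l : List Word) (K T : ℕ) (o : List Word) (r : Word) :
    ((fun x : List Word × Word => (sample l (x.2.take K) :: x.1, x.2.drop K))^[T] (o, r)).1 =
      (blocks (sample l) K T r).reverse ++ o := by
  induction T generalizing o r with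
  | zero => rfl
  | succ T ih => rw [iterate_succ_apply, ih]; simp [blocks]

section PolynomialTime

variable {α : Type} [Enc α]

@[fun_prop] theorem PT.blocks_comp {l : α → List Word} {K T : α → ℕ} {r : α → Word} (hl : PT l)
    (hK : PT K) (hT : PT T) (hr : PT r) : PT (fun a => blocks (sample (l a)) (K a) (T a)
      (r a)) := by
  have h : PT fun a => (fun x : List Word × Word =>
      (sample (l a) (x.2.take (K a)) :: x.1, x.2.drop (K a)))^[T a] ([], r a) := by
    refine PT.iterate_add (step := fun a (x : List Word × Word) =>
        (sample (l a) (x.2.take (K a)) :: x.1, x.2.drop (K a))) (by fun_prop) hT (by fun_prop)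
      (S := fun a => 4 * size (l a) + 2)
      (((PolyBdd.const 4).mul hl.polyBdd_size).add (PolyBdd.const 2)) fun a x => ?_
    have := length_sample_le (l a) (x.2.take (K a))
    simp only [size_pair, size_words_cons, size_word, List.length_drop]
    omega
  have h' := h.fst.reverseWords
  simpa only [blocks_iterate, List.append_nil, List.reverse_reverse] using h'

theorem PT.answer_comp {act : List Word → List Word} (hact : PT act) (coins : Polynomial ℕ)
    {T K : α → ℕ} {q : α → List Word} {r : α → Word} (hT : PT T) (hK : PT K) (hq : PT q)
    (hr : PT r) : PT (fun a => answer act coins (T a) (K a) (q a) (r a)) := by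
  unfold answer
  fun_prop

end PolynomialTime

/-! ### Choosing the number of steps -/

theorem length_encodeWords_cons (w : Word) (l : List Word) :
    (encodeWords (w :: l)).length = w.length + 1 + (encodeWords l).length := by
  simp [encodeWords]; omega

theorem weight_lt (ps : List (Word × Word)) :
    weight ps < 2 ^ (encodeWords (flat ps)).length := by
  induction ps with
  | nil => simp [weight]
  | cons p ps ih =>
    have h1 := binVal_lt p.2
    have h2 : weight (p :: ps) = binVal p.2 + weight ps := by simp [weight]
    rw [flat_cons, length_encodeWords_cons, length_encodeWords_cons, h2]
    have h3 : 2 ^ p.2.length ≤ 2 ^ (p.1.length + p.2.length + 1 + (encodeWords (flat ps)).length) :=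
      Nat.pow_le_pow_right (by omega) (by omega)
    have h4 : 2 ^ (encodeWords (flat ps)).length ≤
        2 ^ (p.1.length + p.2.length + 1 + (encodeWords (flat ps)).length) :=
      Nat.pow_le_pow_right (by omega) (by omega)
    have h5 : p.1.length + 1 + (p.2.length + 1 + (encodeWords (flat ps)).length) =
      p.1.length + p.2.length + 1 + (encodeWords (flat ps)).length + 1 := by omega
    rw [h5, pow_succ]
    omega

theorem length_le_length_encodeWords (ps : List (Word × Word)) :
    ps.length ≤ (encodeWords (flat ps)).length := by
  induction ps with
  | nil => simp
  | cons p ps ih =>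
    rw [flat_cons, length_encodeWords_cons, length_encodeWords_cons, List.length_cons]; omega

section Parameters

variable {S : Word → Setting}

/-- All parameters of an instance of encoded length at most `B` are at most `B`. -/
theorem instance_bounds (e : Word) (D : ExplicitDist (S e)) {B : ℕ}
    (h : (encodeWords (e :: unary (S e).v :: D.describe)).length ≤ B) :
    e.length + (S e).b + (S e).v ≤ B ∧ D.supportSize ≤ B ∧ D.totalWeight ≤ 2 ^ B := by
  rw [length_encodeWords_cons, length_encodeWords_cons, D.describe_eq] at h
  have h1 := weight_lt (codes (S e).codeF D.entries)
  have h2 := length_le_length_encodeWords (codes (S e).codeF D.entries)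
  have hv : (unary (S e).v).length = (S e).v := List.length_replicate
  rw [weight_codes] at h1
  have h3 : (S e).b ≤ (encodeWords (flat (codes (S e).codeF D.entries))).length := by
    obtain ⟨a, l, hl⟩ := List.exists_cons_of_ne_nil D.entries_ne_nil
    rw [hl]
    change _ ≤ (encodeWords ((S e).codeF a.1 :: _)).length
    rw [length_encodeWords_cons, (S e).length_codeF]
    omega
  refine ⟨by omega, ?_, ?_⟩
  · have : (codes (S e).codeF D.entries).length = D.supportSize := List.length_map _
    omega
  · rw [ExplicitDist.totalWeight]
    exact h1.le.trans (Nat.pow_le_pow_right (by omega) (by omega))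

theorem length_le_of_isSolution {C c : ℝ} {I : List Word} {w : Word} {B : ℕ}
    (h : (offlineProblem S C c).IsSolution I w) (hI : (encodeWords I).length ≤ B) :
    w.length ≤ B := by
  obtain ⟨e, D, x, rfl, rfl, -⟩ := h
  rw [(S e).length_codeX]
  have := (instance_bounds e D hI).1
  omega

/-- Every instance has a solution, as the expected values are bounded and the tolerance is positive.
-/
theorem exists_solvedBy {C c : ℝ} (hC : 0 < C) :
    ∃ O, (offlineProblem S C c).SolvedBy O := by
  have : ∀ I, ∃ w, (offlineProblem S C c).IsInstance I → (offlineProblem S C c).IsSolution I w := by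
    intro I
    by_cases h : (offlineProblem S C c).IsInstance I
    · obtain ⟨e, D, rfl⟩ := h
      have := (S e).nonempty_X
      have hs : (0 : ℝ) < D.supportSize := by
        exact_mod_cast List.length_pos_of_ne_nil D.entries_ne_nil
      have hε : 0 < C / (D.supportSize : ℝ) ^ c := by positivity
      obtain ⟨x, hx⟩ := exists_lt_of_lt_ciSup (f := D.expect)
        (show D.opt - C / (D.supportSize : ℝ) ^ c < D.opt by linarith)
      exact ⟨(S e).codeX x, fun _ => ⟨e, D, x, rfl, rfl, D.isApproxOpt_of (by linarith)⟩⟩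
    · exact ⟨[], fun h' => absurd h' h⟩
  choose O hO using this
  exact ⟨O, hO⟩

open Classical in
/-- A learner with polynomial regret solves all instances of encoded length at most `B`, with error
probability at most `1 / M`, where the number of its steps is polynomial in `B` and `M`. -/
theorem Learner.exists_answer (A : Learner S) (hA : A.HasPolyRegret) {C c : ℝ} (hC : 0 < C)
    (B M : Polynomial ℕ) (hM : ∀ n, 1 ≤ M.eval n) :
    ∃ T K m : Polynomial ℕ, ∀ (n : ℕ) (I : List Word), (offlineProblem S C c).IsInstance I →
      (encodeWords I).length ≤ B.eval n →
        coinExpect (K.eval n + (T.eval n * K.eval n + m.eval n)) (fun r =>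
          if (offlineProblem S C c).IsSolution I
            (answer A.act A.coins (T.eval n) (K.eval n) I r) then 0 else 1) ≤
          1 / ((M.eval n : ℕ) : ℝ) := by
  obtain ⟨q, κ, hκ, hreg⟩ := hA
  -- `Z` bounds `|D| ^ c / C`, and `Q` bounds the numerator of the regret bound
  let Z : Polynomial ℕ := .C (⌈1 / C⌉₊ + 1) * (B + 1) ^ ⌈c⌉₊
  let Q : Polynomial ℕ := q.comp B
  -- the regret after `T` steps is at most `1 / (4 * M * Z)`
  let T : Polynomial ℕ := (4 * M * Z * (Q + 1)) ^ ⌈1 / κ⌉₊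
  -- the weights are below `2 ^ B`, so a function drawn by `K` bits has its expected values up
  -- to an error of `1 / (8 * M * Z)`; the summand `T` ensures `T ≤ 2 ^ K`
  let K : Polynomial ℕ := B + (8 * M * B * Z + T)
  refine ⟨T, K, A.coins.comp (B + T), fun n I hI hlen => ?_⟩
  obtain ⟨e, D, rfl⟩ := hI
  obtain ⟨hb, hs, hW⟩ := instance_bounds e D hlen
  set b := B.eval n with hbdef
  set M' := M.eval n with hM'
  set Z' := Z.eval n with hZ'
  set Q' := Q.eval n with hQ'
  set T' := T.eval n with hT'
  have hZe : Z' = (⌈1 / C⌉₊ + 1) * (b + 1) ^ ⌈c⌉₊ := by simp [hZ', Z, hbdef]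
  have hTe : T' = (4 * M' * Z' * (Q' + 1)) ^ ⌈1 / κ⌉₊ := by simp [hT', T, hM', hZ', hQ']
  have hKe : K.eval n = b + (8 * M' * b * Z' + T') := by
    simp [K, hT', hM', hZ', hbdef]
  have hQe : Q' = q.eval b := by simp [hQ', Q, hbdef]
  have hM1 : 1 ≤ M' := hM n
  have hZ1 : 1 ≤ Z' := by
    rw [hZe]; exact Nat.mul_pos (Nat.succ_pos _) (Nat.pow_pos (Nat.succ_pos _))
  have hY1 : 1 ≤ 4 * M' * Z' * (Q' + 1) := by
    have : 0 < M' * Z' * (Q' + 1) := by positivity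
    nlinarith
  have hT1 : 1 ≤ T' := by rw [hTe]; exact Nat.one_le_pow _ _ hY1
  have hMr : (1 : ℝ) ≤ M' := by exact_mod_cast hM1
  have hZr : (1 : ℝ) ≤ Z' := by exact_mod_cast hZ1
  have hTK : T' ≤ 2 ^ K.eval n := by
    rw [hKe]
    exact Nat.lt_two_pow_self.le.trans (Nat.pow_le_pow_right (by omega) (by omega))
  have hpow : (4 * M' * Z' * (Q' + 1) : ℝ) ≤ (T' : ℝ) ^ κ := by
    have h1 : (1 : ℝ) ≤ 4 * M' * Z' * (Q' + 1) := by exact_mod_cast hY1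
    rw [hTe]
    push_cast
    rw [← Real.rpow_natCast, ← Real.rpow_mul (by linarith)]
    calc (4 * M' * Z' * (Q' + 1) : ℝ) = (4 * M' * Z' * (Q' + 1) : ℝ) ^ (1 : ℝ) := by
          rw [Real.rpow_one]
      _ ≤ _ := Real.rpow_le_rpow_of_exponent_le h1 (by
          have h2 : 1 / κ ≤ (⌈1 / κ⌉₊ : ℝ) := Nat.le_ceil _
          calc (1 : ℝ) = 1 / κ * κ := by field_simp
            _ ≤ _ := by gcongr)
  have hε : ∀ f, A.regret e T' f ≤ Q' / (T' : ℝ) ^ κ := fun f => by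
    refine (hreg e T' hT1 f).trans ?_
    have : q.eval ((S e).b + (S e).v) ≤ Q' := by rw [hQe]; exact eval_mono q (by omega)
    gcongr
  refine (A.coinExpect_answer_le e D C c T' (K.eval n) _ hT1 hTK (by
    rw [Polynomial.eval_comp, Polynomial.eval_add]
    exact eval_mono _ (by omega)) _ hε hC).trans ?_
  have hsr : (1 : ℝ) ≤ D.supportSize := by
    exact_mod_cast List.length_pos_of_ne_nil D.entries_ne_nil
  have hsc : (D.supportSize : ℝ) ^ c / C ≤ Z' := by
    have h1 : (D.supportSize : ℝ) ^ c ≤ ((b : ℝ) + 1) ^ ⌈c⌉₊ := by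
      calc (D.supportSize : ℝ) ^ c ≤ (D.supportSize : ℝ) ^ (⌈c⌉₊ : ℝ) :=
            Real.rpow_le_rpow_of_exponent_le hsr (Nat.le_ceil _)
        _ = (D.supportSize : ℝ) ^ ⌈c⌉₊ := Real.rpow_natCast _ _
        _ ≤ _ := by
          gcongr
          exact_mod_cast Nat.le_succ_of_le hs
    have h2 : 1 / C ≤ (⌈1 / C⌉₊ : ℝ) + 1 := (Nat.le_ceil _).trans (by linarith)
    rw [hZe]
    push_cast
    calc (D.supportSize : ℝ) ^ c / C = 1 / C * (D.supportSize : ℝ) ^ c := by ring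
      _ ≤ _ := by gcongr
  have hη : ((S e).v * D.totalWeight / 2 ^ K.eval n : ℝ) ≤ 1 / (8 * M' * Z') := by
    have h1 : ((S e).v : ℝ) ≤ b := by exact_mod_cast (by omega : (S e).v ≤ b)
    have h2 : (D.totalWeight : ℝ) ≤ 2 ^ b := by exact_mod_cast hW
    have h3 : (8 * M' * b * Z' : ℝ) ≤ 2 ^ (8 * M' * b * Z' + T') := by
      exact_mod_cast Nat.lt_two_pow_self.le.trans
        (Nat.pow_le_pow_right (by omega) (Nat.le_add_right _ _))
    rw [hKe, pow_add, div_le_div_iff₀ (by positivity) (by positivity)]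
    calc ((S e).v * D.totalWeight : ℝ) * (8 * M' * Z') ≤ b * 2 ^ b * (8 * M' * Z') := by gcongr
      _ = 2 ^ b * (8 * M' * b * Z') := by ring
      _ ≤ _ := by rw [one_mul]; gcongr
  have hQT : Q' / (T' : ℝ) ^ κ ≤ 1 / (4 * M' * Z') := by
    have h1 : (0 : ℝ) < (T' : ℝ) ^ κ := by positivity
    rw [div_le_div_iff₀ h1 (by positivity)]
    have : (0 : ℝ) ≤ 4 * M' * Z' := by positivity
    nlinarith
  rw [div_div_eq_mul_div, mul_div_assoc]
  calc _ ≤ (2 * (1 / (4 * M' * Z')) + 4 * (1 / (8 * M' * Z')) : ℝ) * Z' := by gcongr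
    _ = 1 / M' := by field_simp; norm_num

end Parameters

/-! ### Simulating an oracle -/

/-- The state of the simulation: the verdict, or `[]` before the halt; the answers so far; and the
table of the queries with their answers, the newest first. -/
abbrev OracleState := Word × List Word × List Word

/-- One round of the simulation of an oracle computation. A new query `q` is answered by
`ans q b`, cut off to `B` bits. A repeated query gets the earlier answer again. -/
def oracleStep (R : List Word → List Word) (ans : List Word → Word → Word) (x : Word) (B : ℕ)
    (y : OracleState) (b : Word) : OracleState :=
  let m := R (x :: y.2.1)
  let key : Word := enc m.tail
  let t := seek key y.2.2
  let a := (bif t.isEmpty then ans m.tail b else t.tail.headD []).take B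
  bif !y.1.isEmpty then y else
  bif !(m.headD []).isEmpty then ([(m.headD []).headD false], y.2) else
  ([], y.2.1 ++ [a], bif t.isEmpty then key :: a :: y.2.2 else y.2.2)

/-- The table that lists the queries `p.1` and their answers `p.2`. -/
def queryTable (ps : List (List Word × Word)) : List Word :=
  flat (ps.map fun p => ((enc p.1 : Word), p.2))

theorem seek_queryTable (q : List Word) (ps : List (List Word × Word)) :
    (seek (enc q) (queryTable ps) = [] ∧ ∀ p ∈ ps, p.1 ≠ q) ∨
      ∃ a t, seek (enc q) (queryTable ps) = enc q :: a :: t ∧ (q, a) ∈ ps := by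
  rw [queryTable, seek_flat]
  induction ps with
  | nil => exact Or.inl ⟨rfl, by simp⟩
  | cons p ps ih =>
    by_cases h : p.1 = q
    · right
      refine ⟨p.2, flat (ps.map fun p => ((enc p.1 : Word), p.2)), ?_, by rw [← h]; simp⟩
      simp [h]
    · have h' : (enc p.1 : Word) ≠ enc q := fun h' => h (packWords_injective h')
      rw [List.map_cons, List.dropWhile_cons_of_pos (by simpa using h')]
      rcases ih with ⟨h1, h2⟩ | ⟨a, t, h1, h2⟩
      · exact Or.inl ⟨h1, by simpa using ⟨h, fun a b hab => h2 _ hab⟩⟩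
      · exact Or.inr ⟨a, t, h1, List.mem_cons_of_mem _ h2⟩

section Oracle

variable (P : SearchProblem) (L : Language Bool) (R : List Word → List Word) (x : Word) (B : ℕ)

/-- The invariant of the simulation after `k` rounds: it has halted with the right verdict, or with
every solving oracle that agrees with the table of answers, the computation decides correctly and
has at most `B - k` queries left. -/
def OracleInv (k : ℕ) (y : OracleState) : Prop :=
  (∃ a : Bool, y.1 = [a] ∧ (a = true ↔ x ∈ L)) ∨
    (y.1 = [] ∧ k ≤ B ∧ ∃ ps : List (List Word × Word), y.2.2 = queryTable ps ∧
      (∀ p ∈ ps, p.2.length ≤ B) ∧ (∃ O, P.SolvedBy O ∧ ∀ p ∈ ps, O p.1 = p.2) ∧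
      ∀ O, P.SolvedBy O → (∀ p ∈ ps, O p.1 = p.2) →
        ∃ a : Bool, (a = true ↔ x ∈ L) ∧ RunsTo P R O x a B (B - k) y.2.1)

variable {P L R x B}

/-- A round keeps the invariant if no new query is made, or if the new query is answered by a
solution. -/
theorem OracleInv.step (hB : ∀ q w, P.IsSolution q w → (encodeWords q).length ≤ B → w.length ≤ B)
    {ans : List Word → Word → Word} {k : ℕ} {y : OracleState} (h : OracleInv P L R x B k y) :
    (∀ b, OracleInv P L R x B (k + 1) (oracleStep R ans x B y b)) ∨
      ∃ q, P.IsInstance q ∧ (encodeWords q).length ≤ B ∧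
        ∀ b, P.IsSolution q (ans q b) → OracleInv P L R x B (k + 1) (oracleStep R ans x B y b) := by
  classical
  obtain ⟨v, h, tbl⟩ := y
  rcases h with ⟨a, h1, h2⟩ | ⟨h1, hk, ps, h2, h3, ⟨O, hO, hO'⟩, h4⟩
  · left
    intro b
    left
    exact ⟨a, by simp only at h1; simp [oracleStep, h1], h2⟩
  simp only at h1 h2 h4
  subst h1 h2
  obtain ⟨a, ha, hrun⟩ := h4 O hO hO'
  -- the next move does not depend on the choice of the oracle
  have hmove : R (x :: h) = [[a]] ∨ ∃ n q, B - k = n + 1 ∧ R (x :: h) = [] :: q ∧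
      P.IsInstance q ∧ (encodeWords q).length ≤ B := by
    cases hn : B - k with
    | zero => rw [hn] at hrun; exact Or.inl hrun
    | succ n =>
      rw [hn] at hrun
      rcases hrun with h | ⟨q, e1, e2, e3, -⟩
      · exact Or.inl h
      · exact Or.inr ⟨n, q, rfl, e1, e2, e3⟩
  rcases hmove with hm | ⟨n, q, hn, hm, hq, hlen⟩
  · left
    intro b
    left
    exact ⟨a, by simp [oracleStep, hm], ha⟩
  have hcont : ∀ O, P.SolvedBy O → (∀ p ∈ ps, O p.1 = p.2) → ∃ a : Bool, (a = true ↔ x ∈ L) ∧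
      RunsTo P R O x a B (B - (k + 1)) (h ++ [O q]) := by
    intro O hO hO'
    obtain ⟨a, ha, hrun⟩ := h4 O hO hO'
    rw [hn] at hrun
    refine ⟨a, ha, ?_⟩
    rcases hrun with h | ⟨q', e1, -, -, e4⟩
    · rw [hm] at h; simp at h
    · rw [hm] at e1
      obtain rfl : q = q' := by simpa using e1
      rwa [show B - (k + 1) = n by omega]
  rcases seek_queryTable q ps with ⟨hs, hnew⟩ | ⟨w, t, hs, hold⟩
  · right
    refine ⟨q, hq, hlen, fun b hsol => ?_⟩
    have hl := hB _ _ hsol hlen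
    have hstep : oracleStep R ans x B ([], h, queryTable ps) b =
        ([], h ++ [ans q b], queryTable ((q, ans q b) :: ps)) := by
      rw [show queryTable ((q, ans q b) :: ps) = enc q :: ans q b :: queryTable ps from rfl]
      simp [oracleStep, hm, hs, List.take_of_length_le hl]
    rw [hstep]
    refine Or.inr ⟨rfl, by omega, (q, ans q b) :: ps, rfl, ?_, ?_, ?_⟩
    · simpa [hl] using fun a b hab => h3 (a, b) hab
    · refine ⟨update O q (ans q b), fun I hI => ?_, ?_⟩
      · by_cases hIq : I = q
        · subst hIq; simpa using hsol
        · rw [update_of_ne hIq]; exact hO I hI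
      · intro p hp
        rcases List.mem_cons.1 hp with rfl | hp
        · simp
        · rw [update_of_ne (hnew p hp)]; exact hO' p hp
    · intro O₁ h5 h6
      have h7 := hcont O₁ h5 fun p hp => h6 p (List.mem_cons_of_mem _ hp)
      rwa [h6 (q, ans q b) (by simp)] at h7
  · left
    intro b
    have hl := h3 _ hold
    simp only at hl
    have hstep : oracleStep R ans x B ([], h, queryTable ps) b =
        ([], h ++ [w], queryTable ps) := by
      simp [oracleStep, hm, hs, List.take_of_length_le hl]
    rw [hstep]
    refine Or.inr ⟨rfl, by omega, ps, rfl, h3, ⟨O, hO, hO'⟩, fun O₁ h5 h6 => ?_⟩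
    have h7 := hcont O₁ h5 h6
    rwa [h6 (q, w) hold] at h7

/-- The simulation with `B + 1` rounds, enough for `B` queries and the halt. Each round uses `ρ`
random
bits. -/
def oracleRun (R : List Word → List Word) (ans : List Word → Word → Word) (x : Word) (B ρ : ℕ)
    (r : Word) : OracleState × Word :=
  (fun y : OracleState × Word => (oracleStep R ans x B y.1 (y.2.take ρ), y.2.drop ρ))^[B + 1]
    (([], [], []), r)

open Classical in
/-- A Turing reduction with each new query answered at random decides correctly, up to the sum of
the probabilities that an answer is wrong. -/
theorem coinExpect_oracleRun_le
    (hB : ∀ q w, P.IsSolution q w → (encodeWords q).length ≤ B → w.length ≤ B)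
    (hP : ∃ O, P.SolvedBy O)
    (hR : ∀ O, P.SolvedBy O → ∃ a : Bool, (a = true ↔ x ∈ L) ∧ RunsTo P R O x a B B [])
    {ans : List Word → Word → Word} {ρ : ℕ} {δ : ℝ} (hδ : 0 ≤ δ)
    (hans : ∀ q, P.IsInstance q → (encodeWords q).length ≤ B →
      coinExpect ρ (fun b => if P.IsSolution q (ans q b) then 0 else 1) ≤ δ) :
    coinExpect ((B + 1) * ρ) (fun r =>
      if (oracleRun R ans x B ρ r).1.1 = [decide (x ∈ L)] then 0 else 1) ≤ ((B : ℝ) + 1) * δ := by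
  have h0 : OracleInv P L R x B 0 ([], [], []) :=
    Or.inr ⟨rfl, Nat.zero_le _, [], rfl, by simp, by simpa using hP, fun O hO _ => hR O hO⟩
  have h1 := coinExpect_iterate (oracleStep R ans x B) ρ (OracleInv P L R x B) δ (by
    intro k y hy
    rcases hy.step hB (ans := ans) with h | ⟨q, h1, h2, h3⟩
    · simp only [h, if_true, coinExpect_const, hδ]
    · refine le_trans (coinExpect_mono fun b _ => ?_) (hans q h1 h2)
      by_cases h4 : P.IsSolution q (ans q b)
      · simp [h4, h3 b h4]
      · rw [if_neg h4]; split_ifs <;> norm_num) (B + 1) 0 _ h0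
  push_cast at h1
  refine le_trans (coinExpect_mono fun r _ => ?_) h1
  change _ ≤ ite (OracleInv P L R x B (0 + (B + 1)) (oracleRun R ans x B ρ r).1) (0 : ℝ) 1
  split_ifs with h2 h3 h3
  · exact le_rfl
  · norm_num
  · exfalso
    rcases h3 with ⟨a, h4, h5⟩ | ⟨-, h4, -⟩
    · apply h2
      rw [h4]
      congr 1
      rw [Bool.eq_iff_iff, h5, decide_eq_true_iff]
    · omega
  · exact le_rfl

end Oracle

/-! ### Deciding NP languages with small error probability -/

section PolynomialTime

variable {α : Type} [Enc α]

theorem length_oracleStep_verdict_le (R : List Word → List Word) (ans : List Word → Word → Word)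
    (x : Word) (B : ℕ) (y : OracleState) (b : Word) :
    (oracleStep R ans x B y b).1.length ≤ y.1.length + 1 := by
  dsimp only [oracleStep]
  cases y.1.isEmpty <;> cases ((R (x :: y.2.1)).headD []).isEmpty <;> simp

/-- The number of bits that one round adds to the answers and to the table. -/
theorem size_oracleStep_le (R : List Word → List Word) (ans : List Word → Word → Word)
    (x : Word) (B : ℕ) (y : OracleState) (b : Word) :
    size (oracleStep R ans x B y b).2.1 ≤ size y.2.1 + (2 * B + 1) ∧
      size (oracleStep R ans x B y b).2.2 ≤
        size y.2.2 + (2 * size (R (x :: y.2.1)) + 1 + (2 * B + 1)) := by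
  have h1 : ∀ w : Word, (w.take B).length ≤ B := fun w => List.length_take_le _ _
  have h2 := size_tail_words_le (R (x :: y.2.1))
  have h3 : (enc (R (x :: y.2.1)).tail : Word).length ≤ size (R (x :: y.2.1)) := by
    change size _ ≤ _; omega
  dsimp only [oracleStep]
  generalize R (x :: y.2.1) = m at *
  cases y.1.isEmpty
  · simp only [Bool.not_false, cond_true]; omega
  cases (m.headD []).isEmpty
  · simp only [Bool.not_true, Bool.not_false, cond_true, cond_false]; omega
  simp only [Bool.not_true, cond_false, size_words_append, size_words_cons, size_words_nil]
  refine ⟨Nat.add_le_add_left (by have := h1 (bif (seek (enc m.tail) y.2.2).isEmpty then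
    ans m.tail b else (seek (enc m.tail) y.2.2).tail.headD []); omega) _, ?_⟩
  cases (seek (enc m.tail) y.2.2).isEmpty
  · simp only [cond_false]; omega
  · simp only [cond_true, size_words_cons]
    have := h1 (ans m.tail b)
    omega

theorem PT.oracleRun_comp {R : List Word → List Word} (hR : PT R)
    {ans : α → List Word → Word → Word}
    (hans : PT fun z : α × List Word × Word => ans z.1 z.2.1 z.2.2) {x : α → Word} {B ρ : α → ℕ}
    {r : α → Word} (hx : PT x) (hB : PT B) (hρ : PT ρ) (hr : PT r) :
    PT (fun a => oracleRun R (ans a) (x a) (B a) (ρ a) (r a)) := by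
  obtain ⟨p, hp⟩ := hR.polyBdd_size
  have hstep : PT fun z : α × OracleState × Word =>
      (oracleStep R (ans z.1) (x z.1) (B z.1) z.2.1 (z.2.2.take (ρ z.1)), z.2.2.drop (ρ z.1)) := by
    have h : PT fun z : α × OracleState × Word =>
        ans z.1 (R (x z.1 :: z.2.1.2.1)).tail (z.2.2.take (ρ z.1)) :=
      hans.comp (f := fun z : α × OracleState × Word =>
        (z.1, (R (x z.1 :: z.2.1.2.1)).tail, z.2.2.take (ρ z.1))) (by fun_prop)
    have hk : PT fun z : α × OracleState × Word => (enc (R (x z.1 :: z.2.1.2.1)).tail : Word) :=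
      PT.encode.comp (by fun_prop)
    simp only [oracleStep]
    fun_prop
  -- bounds for the answers and for one entry of the table
  let H : α → ℕ := fun a => (B a + 1) * (2 * B a + 1)
  let E : α → ℕ := fun a => 2 * p.eval (2 * size (x a) + 1 + H a) + 1 + (2 * B a + 1)
  have hBb := hB.polyBdd
  have hxb := hx.polyBdd_size
  have hrb := hr.polyBdd_size
  have hH : PolyBdd H := by unfold H; fun_prop
  have hE : PolyBdd E := by
    have : PolyBdd fun a => p.eval (2 * size (x a) + 1 + H a) :=
      PolyBdd.exists_mono (by fun_prop) p
    unfold E; fun_prop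
  refine PT.iterate (step := fun a (y : OracleState × Word) =>
      (oracleStep R (ans a) (x a) (B a) y.1 (y.2.take (ρ a)), y.2.drop (ρ a)))
    (n := fun a => B a + 1) (s := fun a => ((([], [], []) : OracleState), r a)) hstep
    (by fun_prop) (by fun_prop)
    (S := fun a => 2 * (2 * (B a + 1) + (2 * H a + (B a + 1) * E a + 1) + 1) + size (r a) + 1)
    (by fun_prop) fun a k hk => ?_
  have key : ∀ k ≤ B a + 1, ∀ y, (fun y : OracleState × Word =>
      (oracleStep R (ans a) (x a) (B a) y.1 (y.2.take (ρ a)), y.2.drop (ρ a)))^[k]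
        ((([], [], []) : OracleState), r a) = y →
      y.1.1.length ≤ k ∧ size y.1.2.1 ≤ k * (2 * B a + 1) ∧ size y.1.2.2 ≤ k * E a ∧
        y.2.length ≤ (r a).length := by
    intro k
    induction k with
    | zero => rintro - _ rfl; simp [size_words_nil]
    | succ k ih =>
      rintro hk _ rfl
      rw [iterate_succ_apply']
      obtain ⟨h1, h2, h3, h4⟩ := ih (by omega) _ rfl
      generalize (fun y : OracleState × Word =>
        (oracleStep R (ans a) (x a) (B a) y.1 (y.2.take (ρ a)), y.2.drop (ρ a)))^[k] _ = y at *
      dsimp only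
      have h5 := length_oracleStep_verdict_le R (ans a) (x a) (B a) y.1 (y.2.take (ρ a))
      obtain ⟨h6, h7⟩ := size_oracleStep_le R (ans a) (x a) (B a) y.1 (y.2.take (ρ a))
      have h8 : size (R (x a :: y.1.2.1)) ≤ p.eval (2 * size (x a) + 1 + H a) := by
        refine (hp _).trans (eval_mono p ?_)
        rw [size_words_cons]
        refine Nat.add_le_add_left (h2.trans ?_) _
        exact Nat.mul_le_mul_right _ (by omega)
      refine ⟨by omega, ?_, ?_, ?_⟩
      · rw [Nat.succ_mul k]; omega
      · have : E a = 2 * p.eval (2 * size (x a) + 1 + H a) + 1 + (2 * B a + 1) := rfl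
        rw [Nat.succ_mul k]; omega
      · simp only [List.length_drop]; omega
  obtain ⟨h1, h2, h3, h4⟩ := key k hk _ rfl
  have h5 : k * (2 * B a + 1) ≤ H a := Nat.mul_le_mul_right _ hk
  have h6 : k * E a ≤ (B a + 1) * E a := Nat.mul_le_mul_right _ hk
  simp only [size_pair, size_word]
  omega

end PolynomialTime

variable {S : Word → Setting}

open Classical in
/-- A learner with polynomial regret allows to decide every language that reduces to the offline
problem by a randomized polynomial-time machine with two-sided error `1 / (s + 1)`. -/
theorem Learner.exists_decider (A : Learner S) (hA : A.HasPolyRegret) {C c : ℝ} (hC : 0 < C)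
    {L : Language Bool} (hL : TuringReduces L (offlineProblem S C c)) (s : Polynomial ℕ) :
    ∃ (M : List Word → List Word) (m : Polynomial ℕ), PT M ∧ ∀ x : Word,
      coinExpect (m.eval x.length) (fun r => if M [x, r] = [[decide (x ∈ L)]] then 0 else 1) ≤
        1 / (((s.eval x.length : ℕ) : ℝ) + 1) := by
  obtain ⟨R, B, hR, hred⟩ := hL
  obtain ⟨T, K, m, hans⟩ := A.exists_answer hA hC (c := c) B ((s + 1) * (B + 1)) fun n => by
    simp only [Polynomial.eval_mul, Polynomial.eval_add, Polynomial.eval_one]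
    nlinarith [Nat.zero_le (s.eval n), Nat.zero_le (B.eval n)]
  let ρ : Polynomial ℕ := K + (T * K + m)
  let M : List Word → List Word := fun l =>
    [(oracleRun R (answer A.act A.coins (T.eval (l.headD []).length) (K.eval (l.headD []).length))
      (l.headD []) (B.eval (l.headD []).length) (ρ.eval (l.headD []).length)
      (l.tail.headD [])).1.1]
  refine ⟨M, (B + 1) * ρ, ?_, fun x => ?_⟩
  · have h1 : PT fun z : List Word × List Word × Word => answer A.act A.coins
        (T.eval (z.1.headD []).length) (K.eval (z.1.headD []).length) z.2.1 z.2.2 :=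
      PT.answer_comp (PT.of_polyTime A.act_polyTime) _ (by fun_prop) (by fun_prop) (by fun_prop)
        (by fun_prop)
    have h2 : PT fun l : List Word => (oracleRun R
        (answer A.act A.coins (T.eval (l.headD []).length) (K.eval (l.headD []).length))
        (l.headD []) (B.eval (l.headD []).length) (ρ.eval (l.headD []).length)
        (l.tail.headD [])).1.1 :=
      (PT.oracleRun_comp (PT.of_polyTime hR) (ans := fun l : List Word => answer A.act A.coins
        (T.eval (l.headD []).length) (K.eval (l.headD []).length)) h1 (by fun_prop) (by fun_prop)
        (by fun_prop) (by fun_prop)).fst.fst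
    unfold M
    fun_prop
  · have h1 := coinExpect_oracleRun_le (P := offlineProblem S C c) (L := L) (R := R) (x := x)
      (B := B.eval x.length) (fun q w h h' => length_le_of_isSolution h h')
      (exists_solvedBy hC) (fun O hO => hred O hO x)
      (ans := answer A.act A.coins (T.eval x.length) (K.eval x.length)) (ρ := ρ.eval x.length)
      (δ := 1 / (((s + 1) * (B + 1)).eval x.length : ℕ)) (by positivity) (fun q hq hl => by
        have := hans x.length q hq hl
        simpa [ρ] using this)
    have e : ((B + 1) * ρ).eval x.length = (B.eval x.length + 1) * ρ.eval x.length := by simp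
    rw [e]
    refine le_trans (coinExpect_mono fun r _ => ?_) (h1.trans (le_of_eq ?_))
    · refine le_of_eq ?_
      congr 1
      simp [M]
    · simp only [Polynomial.eval_mul, Polynomial.eval_add, Polynomial.eval_one]
      push_cast
      have : ((B.eval x.length : ℕ) : ℝ) + 1 ≠ 0 := by positivity
      have : ((s.eval x.length : ℕ) : ℝ) + 1 ≠ 0 := by positivity
      field_simp

/-! ### Searching for a witness -/

section Witness

variable (V : List Word → List Word) (p : Polynomial ℕ)

/-- The pairs of a word `x` and a prefix of a witness of `x`, for the verifier `V` and witnesses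
whose length is bounded by `p`. -/
def prefixLanguage : Language Bool :=
  {y | ∃ w : Word, (unpairWord y).2.length + w.length ≤ p.eval (unpairWord y).1.length ∧
    V [(unpairWord y).1, (unpairWord y).2 ++ w] = [[true]]}

variable {V p}

theorem pairWord_mem_prefixLanguage {x u : Word} : pairWord x u ∈ prefixLanguage V p ↔
    ∃ w : Word, u.length + w.length ≤ p.eval x.length ∧ V [x, u ++ w] = [[true]] := by
  change (∃ w : Word, _) ↔ _
  rw [unpairWord_pairWord]

theorem inNP_prefixLanguage (hV : PT V) : InNP (prefixLanguage V p) := by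
  have h1 : PT fun y : Word => (unpairWord y).1 := PT.of_word polyComputable_fst _ fun _ => rfl
  have h2 : PT fun y : Word => (unpairWord y).2 := PT.of_word polyComputable_snd _ fun _ => rfl
  let acc : Word → Word → Bool := fun y w =>
    decide ((unpairWord y).2.length + w.length ≤ p.eval (unpairWord y).1.length) &&
      decide (V [(unpairWord y).1, (unpairWord y).2 ++ w] = [[true]])
  refine ⟨fun l => bif acc (l.headD []) (l.tail.headD []) then [[true]] else [], p,
    PT.polyTime ?_, fun y => ?_⟩
  · have h3 : PT fun l : List Word => (unpairWord (l.headD [])).1 := h1.comp (by fun_prop)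
    have h4 : PT fun l : List Word => (unpairWord (l.headD [])).2 := h2.comp (by fun_prop)
    unfold acc
    fun_prop
  · have h5 := length_unpairWord y
    have e : ∀ w : Word, (bif acc y w then [[true]] else []) = ([[true]] : List Word) ↔
        acc y w = true := fun w => by cases acc y w <;> simp
    change (∃ w : Word, _) ↔ ∃ w : Word, _ ∧ (bif acc y w then [[true]] else []) = [[true]]
    simp only [e, acc, Bool.and_eq_true, decide_eq_true_iff]
    refine exists_congr fun w => ⟨fun h => ⟨?_, h⟩, fun h => h.2⟩
    have := eval_mono p (show (unpairWord y).1.length ≤ y.length by omega)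
    omega

/-- One round of the search: extend the prefix `u` of a witness by the bit that the randomized
machine `M` proposes, unless `u` is a witness. -/
def searchStep (V M : List Word → List Word) (m : Polynomial ℕ) (x u b : Word) : Word :=
  bif decide (V [x, u] = [[true]]) then u else
    u ++ [decide (M [pairWord x (u ++ [true]),
      b.take (m.eval (pairWord x (u ++ [true])).length)] = [[true]])]

/-- The result of `N` rounds of the search with `ρ` random bits each. -/
def search (V M : List Word → List Word) (m : Polynomial ℕ) (x : Word) (N ρ : ℕ) (r : Word) :
    Word :=
  ((fun y : Word × Word => (searchStep V M m x y.1 (y.2.take ρ), y.2.drop ρ))^[N] ([], r)).1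

theorem PT.search_comp {α : Type} [Enc α] {M : List Word → List Word} (hV : PT V) (hM : PT M)
    (m : Polynomial ℕ) {x r : α → Word} {N ρ : α → ℕ} (hx : PT x) (hN : PT N) (hρ : PT ρ)
    (hr : PT r) : PT (fun a => search V M m (x a) (N a) (ρ a) (r a)) := by
  refine PT.fst (PT.iterate_add (step := fun a (y : Word × Word) =>
    (searchStep V M m (x a) y.1 (y.2.take (ρ a)), y.2.drop (ρ a))) ?_ hN (by fun_prop)
    (S := fun _ => 2) (by fun_prop) fun a y => ?_)
  · have h : PT fun z : α × Word × Word => pairWord (x z.1) (z.2.1 ++ [true]) :=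
      PT.encode.comp (f := fun z : α × Word × Word => (x z.1, z.2.1 ++ [true])) (by fun_prop)
    unfold searchStep
    fun_prop
  · have h : (searchStep V M m (x a) y.1 (y.2.take (ρ a))).length ≤ y.1.length + 1 := by
      unfold searchStep
      cases decide (V [x a, y.1] = [[true]]) <;> simp
    simp only [size_pair, size_word, List.length_drop]
    omega

/-- The invariant of the search after `k` rounds: `u` is a prefix of a witness of `x`, and `u` is
itself a witness unless its length is `k`. -/
def SearchInv (V : List Word → List Word) (p : Polynomial ℕ) (x : Word) (k : ℕ) (u : Word) : Prop :=
  (∃ w : Word, u.length + w.length ≤ p.eval x.length ∧ V [x, u ++ w] = [[true]]) ∧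
    (V [x, u] = [[true]] ∨ u.length = k)

open Classical in
/-- A round of the search fails only if the randomized machine errs. -/
theorem SearchInv.step {M : List Word → List Word} {m : Polynomial ℕ}
    (hM : ∀ y : Word, coinExpect (m.eval y.length)
      (fun r => if M [y, r] = [[decide (y ∈ prefixLanguage V p)]] then 0 else 1) ≤
        1 / (((2 * p).eval y.length : ℕ) + 1 : ℝ)) {x : Word} {k : ℕ} {u : Word}
    (h : SearchInv V p x k u) :
    coinExpect (m.eval (2 * x.length + p.eval x.length + 1))
      (fun b => if SearchInv V p x (k + 1) (searchStep V M m x u b) then 0 else 1) ≤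
        1 / (2 * (p.eval x.length : ℕ) + 1 : ℝ) := by
  by_cases hu : V [x, u] = [[true]]
  · have e : ∀ b, SearchInv V p x (k + 1) (searchStep V M m x u b) := fun b => by
      rw [searchStep, hu]
      exact ⟨h.1, Or.inl hu⟩
    simp only [e, if_true, coinExpect_const]
    positivity
  obtain ⟨⟨w, hw, hacc⟩, hk⟩ := h
  have hk := hk.resolve_left hu
  obtain ⟨c, w, rfl⟩ : ∃ c w', w = c :: w' := by
    cases w with
    | nil => rw [List.append_nil] at hacc; exact absurd hacc hu
    | cons c w => exact ⟨c, w, rfl⟩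
  set y := pairWord x (u ++ [true]) with hy
  have hlen : y.length = 2 * x.length + (u.length + 1) + 1 := by simp [hy, length_pairWord]
  rw [List.length_cons] at hw
  refine le_trans (le_trans (coinExpect_mono (h := fun b =>
      if M [y, b.take (m.eval y.length)] = [[decide (y ∈ prefixLanguage V p)]] then 0 else 1)
    fun b _ => ?_) ((coinExpect_take (eval_mono m (by omega)) (fun b =>
      if M [y, b] = [[decide (y ∈ prefixLanguage V p)]] then 0 else 1)).le.trans (hM y))) ?_
  · by_cases hb : M [y, b.take (m.eval y.length)] = [[decide (y ∈ prefixLanguage V p)]]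
    · have hstep : searchStep V M m x u b = u ++ [decide (y ∈ prefixLanguage V p)] := by
        simp [searchStep, hu, ← hy, hb]
      rw [if_pos hb, if_pos]
      rw [hstep]
      refine ⟨?_, Or.inr (by simp [hk])⟩
      by_cases hmem : y ∈ prefixLanguage V p
      · rw [decide_eq_true hmem]
        exact pairWord_mem_prefixLanguage.1 hmem
      · rw [decide_eq_false hmem]
        -- the next bit of the witness cannot be `true`
        have hc : c = false := by
          cases c with
          | false => rfl
          | true => exact absurd (pairWord_mem_prefixLanguage.2
              ⟨w, by simp; omega, by simpa using hacc⟩) hmem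
        subst hc
        exact ⟨w, by simp; omega, by simpa using hacc⟩
    · rw [if_neg hb]
      split_ifs <;> norm_num
  · have h1 : p.eval x.length ≤ p.eval y.length := eval_mono p (by omega)
    have h2 : (2 * p).eval y.length = 2 * p.eval y.length := by simp
    rw [h2]
    push_cast
    gcongr

end Witness

variable {S : Word → Setting}

/-- If the offline problem is hard, a learner with polynomial regret puts NP into RP: the witness is
found bit by bit, by deciding the language of the prefixes of witnesses. -/
theorem Learner.inRP (A : Learner S) (hA : A.HasPolyRegret) {C c : ℝ} (hC : 0 < C)
    (hard : (offlineProblem S C c).NPHard) {L : Language Bool} (hL : InNP L) : InRP L := by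
  classical
  obtain ⟨V, p, hV, hVL⟩ := hL
  have hV' := PT.of_polyTime hV
  obtain ⟨M, m, hM, herr⟩ :=
    -- with error below `1 / (2 * p)` per round, `p` rounds succeed with probability `1 / 2`
    A.exists_decider hA hC
    (hard _ (inNP_prefixLanguage (p := p) hV')) (2 * p)
  -- a query is a pair of `x` and a nonempty prefix of at most `p` bits
  let ρ : Polynomial ℕ := m.comp (2 * .X + p + 1)
  have hρ : ∀ n, ρ.eval n = m.eval (2 * n + p.eval n + 1) := fun n => by simp [ρ]
  let u : Word → Word → Word := fun x r => search V M m x (p.eval x.length) (ρ.eval x.length) r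
  let acc : Word → Word → Bool := fun x r =>
    decide ((u x r).length ≤ p.eval x.length) && decide (V [x, u x r] = [[true]])
  let M' : List Word → List Word := fun l =>
    bif acc (l.headD []) (l.tail.headD []) then [[true]] else []
  have hM' : ∀ x r, M' [x, r] = [[true]] ↔
      (u x r).length ≤ p.eval x.length ∧ V [x, u x r] = [[true]] := fun x r => by
    change (bif acc x r then [[true]] else []) = [[true]] ↔ _
    have : acc x r = true ↔
        (u x r).length ≤ p.eval x.length ∧ V [x, u x r] = [[true]] := by
      simp only [acc, Bool.and_eq_true, decide_eq_true_iff]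
    rw [← this]
    cases acc x r <;> simp
  refine ⟨M', p * ρ, PT.polyTime ?_, fun x => ⟨fun hx => ?_, fun hx r _ h => ?_⟩⟩
  · have h : PT fun l : List Word => u (l.headD []) (l.tail.headD []) :=
      PT.search_comp hV' hM m (by fun_prop) (by fun_prop) (by fun_prop) (by fun_prop)
    have h' : ∀ U : List Word → Word, PT U → PT fun l =>
        bif decide ((U l).length ≤ p.eval (l.headD []).length) &&
          decide (V [l.headD [], U l] = [[true]]) then ([[true]] : List Word) else [] :=
      fun U hU => by fun_prop
    exact h' _ h
  · obtain ⟨w, hw, hacc⟩ := (hVL x).1 hx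
    have h0 : SearchInv V p x 0 [] := ⟨⟨w, by simpa using hw, hacc⟩, Or.inr rfl⟩
    have h1 := coinExpect_iterate (searchStep V M m x) (ρ.eval x.length) (SearchInv V p x)
      (1 / (2 * (p.eval x.length : ℕ) + 1 : ℝ)) (fun k v hv => by
        rw [hρ]; exact hv.step herr) (p.eval x.length) 0 [] h0
    have h2 : ((p.eval x.length : ℕ) : ℝ) * (1 / (2 * (p.eval x.length : ℕ) + 1 : ℝ)) ≤ 1 / 2 := by
      rw [mul_one_div, div_le_div_iff₀ (by positivity) (by norm_num)]
      linarith
    rw [show (p * ρ).eval x.length = p.eval x.length * ρ.eval x.length by simp]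
    set n := p.eval x.length * ρ.eval x.length
    refine le_trans (b := coinExpect n fun r => 1 -
      if SearchInv V p x (0 + p.eval x.length) (u x r) then 0 else 1) ?_
      (coinExpect_mono fun r _ => ?_)
    · rw [coinExpect_sub_fun, coinExpect_const]
      change coinExpect n (fun r =>
        if SearchInv V p x (0 + p.eval x.length) (u x r) then 0 else 1) ≤ _ at h1
      linarith [h1.trans h2]
    · by_cases hi : SearchInv V p x (0 + p.eval x.length) (u x r)
      · have : M' [x, r] = [[true]] := by
          obtain ⟨⟨w, h3, h4⟩, h5⟩ := hi
          refine (hM' x r).2 ⟨by omega, ?_⟩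
          rcases h5 with h5 | h5
          · exact h5
          · have : w = [] := List.length_eq_zero_iff.1 (by omega)
            rwa [this, List.append_nil] at h4
        rw [if_pos hi, if_pos this, sub_zero]
      · rw [if_neg hi, sub_self]
        split_ifs <;> norm_num
  · exact hx ((hVL x).2 ⟨u x r, (hM' x r).1 h⟩)

end OnlineTransfer

theorem mainTheorem3 (S : OnlineTransfer.Word → OnlineTransfer.Setting) (C c : ℝ)
    (hC : 0 < C) (hc : 0 < c)
    (hard : (OnlineTransfer.offlineProblem S C c).NPHard)
    (hRP : ¬ ∀ L : Language Bool, OnlineTransfer.InNP L → OnlineTransfer.InRP L) :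
    ¬ ∃ A : OnlineTransfer.Learner S, A.HasPolyRegret := by
  rintro ⟨A, hA⟩
  exact hRP fun _ hL => A.inRP hA hC hard hL
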